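/- Throughout, $\mathbb N$ is the set of positive integers, $\pi(k)$ is the set of primes dividing $k$, $k_p$ is the largest power of the prime $p$ dividing $k$, and $k_\mu=\prod_{p\in\mu}k_p$ for a set $\mu$ of primes; $\mu'$ is the complement of $\mu$ in the set of all primes, and $2'=\{2\}'$. $\mathcal U_m$ is the group of units of $\mathbb Z/m\mathbb Z$, $[t]_m$ is the class of $t$, and $\langle t\rangle_m$ is the subgroup of $\mathcal U_m$ generated by $[t]_m$. For $q\mid m$, $\mathrm{Res}_q:\mathcal U_m\to\mathcal U_q$ is the natural map. For a subgroup $T\le\mathcal U_m$, $T_\mu$ is its Hall $\mu$-subgroup, $T_p=T_{\{p\}}$. For a cyclic subgroup $T\le \mathcal U_m$ let $[T]=(r,\epsilon,o)$, where $r$ is the greatest divisor of $m$ such that $\mathrm{Res}_{r_{2'}}(T)=1$ and $\mathrm{Res}_{r_2}(T)\subseteq\langle -1\rangle_{r_2}$; $\epsilon=-1$ if $\mathrm{Res}_{r_2}(T)\neq 1$ and $\epsilon=1$ otherwise; and $o=|\mathrm{Res}_{m_\nu}(T_{\nu'})|$ with $\nu=\pi(m)\setminus\pi(r)$. For $n,s\in\mathbb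 N$ put $[T,n,s]=m_\nu\prod_{p\in\pi(r)}m'_p$, where, if $\epsilon^{p-1}=1$, $$m'_p=\min\Bigl(m_p,\;o_pr_p,\;\max\bigl(r_p,\;s_p,\;r_p\tfrac{s_po_p}{n_p}\bigr)\Bigr),$$ and, if $\epsilon=-1$, $$m'_2=\begin{cases} r_2,&\text{if } o_2\le 2\text{ or }m_2\le 2r_2;\\ m_2/2,&\text{if } 4\le o_2<n_2,\ 4r_2\le m_2,\text{ and if } s_2\ne n_2r_2 \text{ then } 2s_2=m_2<n_2r_2;\\ m_2,&\text{otherwise.}\end{cases}$$ The number $m'=[T,n,s]$ divides $m$, and $m'_p$ is its $p$-part (in particular $m'_p=1$ if $p\nmid m$). Let $\mathcal U_m^{n,s}=\{[t]_m: m\mid s(t-1),\ t^n\equiv 1 \bmod m\}$. For $s\mid m$, a cyclic subgroup $T\le\mathcal U_m$ with $[T]=(r,\epsilon,o)$ and $\pi=\pi(r)\cup(\pi(n)\setminus\pi(m))$ is called $(n,s)$-canonical if $T\subseteq\mathcal U_m^{n,s}$ and * if $\epsilon=-1$ then $s_2\neq r_2n_2$; if moreover $m_2\ge 8$, $n_2\ge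 4$ and $o_2<n_2$, then $r_2\le s_2$; * for every $p\in\pi$ with $\epsilon^{p-1}=1$: $s_p\mid n$, and either $r_p\mid s$ or $s_po_p\nmid n$. If $T=\langle t\rangle_m\subseteq\mathcal U_m^{n,s}$, let $\mathcal G_{m,n,s,T}=\mathcal G_{m,n,s,t}=\langle a,b\mid a^m=1,\ b^n=a^s,\ b^{-1}ab=a^t\rangle$; up to isomorphism it does not depend on the choice of the generator $[t]_m$ of $T$. **Theorem.** Let $m,n,s\in\mathbb N$ with $s\mid m$ and let $T$ and $\bar T$ be $(n,s)$-canonical cyclic subgroups of $\mathcal U_m$. Let $[T]=(r,\epsilon,o)$, $[\bar T]=(\bar r,\bar\epsilon,\bar o)$, $\pi=\pi(r)\cup(\pi(n)\setminus\pi(m))$, $\bar\pi=\pi(\bar r)\cup(\pi(n)\setminus\pi(m))$, $m'=[T,n,s]$ and $\bar m'=[\bar T,n,s]$. The following are equivalent, for any choice of the generators of $T$ and $\bar T$ used in (1): 1. $\mathcal G_{m,n,s,T}\cong\mathcal G_{m,n,s,\bar T}$. 2. $m'=\bar m'$ and $\mathrm{Res}_{m'}(T)=\mathrm{Res}_{\bar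 m'}(\bar T)$. 3. $\pi=\bar\pi$, $\mathrm{Res}_{m_{\pi'}}(T_{\pi'})=\mathrm{Res}_{m_{\pi'}}(\bar T_{\pi'})$, and for every $p\in\pi$: $m'_p=\bar m'_p$ and $\mathrm{Res}_{m_{\pi'}m'_p}(T_p)=\mathrm{Res}_{m_{\pi'}m'_p}(\bar T_p)$. -/

import Mathlib

namespace Metacyclic

/-- `m_p`: the largest power of the prime `p` dividing `m` (for `m` positive). -/
def pPart (p m : ℕ) : ℕ := p ^ m.factorization p

open Classical in
/-- `m_π`: the product of the `m_p` over the primes `p` in `π`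
(primes not dividing `m` contribute the factor `1`). -/
noncomputable def setPart (π : Set ℕ) (m : ℕ) : ℕ :=
  ∏ p ∈ m.primeFactors with p ∈ π, pPart p m

/-- The Hall `π`-subgroup of a subgroup `T` of a finite abelian group: the elements of `T` all of
whose order's prime divisors lie in `π`. -/
def hallPart {G : Type*} [CommGroup G] (π : Set ℕ) (T : Subgroup G) : Subgroup G where
  carrier := {x | x ∈ T ∧ ∀ p : ℕ, p.Prime → p ∣ orderOf x → p ∈ π}
  one_mem' := by
    refine ⟨T.one_mem, fun p hp h => ?_⟩
    rw [orderOf_one] at h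
    exact absurd (Nat.dvd_one.mp h) hp.ne_one
  mul_mem' := by
    rintro x y ⟨hx, hx2⟩ ⟨hy, hy2⟩
    refine ⟨T.mul_mem hx hy, fun p hp h => ?_⟩
    have h1 : p ∣ orderOf x * orderOf y :=
      (h.trans (Commute.all x y).orderOf_mul_dvd_lcm).trans (Nat.lcm_dvd_mul _ _)
    rcases hp.dvd_mul.mp h1 with h2 | h2
    · exact hx2 p hp h2
    · exact hy2 p hp h2
  inv_mem' := by
    rintro x ⟨hx, hx2⟩
    refine ⟨T.inv_mem hx, fun p hp h => hx2 p hp ?_⟩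
    rwa [orderOf_inv] at h

/-- `Res_q(T)`: the image of `T ≤ U_m` under the natural map `U_m → U_q`, for `q ∣ m`. -/
def res {q m : ℕ} (h : q ∣ m) (T : Subgroup (ZMod m)ˣ) : Subgroup (ZMod q)ˣ :=
  T.map (ZMod.unitsMap h)

theorem pPart_dvd (p m : ℕ) : pPart p m ∣ m := Nat.ordProj_dvd m p

theorem setPart_dvd (π : Set ℕ) (m : ℕ) : setPart π m ∣ m := by
  classical
  rcases Nat.eq_zero_or_pos m with rfl | hm
  · exact dvd_zero _
  · have h : ∏ p ∈ m.primeFactors, pPart p m = m :=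
      Nat.prod_factorization_pow_eq_self hm.ne'
    unfold setPart
    conv_rhs => rw [← h]
    convert Finset.prod_dvd_prod_of_subset _ _ (fun p => pPart p m)
      (Finset.filter_subset (fun p => p ∈ π) m.primeFactors)

/-- The condition on a divisor `d` of `m` in the definition of the invariant `r`:
`Res` of `T` to the odd part of `d` is trivial, and `Res` of `T` to the `2`-part of `d` is
contained in the subgroup generated by `-1`. -/
def IsAdmissible {m : ℕ} (T : Subgroup (ZMod m)ˣ) (d : ℕ) : Prop :=
  ∃ h : d ∣ m,
    res ((Nat.ordCompl_dvd d 2).trans h) T = ⊥ ∧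
    res ((pPart_dvd 2 d).trans h) T ≤ Subgroup.zpowers (-1)

open Classical in
/-- The invariant `r` of `T`: the greatest admissible divisor of `m`. -/
noncomputable def rInv {m : ℕ} (T : Subgroup (ZMod m)ˣ) : ℕ :=
  Nat.findGreatest (IsAdmissible T) m

theorem rInv_dvd {m : ℕ} (T : Subgroup (ZMod m)ˣ) : rInv T ∣ m := by
  classical
  by_cases h : rInv T = 0
  · rcases Nat.eq_zero_or_pos m with rfl | hm
    · exact dvd_zero _
    · exfalso
      have h1 : IsAdmissible T 1 := by
        refine ⟨one_dvd m, ?_, ?_⟩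
        · have : Subsingleton (ZMod (1 / 2 ^ (Nat.factorization 1) 2)) := by
            rw [Nat.factorization_one]
            exact inferInstanceAs (Subsingleton (ZMod 1))
          exact Subsingleton.elim _ _
        · have : Subsingleton (ZMod (pPart 2 1)) := by
            unfold pPart
            rw [Nat.factorization_one]
            exact inferInstanceAs (Subsingleton (ZMod 1))
          exact (Subsingleton.elim _ _ : res _ T = Subgroup.zpowers (-1)).le
      have h2 : 1 ≤ rInv T := Nat.le_findGreatest hm h1
      omega
  · exact (Nat.findGreatest_of_ne_zero (P := IsAdmissible T) (n := m) rfl h).1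

open Classical in
/-- The invariant `ε` of `T`. -/
noncomputable def epsInv {m : ℕ} (T : Subgroup (ZMod m)ˣ) : ℤ :=
  if res ((pPart_dvd 2 (rInv T)).trans (rInv_dvd T)) T ≠ ⊥ then -1 else 1

/-- The set `ν` of primes dividing `m` but not `r`. -/
noncomputable def nuSet {m : ℕ} (T : Subgroup (ZMod m)ˣ) : Finset ℕ :=
  m.primeFactors \ (rInv T).primeFactors

/-- The invariant `o` of `T`: the order of the restriction modulo `m_ν` of the
Hall subgroup of `T` for the set of primes not in `ν`. -/
noncomputable def oInv {m : ℕ} (T : Subgroup (ZMod m)ˣ) : ℕ :=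
  Nat.card (res (setPart_dvd (nuSet T) m) (hallPart ((nuSet T : Set ℕ)ᶜ) T))

open Classical in
/-- The number `m'_p`, for a prime `p` dividing `r`. In the first case all the quantities are
powers of `p`; the natural number quotient is the exact one unless the exact one is less than `1`,
when it is `0` and does not affect the maximum. In the second case `p = 2` and `ε = -1`. -/
noncomputable def localPart {m : ℕ} (T : Subgroup (ZMod m)ˣ) (n s p : ℕ) : ℕ :=
  if epsInv T ^ (p - 1) = 1 then
    min (pPart p m)
      (min (pPart p (oInv T) * pPart p (rInv T))
        (max (pPart p (rInv T))
          (max (pPart p s) (pPart p (rInv T) * pPart p s * pPart p (oInv T) / pPart p n))))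
  else if pPart 2 (oInv T) ≤ 2 ∨ pPart 2 m ≤ 2 * pPart 2 (rInv T) then
    pPart 2 (rInv T)
  else if 4 ≤ pPart 2 (oInv T) ∧ pPart 2 (oInv T) < pPart 2 n ∧
      4 * pPart 2 (rInv T) ≤ pPart 2 m ∧
      (pPart 2 s ≠ pPart 2 n * pPart 2 (rInv T) →
        2 * pPart 2 s = pPart 2 m ∧ pPart 2 m < pPart 2 n * pPart 2 (rInv T)) then
    pPart 2 m / 2
  else pPart 2 m

/-- The number `m' = [T, n, s]`. -/
noncomputable def bracket {m : ℕ} (T : Subgroup (ZMod m)ˣ) (n s : ℕ) : ℕ :=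
  setPart (nuSet T) m * ∏ p ∈ (rInv T).primeFactors, localPart T n s p

theorem localPart_dvd {m : ℕ} (hm : m ≠ 0) (T : Subgroup (ZMod m)ˣ) (n s p : ℕ)
    (hp : p.Prime) : localPart T n s p ∣ pPart p m := by
  have hr : ∀ q : ℕ, pPart q (rInv T) ∣ pPart q m := fun q =>
    Nat.ordProj_dvd_ordProj_of_dvd hm (rInv_dvd T) q
  have key : ∀ x : ℕ, (∃ k, x = p ^ k) → x ≤ pPart p m → x ∣ pPart p m := by
    rintro x ⟨k, rfl⟩ h
    exact pow_dvd_pow p ((Nat.pow_le_pow_iff_right hp.one_lt).mp h)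
  have hmin : ∀ x y : ℕ, (∃ k, x = p ^ k) → (∃ k, y = p ^ k) → ∃ k, min x y = p ^ k := by
    intro x y hx hy
    rcases min_choice x y with h | h <;> rw [h] <;> assumption
  have hmax : ∀ x y : ℕ, (∃ k, x = p ^ k) → (∃ k, y = p ^ k) → ∃ k, max x y = p ^ k := by
    intro x y hx hy
    rcases max_choice x y with h | h <;> rw [h] <;> assumption
  have hpp : ∀ x : ℕ, ∃ k, pPart p x = p ^ k := fun x => ⟨_, rfl⟩
  unfold localPart
  split_ifs with h1 h2 h3
  · refine key _ (hmin _ _ (hpp _) (hmin _ _ ⟨_, (pow_add _ _ _).symm⟩ ?_)) (min_le_left _ _)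
    rw [max_left_comm]
    refine hmax _ _ (hpp s) ?_
    rcases le_or_gt (n.factorization p)
      ((rInv T).factorization p + s.factorization p + (oInv T).factorization p) with h | h
    · refine hmax _ _ (hpp _) ⟨(rInv T).factorization p + s.factorization p +
        (oInv T).factorization p - n.factorization p, ?_⟩
      unfold pPart
      rw [← pow_add, ← pow_add, Nat.pow_div h hp.pos]
    · have h0 : pPart p (rInv T) * pPart p s * pPart p (oInv T) / pPart p n = 0 := by
        unfold pPart
        rw [← pow_add, ← pow_add]
        exact Nat.div_eq_of_lt (Nat.pow_lt_pow_right hp.one_lt h)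
      rw [h0, max_eq_left (Nat.zero_le _)]
      exact hpp _
  all_goals
    have h2p : p = 2 := by
      rcases hp.eq_two_or_odd' with h | h
      · exact h
      · exfalso
        apply h1
        have he : Even (p - 1) := Nat.Odd.sub_odd h odd_one
        unfold epsInv
        split_ifs
        · exact he.neg_one_pow
        · exact one_pow _
    subst h2p
  · exact hr 2
  · exact Nat.div_dvd_of_dvd (by
      have h4 : 4 ≤ pPart 2 m := by
        have : 0 < pPart 2 (rInv T) := pow_pos two_pos _
        omega
      unfold pPart at h4 ⊢
      refine dvd_pow_self 2 ?_
      intro h0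
      rw [h0] at h4
      norm_num at h4)
  · exact dvd_rfl

theorem bracket_dvd {m : ℕ} (T : Subgroup (ZMod m)ˣ) (n s : ℕ) : bracket T n s ∣ m := by
  classical
  rcases Nat.eq_zero_or_pos m with rfl | hm
  · exact dvd_zero _
  · have hsub : (rInv T).primeFactors ⊆ m.primeFactors :=
      Nat.primeFactors_mono (rInv_dvd T) hm.ne'
    have h : ∏ p ∈ m.primeFactors, pPart p m = m :=
      Nat.prod_factorization_pow_eq_self hm.ne'
    have h1 : setPart (nuSet T) m = ∏ p ∈ m.primeFactors \ (rInv T).primeFactors, pPart p m := by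
      unfold setPart nuSet
      refine Finset.prod_congr ?_ (fun _ _ => rfl)
      ext p
      simp only [Finset.mem_filter, Finset.mem_coe, Finset.mem_sdiff]
      tauto
    unfold bracket
    conv_rhs => rw [← h, ← Finset.prod_sdiff hsub]
    rw [h1]
    exact mul_dvd_mul dvd_rfl (Finset.prod_dvd_prod_of_dvd _ _ fun p hp =>
      localPart_dvd hm.ne' T n s p (Nat.prime_of_mem_primeFactors hp))

/-- The set of primes `π = π(r) ∪ (π(n) \ π(m))`. -/
noncomputable def piSet {m : ℕ} (T : Subgroup (ZMod m)ˣ) (n : ℕ) : Finset ℕ :=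
  (rInv T).primeFactors ∪ (n.primeFactors \ m.primeFactors)

theorem setPart_coprime {π : Set ℕ} (m : ℕ) {p : ℕ} (hp : p.Prime) (h : p ∉ π) :
    Nat.Coprime (setPart π m) p := by
  classical
  unfold setPart
  refine Nat.Coprime.prod_left fun q hq => ?_
  rw [Finset.mem_filter] at hq
  refine Nat.Coprime.pow_left _
    ((Nat.coprime_primes (Nat.prime_of_mem_primeFactors hq.1) hp).mpr ?_)
  rintro rfl
  exact h hq.2

/-- `m_{π'} m'_p` divides `m` for `p ∈ π`, so that `Res` to this modulus makes sense. -/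
theorem mixed_dvd {m : ℕ} (T : Subgroup (ZMod m)ˣ) (n s : ℕ) {p : ℕ} (hp : p ∈ piSet T n) :
    setPart ((piSet T n : Set ℕ)ᶜ) m * pPart p (bracket T n s) ∣ m := by
  have hpr : p.Prime := by
    rcases Finset.mem_union.mp hp with h | h
    · exact Nat.prime_of_mem_primeFactors h
    · exact Nat.prime_of_mem_primeFactors (Finset.mem_sdiff.mp h).1
  refine Nat.Coprime.mul_dvd_of_dvd_of_dvd
    (Nat.Coprime.pow_right _ (setPart_coprime m hpr fun h => h hp)) (setPart_dvd _ _)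
    ((pPart_dvd _ _).trans (bracket_dvd T n s))

/-- The subgroup `U_m^{n,s}` of `U_m` of the classes of the `t` with `m ∣ s (t - 1)` and
`t ^ n ≡ 1` modulo `m`. -/
def unitsSub (m n s : ℕ) : Subgroup (ZMod m)ˣ where
  carrier := {u | (s : ZMod m) * ((u : ZMod m) - 1) = 0 ∧ u ^ n = 1}
  one_mem' := by simp
  mul_mem' := by
    rintro u v ⟨hu, hu2⟩ ⟨hv, hv2⟩
    refine ⟨?_, by rw [mul_pow, hu2, hv2, one_mul]⟩
    push_cast
    linear_combination (v : ZMod m) * hu + hv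
  inv_mem' := by
    rintro u ⟨hu, hu2⟩
    refine ⟨?_, by rw [inv_pow, hu2, inv_one]⟩
    have h : (u : ZMod m) * ((u⁻¹ : (ZMod m)ˣ) : ZMod m) = 1 := u.mul_inv
    linear_combination (-((u⁻¹ : (ZMod m)ˣ) : ZMod m)) * hu + (s : ZMod m) * h

/-- `T` is `(n,s)`-canonical. -/
structure IsCanonical {m : ℕ} (n s : ℕ) (T : Subgroup (ZMod m)ˣ) : Prop where
  le_unitsSub : T ≤ unitsSub m n s
  neg_ne : epsInv T = -1 → pPart 2 s ≠ pPart 2 (rInv T) * pPart 2 n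
  neg_le : epsInv T = -1 → 8 ≤ pPart 2 m → 4 ≤ pPart 2 n → pPart 2 (oInv T) < pPart 2 n →
    pPart 2 (rInv T) ≤ pPart 2 s
  pos : ∀ p ∈ piSet T n, epsInv T ^ (p - 1) = 1 →
    pPart p s ∣ n ∧ (pPart p (rInv T) ∣ s ∨ ¬ pPart p s * pPart p (oInv T) ∣ n)

/-- `T = ⟨t⟩_m`: the subgroup `T` of `U_m` is the cyclic group generated by the class of `t`. -/
def IsGeneratedBy {m : ℕ} (T : Subgroup (ZMod m)ˣ) (t : ℤ) : Prop :=
  ∃ u : (ZMod m)ˣ, (u : ZMod m) = (t : ZMod m) ∧ T = Subgroup.zpowers u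

/-- The relators of the presentation `⟨a, b ∣ a ^ m = 1, b ^ n = a ^ s, b⁻¹ a b = a ^ t⟩`, with `a`
and `b` the generators of index `0` and `1`. -/
def relators (m n s : ℕ) (t : ℤ) : Set (FreeGroup (Fin 2)) :=
  {FreeGroup.of 0 ^ m,
   FreeGroup.of 1 ^ n * (FreeGroup.of 0 ^ s)⁻¹,
   (FreeGroup.of 1)⁻¹ * FreeGroup.of 0 * FreeGroup.of 1 * (FreeGroup.of 0 ^ t)⁻¹}

/-- The group `G_{m,n,s,t}`, also denoted `G_{m,n,s,T}` when `T = ⟨t⟩_m`. -/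
abbrev MetacyclicGroup (m n s : ℕ) (t : ℤ) : Type := PresentedGroup (relators m n s t)

end Metacyclic

namespace Metacyclic

open Finset

theorem dvd_pow_sub_one {q x : ℤ} (h : q ∣ x - 1) (k : ℕ) : q ∣ x ^ k - 1 := by
  simpa using h.trans (sub_dvd_pow_sub_pow x 1 k)

theorem dvd_geom_sum_sub {q x : ℤ} (h : q ∣ x - 1) (v : ℕ) :
    q ∣ ∑ i ∈ range v, x ^ i - v := by
  have : ∑ i ∈ range v, x ^ i - (v : ℤ) = ∑ i ∈ range v, (x ^ i - 1) := by simp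
  rw [this]
  exact dvd_sum fun i _ => dvd_pow_sub_one h i

theorem geom_sum_mul_range (x : ℤ) (p v : ℕ) :
    ∑ i ∈ range (p * v), x ^ i = (∑ i ∈ range p, x ^ i) * ∑ i ∈ range v, (x ^ p) ^ i := by
  induction v with
  | zero => simp
  | succ v ih =>
    rw [mul_add, mul_one, sum_range_add, ih, sum_range_succ, mul_add]
    congr 1
    rw [sum_mul]
    exact sum_congr rfl fun i _ => by ring

theorem pow_dvd_geom_sum {p : ℕ} {x : ℤ} (h : (p : ℤ) ∣ x - 1) :
    ∀ {k v : ℕ}, p ^ k ∣ v → (p : ℤ) ^ k ∣ ∑ i ∈ range v, x ^ i := by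
  intro k
  induction k generalizing x with
  | zero => simp
  | succ k ih =>
    rintro v ⟨w, rfl⟩
    rw [pow_succ' (p : ℤ), pow_succ' p, mul_assoc, geom_sum_mul_range]
    refine mul_dvd_mul ?_ (ih (dvd_pow_sub_one h p) ⟨w, rfl⟩)
    simpa using dvd_add (dvd_geom_sum_sub h p) (dvd_refl (p : ℤ))

theorem pow_add_dvd_pow_sub_one {p R : ℕ} (hR : 1 ≤ R) {x : ℤ} (h : (p : ℤ) ^ R ∣ x - 1) :
    ∀ {O e : ℕ}, p ^ O ∣ e → (p : ℤ) ^ (R + O) ∣ x ^ e - 1 := by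
  have hp : (p : ℤ) ∣ x - 1 := (dvd_pow_self _ (by omega)).trans h
  intro O e he
  rw [pow_add, ← mul_geom_sum]
  exact mul_dvd_mul h (pow_dvd_geom_sum hp he)

/-- The exact power of `p` dividing `x ^ (p ^ i) - 1`. -/
theorem exists_pow_prime_pow_sub_one {p R : ℕ} (hp : p.Prime) (hR : 1 ≤ R) (h2 : p = 2 → 2 ≤ R)
    {x c : ℤ} (hx : x - 1 = p ^ R * c) (i : ℕ) :
    ∃ c', x ^ p ^ i - 1 = p ^ (R + i) * c' ∧ (p : ℤ) ∣ c' - c := by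
  have hd : (p : ℤ) * (p : ℤ) ^ R * p ∣ ((p : ℤ) ^ R) ^ p := by
    rw [← pow_mul, mul_right_comm, ← sq, ← pow_add]
    refine pow_dvd_pow _ ?_
    rcases hp.eq_two_or_odd' with rfl | ho
    · have := h2 rfl
      omega
    · have : 3 ≤ p := by
        have := hp.two_le
        rcases ho with ⟨k, rfl⟩
        omega
      nlinarith
  obtain ⟨y, hy⟩ := ZMod.exists_one_add_mul_pow_prime_pow_eq (R := ℤ) (u := (p : ℤ) ^ R)
    (v := p) hp (dvd_pow_self _ (by omega)) hd c i
  refine ⟨c + p * y, ?_, by simp⟩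
  rw [← hx, add_sub_cancel] at hy
  rw [hy, pow_add]
  ring

theorem exists_mul_add_dvd {p : ℕ} (hp : p.Prime) {c : ℤ} (hc : ¬ (p : ℤ) ∣ c) (d : ℤ) :
    ∃ z : ℕ, (p : ℤ) ∣ c * z + d := by
  have := Fact.mk hp
  have hc' : (c : ZMod p) ≠ 0 := fun h => hc ((ZMod.intCast_zmod_eq_zero_iff_dvd _ _).mp h)
  refine ⟨(-(d : ZMod p) / c).val, ?_⟩
  rw [← ZMod.intCast_zmod_eq_zero_iff_dvd]
  push_cast
  rw [ZMod.natCast_zmod_val]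
  field_simp
  ring

theorem exists_pow_sub_dvd {p R O : ℕ} (hp : p.Prime) (hR : 1 ≤ R) (h2 : p = 2 → 2 ≤ R)
    {x y c : ℤ} (hx : x - 1 = p ^ R * c) (hc : ¬ (p : ℤ) ∣ c)
    (hxy : (p : ℤ) ^ (R + O) ∣ x - y) (M : ℕ) :
    ∃ k : ℕ, k ≡ 1 [MOD p ^ O] ∧ (p : ℤ) ^ M ∣ x ^ k - y := by
  suffices H : ∀ i, ∃ k : ℕ, k ≡ 1 [MOD p ^ O] ∧ (p : ℤ) ^ (R + O + i) ∣ x ^ k - y by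
    obtain ⟨k, h1, h3⟩ := H M
    exact ⟨k, h1, (pow_dvd_pow _ (by omega)).trans h3⟩
  intro i
  induction i with
  | zero => exact ⟨1, rfl, by simpa using hxy⟩
  | succ i ih =>
    obtain ⟨k, h1, d, hd⟩ := ih
    obtain ⟨c', hc', hcc⟩ := exists_pow_prime_pow_sub_one hp hR h2 hx (O + i)
    have hc'' : ¬ (p : ℤ) ∣ c' := fun h => hc (by simpa using dvd_sub h hcc)
    obtain ⟨z, hz⟩ := exists_mul_add_dvd hp hc'' d
    refine ⟨k + p ^ (O + i) * z, ?_, ?_⟩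
    · have : k + p ^ (O + i) * z ≡ 1 + 0 [MOD p ^ O] :=
        h1.add ((Nat.modEq_zero_iff_dvd).mpr ((pow_dvd_pow p (by omega)).mul_right z))
      simpa using this
    · have hRpos : (p : ℤ) ∣ x - 1 := (dvd_pow_self _ (by omega)).trans ⟨c, hx⟩
      obtain ⟨f, hf⟩ := dvd_pow_sub_one hRpos k
      have e1 : x ^ p ^ (O + i) = 1 + p ^ (R + O + i) * c' := by
        rw [add_assoc]; linarith
      have e2 : (p : ℤ) ^ (R + O + (i + 1)) ∣ (x ^ p ^ (O + i)) ^ z - 1 - p ^ (R + O + i) * c' * z := by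
        have := dvd_geom_sum_sub (q := (p : ℤ) ^ (R + O + i)) (x := x ^ p ^ (O + i))
          (by rw [e1]; simp) z
        obtain ⟨g, hg⟩ := this
        have h3 : (x ^ p ^ (O + i)) ^ z - 1 =
          (x ^ p ^ (O + i) - 1) * ∑ j ∈ range z, (x ^ p ^ (O + i)) ^ j := (mul_geom_sum _ _).symm
        have h4 : (∑ j ∈ range z, (x ^ p ^ (O + i)) ^ j) = z + p ^ (R + O + i) * g := by linarith
        rw [h3, h4, e1]
        have : (p : ℤ) ^ (R + O + (i + 1)) ∣ p ^ (R + O + i) * p ^ (R + O + i) := by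
          rw [← pow_add]; exact pow_dvd_pow _ (by omega)
        refine (this.mul_right (c' * g)).trans (dvd_of_eq ?_)
        ring
      obtain ⟨a, ha⟩ := e2
      obtain ⟨b, hb⟩ := hz
      have e3 : x ^ k = 1 + p * f := by linarith
      have e4 : x ^ (k + p ^ (O + i) * z) - y = (p : ℤ) ^ (R + O + (i + 1)) * (x ^ k * a + b + f * c' * z) := by
        rw [pow_add, pow_mul]
        have h5 : (x ^ p ^ (O + i)) ^ z = 1 + p ^ (R + O + i) * c' * z + p ^ (R + O + (i + 1)) * a := by
          linarith
        rw [h5]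
        have h6 : d = p * b - c' * z := by linarith
        have h7 : y = x ^ k - p ^ (R + O + i) * d := by linarith
        rw [h7, h6, e3]
        ring
      exact ⟨_, e4⟩

/-- If `x` and `y` are congruent to `1` modulo exactly `p ^ R` and congruent to each other modulo
`p ^ (R + O)`, then `y` is modulo `p ^ M` a power of `x` with exponent `1` modulo `p ^ O`. -/
theorem exists_coprime_pow_sub_dvd {p R O M : ℕ} (hp : p.Prime) (hR : 1 ≤ R) (hRM : R < M)
    (h2 : p = 2 → 2 ≤ R)
    {x y : ℤ} (hx : (p : ℤ) ^ R ∣ x - 1) (hx' : ¬ (p : ℤ) ^ (R + 1) ∣ x - 1)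
    (hy' : ¬ (p : ℤ) ^ (R + 1) ∣ y - 1)
    (hxy : (p : ℤ) ^ (R + O) ∣ x - y) :
    ∃ k : ℕ, k ≡ 1 [MOD p ^ O] ∧ ¬ p ∣ k ∧ (p : ℤ) ^ M ∣ x ^ k - y := by
  obtain ⟨c, hc⟩ := hx
  have hpc : ¬ (p : ℤ) ∣ c := fun ⟨d, hd⟩ => hx' ⟨d, by rw [hc, hd]; ring⟩
  obtain ⟨k, h1, h3⟩ := exists_pow_sub_dvd hp hR h2 hc hpc hxy M
  refine ⟨k, h1, fun hk => hy' ?_, h3⟩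
  have h4 := pow_add_dvd_pow_sub_one hR (O := 1) (x := x) ⟨c, hc⟩ (by simpa using hk)
  have h5 := (pow_dvd_pow (p : ℤ) (show R + 1 ≤ M by omega)).trans h3
  have := dvd_sub h4 h5
  rwa [show x ^ k - 1 - (x ^ k - y) = y - 1 by ring] at this

/-- A refinement of `pow_dvd_geom_sum`. -/
theorem pow_succ_dvd_geom_sum_sub {p : ℕ} (hp : p.Prime) {x : ℤ} (h : (p : ℤ) ∣ x - 1)
    (h2 : p = 2 → (4 : ℤ) ∣ x - 1) :
    ∀ {k v : ℕ}, p ^ k ∣ v → (p : ℤ) ^ (k + 1) ∣ ∑ i ∈ range v, x ^ i - v := by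
  intro k
  induction k generalizing x with
  | zero => intro v _; simpa using dvd_geom_sum_sub h v
  | succ k ih =>
    rintro v ⟨w, rfl⟩
    have hp2 : (p : ℤ) ^ 2 ∣ ∑ i ∈ range p, x ^ i - p := by
      rcases hp.eq_two_or_odd' with rfl | ho
      · have := h2 rfl
        norm_num [sum_range_succ]
        omega
      · obtain ⟨c, hc⟩ := h
        have e : ∑ i ∈ range p, x ^ i - (p : ℤ) = (x - 1) * ∑ j ∈ range p, ∑ i ∈ range j, x ^ i := by
          rw [mul_sum]
          simp only [mul_geom_sum, sum_sub_distrib]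
          simp
        have h4 : (p : ℤ) ∣ ∑ j ∈ range p, ∑ i ∈ range j, x ^ i := by
          have h5 : (p : ℤ) ∣ ∑ j ∈ range p, (∑ i ∈ range j, x ^ i - (j : ℤ)) :=
            dvd_sum fun j _ => dvd_geom_sum_sub ⟨c, hc⟩ j
          rw [sum_sub_distrib] at h5
          have h6 : (p : ℤ) ∣ ∑ j ∈ range p, (j : ℤ) := by
            rw [← Nat.cast_sum, sum_range_id]
            obtain ⟨q, hq⟩ := ho
            rw [show p * (p - 1) / 2 = p * q by
              rw [hq]; simp only [Nat.add_sub_cancel]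
              rw [mul_comm 2 q, ← mul_assoc]; simp]
            push_cast
            exact dvd_mul_right _ _
          simpa using dvd_add h5 h6
        rw [e, sq]
        exact mul_dvd_mul ⟨c, hc⟩ h4
    obtain ⟨a, ha⟩ := hp2
    have := ih (dvd_pow_sub_one h p) (fun e => dvd_pow_sub_one (h2 e) p) (v := p ^ k * w) ⟨w, rfl⟩
    obtain ⟨b, hb⟩ := this
    rw [pow_succ' p, mul_assoc, geom_sum_mul_range]
    have e1 : ∑ i ∈ range p, x ^ i = p + p ^ 2 * a := by linarith
    have e2 : ∑ i ∈ range (p ^ k * w), (x ^ p) ^ i = p ^ k * w + p ^ (k + 1) * b := by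
      push_cast at hb; linarith
    rw [e1, e2]
    push_cast
    exact ⟨b + a * w + p * a * b, by ring⟩

theorem geom_sum_sub_eq (x : ℤ) (v : ℕ) :
    ∑ i ∈ range v, x ^ i - (v : ℤ) = (x - 1) * ∑ j ∈ range v, ∑ i ∈ range j, x ^ i := by
  rw [mul_sum]
  simp only [mul_geom_sum, sum_sub_distrib]
  simp

theorem dvd_sum_geom_sum {p v : ℕ} (hp : p.Prime) {x : ℤ} (h : (p : ℤ) ∣ x - 1)
    (hv : p ∣ v) (hv2 : p = 2 → 4 ∣ v) :
    (p : ℤ) ∣ ∑ j ∈ range v, ∑ i ∈ range j, x ^ i := by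
  have h5 : (p : ℤ) ∣ ∑ j ∈ range v, (∑ i ∈ range j, x ^ i - (j : ℤ)) :=
    dvd_sum fun j _ => dvd_geom_sum_sub h j
  rw [sum_sub_distrib] at h5
  have h6 : (p : ℤ) ∣ ∑ j ∈ range v, (j : ℤ) := by
    have h7 : p ∣ ∑ j ∈ range v, j := by
      have h8 := sum_range_id_mul_two v
      rcases hp.eq_two_or_odd' with rfl | ho
      · obtain ⟨w, rfl⟩ := hv2 rfl
        refine ⟨w * (4 * w - 1), ?_⟩
        nlinarith
      · refine (Nat.Coprime.dvd_mul_right (n := 2) ?_).mp (h8 ▸ hv.mul_right _)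
        exact (Nat.coprime_primes hp Nat.prime_two).mpr fun h => by
          rw [h] at ho; exact absurd ho (by decide)
    rw [← Nat.cast_sum]
    exact Int.natCast_dvd_natCast.mpr h7
  simpa using dvd_add h5 h6

end Metacyclic

namespace Metacyclic

open Finset

/-- The elements `a` and `b` generate the group and satisfy the relations of the presentation of
`G_{m,n,s,t}`. -/
structure IsRelPair {G : Type*} [Group G] (m n s t : ℕ) (a b : G) : Prop where
  pow_eq_one : a ^ m = 1
  pow_eq : b ^ n = a ^ s
  mul_comm' : a * b = b * a ^ t
  closure_eq : Subgroup.closure {a, b} = ⊤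

/-- The elements `a` and `b` generate the group, satisfy the relations of the presentation of
`G_{m,n,s,t}`, the order of `a` is `m` and the order of `b` modulo `⟨a⟩` is `n`. -/
structure IsPair {G : Type*} [Group G] (m n s t : ℕ) (a b : G) : Prop
    extends IsRelPair m n s t a b where
  orderOf_eq : orderOf a = m
  dvd_of_mem : ∀ i : ℕ, b ^ i ∈ Subgroup.zpowers a → n ∣ i

section Relations

variable {G : Type*} [Group G] {m n s t : ℕ} {a b : G}

theorem pow_mul_pow_of_rel (h : a * b = b * a ^ t) (j e : ℕ) :
    a ^ j * b ^ e = b ^ e * a ^ (j * t ^ e) := by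
  have h1 : ∀ j : ℕ, a ^ j * b = b * a ^ (j * t) := by
    intro j
    induction j with
    | zero => simp
    | succ j ih => rw [pow_succ, mul_assoc, h, ← mul_assoc, ih, mul_assoc, ← pow_add, add_mul, one_mul]
  induction e with
  | zero => simp
  | succ e ih =>
    rw [pow_succ, ← mul_assoc, ih, mul_assoc, h1, ← mul_assoc, pow_succ, mul_assoc j]

theorem mul_mul_mul_of_rel (h : a * b = b * a ^ t) (e j k l : ℕ) :
    (b ^ e * a ^ j) * (b ^ k * a ^ l) = b ^ (e + k) * a ^ (j * t ^ k + l) := by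
  rw [mul_assoc, ← mul_assoc (a ^ j), pow_mul_pow_of_rel h, mul_assoc, ← pow_add, ← mul_assoc,
    ← pow_add]

theorem mul_pow_of_rel (h : a * b = b * a ^ t) (e j v : ℕ) :
    (b ^ e * a ^ j) ^ v = b ^ (e * v) * a ^ (j * ∑ i ∈ range v, (t ^ e) ^ i) := by
  induction v with
  | zero => simp
  | succ v ih =>
    rw [pow_succ, ih, mul_mul_mul_of_rel h, geom_sum_succ]
    congr 2
    ring

theorem IsRelPair.exists_eq (h : IsRelPair m n s t a b) (hm : 0 < m) (hn : 0 < n) (g : G) :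
    ∃ i j : ℕ, g = b ^ i * a ^ j := by
  have hb : b ^ (n * m) = 1 := by
    rw [pow_mul, h.pow_eq, ← pow_mul, mul_comm s, pow_mul, h.pow_eq_one, one_pow]
  have hord : ∀ i j : ℕ, (b ^ i * a ^ j) ^ (n * m * m) = 1 := by
    intro i j
    rw [pow_mul, mul_pow_of_rel h.mul_comm', mul_comm i, pow_mul b, hb, one_pow, one_mul, ← pow_mul,
      mul_comm, pow_mul, h.pow_eq_one, one_pow]
  have hN : 0 < n * m * m := by positivity
  have hg : g ∈ Subgroup.closure {a, b} := h.closure_eq ▸ Subgroup.mem_top g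
  induction hg using Subgroup.closure_induction with
  | mem x hx =>
    rcases hx with rfl | rfl
    · exact ⟨0, 1, by simp⟩
    · exact ⟨1, 0, by simp⟩
  | one => exact ⟨0, 0, by simp⟩
  | mul x y _ _ hx hy =>
    obtain ⟨i, j, rfl⟩ := hx
    obtain ⟨i', j', rfl⟩ := hy
    exact ⟨_, _, mul_mul_mul_of_rel h.mul_comm' _ _ _ _⟩
  | inv x _ hx =>
    obtain ⟨i, j, rfl⟩ := hx
    have : (b ^ i * a ^ j)⁻¹ = (b ^ i * a ^ j) ^ (n * m * m - 1) := by
      rw [inv_eq_iff_mul_eq_one, ← pow_succ', Nat.sub_add_cancel hN, hord]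
    rw [this, mul_pow_of_rel h.mul_comm']
    exact ⟨_, _, rfl⟩

theorem IsPair.modEq_of_eq (h : IsPair m n s t a b) {i j : ℕ} (hij : a ^ i = a ^ j) :
    i ≡ j [MOD m] := by
  rw [← h.orderOf_eq]
  exact pow_eq_pow_iff_modEq.mp hij

theorem IsPair.pow_eq_pow (h : IsPair m n s t a b) {i j : ℕ} (hij : i ≡ j [MOD m]) :
    a ^ i = a ^ j := by
  rw [← h.orderOf_eq] at hij
  exact pow_eq_pow_iff_modEq.mpr hij

theorem IsPair.dvd_of_pow_mul_pow_eq (h : IsPair m n s t a b) {i j k : ℕ}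
    (hij : b ^ i * a ^ j = a ^ k) :
    n ∣ i := by
  refine h.dvd_of_mem i ?_
  rw [eq_mul_inv_of_mul_eq hij]
  exact mul_mem (pow_mem (Subgroup.mem_zpowers a) _) (inv_mem (pow_mem (Subgroup.mem_zpowers a) _))

theorem IsPair.modEq_of_pow_mul_pow_eq (h : IsPair m n s t a b) {w j k : ℕ}
    (hij : b ^ (n * w) * a ^ j = a ^ k) : s * w + j ≡ k [MOD m] := by
  rw [pow_mul, h.pow_eq, ← pow_mul, ← pow_add] at hij
  exact h.modEq_of_eq hij

/-- A homomorphism mapping a pair of generators satisfying the relations to a pair of generators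
as in the presentation is bijective. -/
theorem IsRelPair.bijective (hm : 0 < m) (hn : 0 < n) (h : IsRelPair m n s t a b)
    {H : Type*} [Group H] {a' b' : H} (h' : IsPair m n s t a' b') (f : G →* H) (ha : f a = a')
    (hb : f b = b') : Function.Bijective f := by
  constructor
  · rw [injective_iff_map_eq_one]
    intro g hg
    obtain ⟨i, j, rfl⟩ := h.exists_eq hm hn g
    rw [map_mul, map_pow, map_pow, ha, hb] at hg
    obtain ⟨w, rfl⟩ := h'.dvd_of_pow_mul_pow_eq (k := 0) (by simpa using hg)
    have := h'.modEq_of_pow_mul_pow_eq (k := 0) (by simpa using hg)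
    obtain ⟨c, hc⟩ := (Nat.modEq_zero_iff_dvd).mp this
    rw [pow_mul, h.pow_eq, ← pow_mul, ← pow_add, hc, pow_mul, h.pow_eq_one, one_pow]
  · rw [← MonoidHom.range_eq_top, eq_top_iff, ← h'.closure_eq, Subgroup.closure_le]
    rintro x (rfl | rfl)
    · exact ⟨a, ha⟩
    · exact ⟨b, hb⟩

theorem IsPair.map_equiv (h : IsPair m n s t a b) {H : Type*} [Group H] (f : G ≃* H) :
    IsPair m n s t (f a) (f b) where
  pow_eq_one := by rw [← map_pow, h.pow_eq_one, map_one]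
  pow_eq := by rw [← map_pow, h.pow_eq, map_pow]
  mul_comm' := by rw [← map_mul, h.mul_comm', map_mul, map_pow]
  closure_eq := by
    have := congrArg (Subgroup.map f.toMonoidHom) h.closure_eq
    rw [MonoidHom.map_closure, Set.image_pair, Subgroup.map_top_of_surjective _ f.surjective] at this
    exact this
  orderOf_eq := by rw [MulEquiv.orderOf_eq]; exact h.orderOf_eq
  dvd_of_mem i hi := by
    refine h.dvd_of_mem i ?_
    obtain ⟨k, hk⟩ := hi
    refine ⟨k, f.injective ?_⟩
    simpa using hk

end Relations

section Model

variable {m : ℕ}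

/-- Multiplication by a unit of `ZMod m`, as an automorphism of the cyclic group of order `m`. -/
def unitAut : (ZMod m)ˣ →* MulAut (Multiplicative (ZMod m)) where
  toFun u := AddEquiv.toMultiplicative (DistribMulAction.toAddEquiv (ZMod m) u)
  map_one' := by
    refine MulEquiv.ext fun x => ?_
    exact congrArg Multiplicative.ofAdd (one_smul (ZMod m)ˣ (Multiplicative.toAdd x))
  map_mul' u v := by
    refine MulEquiv.ext fun x => ?_
    exact congrArg Multiplicative.ofAdd (mul_smul u v (Multiplicative.toAdd x))

theorem unitAut_apply (u : (ZMod m)ˣ) (x : Multiplicative (ZMod m)) :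
    unitAut u x = Multiplicative.ofAdd (u * x.toAdd) := rfl

/-- The group `⟨a⟩ ⋊ ⟨b⟩` with `a` of order `m`, `b` of infinite order and `b⁻¹ a b = a ^ u`. -/
abbrev InfiniteModel (u : (ZMod m)ˣ) : Type :=
  Multiplicative (ZMod m) ⋊[zpowersHom (MulAut (Multiplicative (ZMod m))) (unitAut u⁻¹)]
    Multiplicative ℤ

variable (u : (ZMod m)ˣ)

/-- The generator `a` of the model. -/
def modelA : InfiniteModel u := SemidirectProduct.inl (Multiplicative.ofAdd 1)

/-- The generator `b` of the model. -/
def modelB : InfiniteModel u := SemidirectProduct.inr (Multiplicative.ofAdd 1)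

theorem modelA_pow (k : ℕ) :
    modelA u ^ k = SemidirectProduct.inl (Multiplicative.ofAdd (k : ZMod m)) := by
  rw [modelA, ← map_pow, ← ofAdd_nsmul]
  simp

theorem modelB_pow (k : ℕ) :
    modelB u ^ k = SemidirectProduct.inr (Multiplicative.ofAdd (k : ℤ)) := by
  rw [modelB, ← map_pow, ← ofAdd_nsmul]
  simp

theorem model_rel {t : ℕ} (ht : (u : ZMod m) = t) :
    modelA u * modelB u = modelB u * modelA u ^ t := by
  rw [modelA_pow, modelA, modelB]
  ext
  · have h : zpowersHom (MulAut (Multiplicative (ZMod m))) (unitAut u⁻¹) (Multiplicative.ofAdd 1) =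
        unitAut u⁻¹ := by
      rw [zpowersHom_apply, toAdd_ofAdd, zpow_one]
    rw [SemidirectProduct.mul_left, SemidirectProduct.mul_left, SemidirectProduct.right_inr, h,
      SemidirectProduct.left_inl, SemidirectProduct.left_inl, unitAut_apply, toAdd_ofAdd, ← ht,
      Units.inv_mul]
    simp
  · simp

/-- The element `b ^ n a ^ (-s)` of the model. -/
def modelZ (n s : ℕ) : InfiniteModel u := (modelA u ^ s)⁻¹ * modelB u ^ n

theorem modelZ_left (n s : ℕ) : (modelZ u n s).left = Multiplicative.ofAdd (-(s : ZMod m)) := by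
  rw [modelZ, modelA_pow, modelB_pow]
  simp

theorem modelZ_right (n s : ℕ) : (modelZ u n s).right = Multiplicative.ofAdd (n : ℤ) := by
  rw [modelZ, modelA_pow, modelB_pow]
  simp

theorem modelZ_mem_center {n s : ℕ} (hn : u ^ n = 1) (hs : (s : ZMod m) * (u - 1) = 0) :
    modelZ u n s ∈ Subgroup.center (InfiniteModel u) := by
  rw [Subgroup.mem_center_iff]
  intro g
  have hs' : u ∈ unitsSub m 0 s := ⟨hs, pow_zero _⟩
  ext
  · rw [SemidirectProduct.mul_left, SemidirectProduct.mul_left, modelZ_left, modelZ_right,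
      zpowersHom_apply, zpowersHom_apply, ← map_zpow, ← map_zpow, unitAut_apply, unitAut_apply]
    have h1 : (u⁻¹ : (ZMod m)ˣ) ^ (Multiplicative.toAdd (Multiplicative.ofAdd (n : ℤ))) = 1 := by
      simp [hn]
    rw [h1]
    have h2 := (Subgroup.zpow_mem _ (Subgroup.inv_mem _ hs') (Multiplicative.toAdd g.right)).1
    apply Multiplicative.toAdd.injective
    simp only [toAdd_mul, toAdd_ofAdd, Units.val_one, one_mul]
    change (_ : ZMod m) + _ = _ + _
    linear_combination -h2
  · rw [SemidirectProduct.mul_right, SemidirectProduct.mul_right, mul_comm]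

theorem modelZ_zpow_right (n s : ℕ) (k : ℤ) :
    (modelZ u n s ^ k).right = Multiplicative.ofAdd (k * n : ℤ) := by
  have : (modelZ u n s ^ k).right = (modelZ u n s).right ^ k :=
    map_zpow (SemidirectProduct.rightHom : InfiniteModel u →* _) _ _
  rw [this, modelZ_right, ← ofAdd_zsmul]
  simp

theorem exists_model {n s t : ℕ} (hn : 0 < n) (ht : (u : ZMod m) = t) (hun : u ^ n = 1)
    (hs : (s : ZMod m) * (u - 1) = 0) :
    ∃ (Q : Type) (_ : Group Q) (a b : Q), orderOf a = m ∧ b ^ n = a ^ s ∧ a * b = b * a ^ t ∧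
      ∀ i : ℕ, b ^ i ∈ Subgroup.zpowers a → n ∣ i := by
  have hc := modelZ_mem_center u hun hs
  have hnorm : (Subgroup.zpowers (modelZ u n s)).Normal := by
    refine ⟨fun x hx g => ?_⟩
    have hx' : x ∈ Subgroup.center (InfiniteModel u) := (Subgroup.zpowers_le.mpr hc) hx
    rwa [Subgroup.mem_center_iff.mp hx' g, mul_assoc, mul_inv_cancel, mul_one]
  let q := QuotientGroup.mk' (Subgroup.zpowers (modelZ u n s))
  have hq : ∀ x, q x = 1 ↔ ∃ k : ℤ, modelZ u n s ^ k = x := fun x => QuotientGroup.eq_one_iff x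
  have hmem : ∀ (i j : ℤ), q (modelB u) ^ i = q (modelA u) ^ j → (n : ℤ) ∣ i := by
    intro i j hij
    rw [← map_zpow, ← map_zpow, eq_comm, ← inv_mul_eq_one, ← map_inv, ← map_mul, hq] at hij
    obtain ⟨k, hk⟩ := hij
    have h2 := congrArg (fun g => Multiplicative.toAdd (SemidirectProduct.rightHom g)) hk
    simp only [map_mul, map_inv, map_zpow] at h2
    simp only [SemidirectProduct.rightHom_eq_right, modelZ_right, modelA, modelB,
      SemidirectProduct.right_inl, SemidirectProduct.right_inr, toAdd_mul, toAdd_zpow, toAdd_ofAdd,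
      one_zpow, inv_one, toAdd_one, smul_eq_mul] at h2
    exact ⟨k, by linarith⟩
  refine ⟨_, inferInstance, q (modelA u), q (modelB u), ?_, ?_, ?_, ?_⟩
  · refine Nat.dvd_antisymm ?_ ?_
    · rw [orderOf_dvd_iff_pow_eq_one, ← map_pow, modelA_pow]
      simp
    · have h1 := pow_orderOf_eq_one (q (modelA u))
      rw [← map_pow, hq] at h1
      obtain ⟨k, hk⟩ := h1
      have h2 := congrArg SemidirectProduct.right hk
      rw [modelZ_zpow_right, modelA_pow] at h2
      have h3 := congrArg Multiplicative.toAdd h2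
      have h4 : k = 0 := by simpa [hn.ne'] using h3
      rw [h4, zpow_zero, modelA_pow] at hk
      have h5 := congrArg (fun x => Multiplicative.toAdd x.left) hk
      rw [← ZMod.natCast_eq_zero_iff]
      simpa using h5.symm
  · have h1 : q (modelZ u n s) = 1 := (hq _).mpr ⟨1, zpow_one _⟩
    change q ((modelA u ^ s)⁻¹ * modelB u ^ n) = 1 at h1
    rw [map_mul, map_inv q, inv_mul_eq_one, map_pow, map_pow] at h1
    exact h1.symm
  · rw [← map_pow, ← map_mul, ← map_mul, model_rel u ht]
  · rintro i ⟨j, hj⟩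
    exact_mod_cast hmem i j (by simpa using hj.symm)

end Model

section Presentation

variable {m n s t : ℕ}

theorem forall_mem_relators {P : FreeGroup (Fin 2) → Prop} {t : ℤ}
    (h1 : P (FreeGroup.of 0 ^ m)) (h2 : P (FreeGroup.of 1 ^ n * (FreeGroup.of 0 ^ s)⁻¹))
    (h3 : P ((FreeGroup.of 1)⁻¹ * FreeGroup.of 0 * FreeGroup.of 1 * (FreeGroup.of 0 ^ t)⁻¹)) :
    ∀ r ∈ relators m n s t, P r := by
  rintro r (rfl | rfl | rfl) <;> assumption

theorem presented_isRelPair {t' : ℤ} (ht' : (t' : ZMod m) = t) :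
    IsRelPair m n s t (PresentedGroup.of 0 : MetacyclicGroup m n s t') (PresentedGroup.of 1) := by
  have key : ∀ r ∈ relators m n s t', PresentedGroup.mk (relators m n s t') r = 1 :=
    fun r hr => PresentedGroup.one_of_mem hr
  have h1 : (PresentedGroup.of 0 : MetacyclicGroup m n s t') ^ m = 1 := by
    have := key (FreeGroup.of 0 ^ m) (by simp [relators])
    rw [map_pow] at this
    exact this
  refine ⟨h1, ?_, ?_, ?_⟩
  · have := key (FreeGroup.of 1 ^ n * (FreeGroup.of 0 ^ s)⁻¹) (by simp [relators])
    rw [map_mul, map_inv, map_pow, map_pow, mul_inv_eq_one] at this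
    exact this
  · have := key ((FreeGroup.of 1)⁻¹ * FreeGroup.of 0 * FreeGroup.of 1 * (FreeGroup.of 0 ^ t')⁻¹)
      (by simp [relators])
    rw [map_mul, map_inv, map_zpow, map_mul, map_mul, map_inv, mul_inv_eq_one, mul_assoc,
      inv_mul_eq_iff_eq_mul] at this
    have h2 : (PresentedGroup.of 0 : MetacyclicGroup m n s t') ^ t' = PresentedGroup.of 0 ^ t := by
      rw [← zpow_natCast, zpow_eq_zpow_iff_modEq]
      refine Int.ModEq.of_dvd (Int.natCast_dvd_natCast.mpr (orderOf_dvd_of_pow_eq_one h1)) ?_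
      exact (ZMod.intCast_eq_intCast_iff _ _ _).mp (by simpa using ht')
    rw [← h2]
    exact this
  · rw [← PresentedGroup.closure_range_of]
    congr 1
    ext x
    simp [Fin.exists_fin_two, eq_comm]

/-- The homomorphism from the presented group given by elements satisfying the relations. -/
theorem exists_hom_presented {t' : ℤ} (ht' : (t' : ZMod m) = t) {H : Type*} [Group H] {a b : H}
    (h1 : a ^ m = 1) (h2 : b ^ n = a ^ s) (h3 : a * b = b * a ^ t) :
    ∃ f : MetacyclicGroup m n s t' →* H, f (PresentedGroup.of 0) = a ∧
      f (PresentedGroup.of 1) = b := by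
  have h4 : a ^ t' = a ^ t := by
    rw [← zpow_natCast, zpow_eq_zpow_iff_modEq]
    refine Int.ModEq.of_dvd (Int.natCast_dvd_natCast.mpr (orderOf_dvd_of_pow_eq_one h1)) ?_
    exact (ZMod.intCast_eq_intCast_iff _ _ _).mp (by simpa using ht')
  have key : ∀ r ∈ relators m n s t', FreeGroup.lift ![a, b] r = 1 := by
    apply forall_mem_relators
    · simpa using h1
    · simp [h2]
    · rw [map_mul, map_mul, map_mul, map_inv, map_inv, map_zpow, FreeGroup.lift_apply_of,
        FreeGroup.lift_apply_of]
      change b⁻¹ * a * b * (a ^ t')⁻¹ = 1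
      rw [h4, mul_assoc b⁻¹, h3, inv_mul_cancel_left, mul_inv_cancel]
  exact ⟨PresentedGroup.toGroup key, PresentedGroup.toGroup.of key, PresentedGroup.toGroup.of key⟩

theorem presented_isPair (hn : 0 < n) {t' : ℤ} (u : (ZMod m)ˣ)
    (ht' : (u : ZMod m) = t') (ht : (u : ZMod m) = t) (hu : u ∈ unitsSub m n s) :
    IsPair m n s t (PresentedGroup.of 0 : MetacyclicGroup m n s t') (PresentedGroup.of 1) := by
  have h := presented_isRelPair (m := m) (n := n) (s := s) (ht'.symm.trans ht)
  obtain ⟨Q, _, a, b, h1, h2, h3, h4⟩ := exists_model u hn ht hu.2 hu.1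
  obtain ⟨f, fa, fb⟩ := exists_hom_presented (m := m) (n := n) (s := s) (ht'.symm.trans ht)
    (by rw [← h1]; exact pow_orderOf_eq_one a) h2 h3
  refine { h with orderOf_eq := ?_, dvd_of_mem := ?_ }
  · refine Nat.dvd_antisymm (orderOf_dvd_of_pow_eq_one h.pow_eq_one) ?_
    have := orderOf_map_dvd f (PresentedGroup.of 0)
    rwa [fa, h1] at this
  · rintro i ⟨j, hj⟩
    refine h4 i ⟨j, ?_⟩
    have := congrArg f hj
    simpa [fa, fb] using this

theorem IsPair.exists_hom {G : Type*} [Group G] {a b : G} (h : IsPair m n s t a b) (hm : 0 < m)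
    (hn : 0 < n) {H : Type*} [Group H] {a' b' : H}
    (h1 : a' ^ m = 1) (h2 : b' ^ n = a' ^ s) (h3 : a' * b' = b' * a' ^ t) :
    ∃ f : G →* H, f a = a' ∧ f b = b' := by
  obtain ⟨f, fa, fb⟩ := exists_hom_presented (m := m) (n := n) (s := s) (t := t) (t' := t)
    (by simp) h.pow_eq_one h.pow_eq h.mul_comm'
  obtain ⟨f', fa', fb'⟩ := exists_hom_presented (m := m) (n := n) (s := s) (t := t) (t' := t)
    (by simp) h1 h2 h3
  have hp := presented_isRelPair (m := m) (n := n) (s := s) (t := t) (t' := t) (by simp)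
  let e := MulEquiv.ofBijective f (hp.bijective hm hn h f fa fb)
  refine ⟨f'.comp e.symm.toMonoidHom, ?_, ?_⟩
  · have : e.symm a = PresentedGroup.of 0 := by rw [MulEquiv.symm_apply_eq]; exact fa.symm
    simpa [this] using fa'
  · have : e.symm b = PresentedGroup.of 1 := by rw [MulEquiv.symm_apply_eq]; exact fb.symm
    simpa [this] using fb'

/-- `G_{m,n,s,t'}` is isomorphic to `G` if and only if `G` has generators as in its
presentation. -/
theorem nonempty_mulEquiv_iff (hm : 0 < m) (hn : 0 < n) {t' : ℤ} (u : (ZMod m)ˣ)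
    (ht' : (u : ZMod m) = t') (ht : (u : ZMod m) = t) (hu : u ∈ unitsSub m n s)
    {G : Type*} [Group G] :
    Nonempty (MetacyclicGroup m n s t' ≃* G) ↔ ∃ x y : G, IsPair m n s t x y := by
  constructor
  · rintro ⟨f⟩
    exact ⟨_, _, (presented_isPair hn u ht' ht hu).map_equiv f⟩
  · rintro ⟨x, y, h⟩
    obtain ⟨f, fa, fb⟩ := exists_hom_presented (m := m) (n := n) (s := s) (ht'.symm.trans ht)
      h.pow_eq_one h.pow_eq h.mul_comm'
    exact ⟨MulEquiv.ofBijective f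
      ((presented_isRelPair (ht'.symm.trans ht)).bijective hm hn h f fa fb)⟩

end Presentation

end Metacyclic

namespace Metacyclic

section Hall

variable {G H : Type*} [CommGroup G] [CommGroup H]

theorem map_hallPart [Finite G] (f : G →* H) (μ : Set ℕ) (T : Subgroup G) :
    (hallPart μ T).map f = hallPart μ (T.map f) := by
  apply le_antisymm
  · rintro _ ⟨x, ⟨hx, hx2⟩, rfl⟩
    exact ⟨⟨x, hx, rfl⟩, fun p hp h => hx2 p hp (h.trans (orderOf_map_dvd f x))⟩
  · rintro _ ⟨⟨x, hx, rfl⟩, hy⟩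
    induction hN : orderOf x using Nat.strong_induction_on generalizing x with
    | _ N ih =>
    by_cases hμ : ∀ p : ℕ, p.Prime → p ∣ orderOf x → p ∈ μ
    · exact ⟨x, ⟨hx, hμ⟩, rfl⟩
    · push Not at hμ
      obtain ⟨p, hp, hpx, hpμ⟩ := hμ
      have hcop : Nat.Coprime p (orderOf (f x)) :=
        (Nat.Prime.coprime_iff_not_dvd hp).mpr fun h => hpμ (hy p hp h)
      obtain ⟨c, hc⟩ := exists_pow_eq_self_of_coprime hcop
      obtain ⟨d, hd⟩ := hpx
      have hpos := orderOf_pos x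
      have hfx : f ((x ^ p) ^ c) = f x := by rw [map_pow, map_pow, hc]
      have hlt : orderOf ((x ^ p) ^ c) < N := by
        refine lt_of_le_of_lt (Nat.le_of_dvd ?_ (orderOf_pow_dvd c)) ?_
        · exact orderOf_pos _
        · rw [orderOf_pow' x hp.ne_zero, hN, Nat.gcd_eq_right (hN ▸ ⟨d, hd⟩)]
          exact Nat.div_lt_self (hN ▸ hpos) hp.one_lt
      have := ih _ hlt ((x ^ p) ^ c) (T.pow_mem (T.pow_mem hx p) c) (by rwa [hfx]) rfl
      rwa [hfx] at this

theorem pow_dvd_card_hallPart_iff [Finite G] {μ : Set ℕ} (g : G) {p : ℕ} (hp : p.Prime)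
    (hpμ : p ∈ μ) (k : ℕ) :
    p ^ k ∣ Nat.card (hallPart μ (Subgroup.zpowers g)) ↔ p ^ k ∣ orderOf g := by
  constructor
  · intro h
    rw [← Nat.card_zpowers]
    exact h.trans (Subgroup.card_dvd_of_le fun x hx => hx.1)
  · rintro ⟨c, hc⟩
    have hpos := orderOf_pos g
    have hc0 : c ≠ 0 := by rintro rfl; omega
    have ho : orderOf (g ^ c) = p ^ k := by
      rw [orderOf_pow' g hc0, hc, Nat.gcd_eq_right (Dvd.intro_left _ rfl),
        Nat.mul_div_cancel _ (Nat.pos_of_ne_zero hc0)]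
    have hmem : g ^ c ∈ hallPart μ (Subgroup.zpowers g) := by
      refine ⟨pow_mem (Subgroup.mem_zpowers g) c, fun q hq hqd => ?_⟩
      rw [ho] at hqd
      rwa [(Nat.prime_dvd_prime_iff_eq hq hp).mp (hq.dvd_of_dvd_pow hqd)]
    rw [← ho]
    exact Subgroup.orderOf_dvd_natCard _ hmem

end Hall

section Res

variable {m : ℕ} {u : (ZMod m)ˣ} {t : ℕ}

theorem unitsMap_coe (hu : (u : ZMod m) = t) {d : ℕ} (h : d ∣ m) :
    (ZMod.unitsMap h u : ZMod d) = t := by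
  rw [ZMod.unitsMap_val, hu, ZMod.cast_natCast h]

theorem natCast_eq_one_iff {d : ℕ} (t : ℕ) : (t : ZMod d) = 1 ↔ (d : ℤ) ∣ t - 1 := by
  rw [← ZMod.intCast_zmod_eq_zero_iff_dvd]
  push_cast
  rw [sub_eq_zero]

theorem res_zpowers {d : ℕ} (h : d ∣ m) (u : (ZMod m)ˣ) :
    res h (Subgroup.zpowers u) = Subgroup.zpowers (ZMod.unitsMap h u) :=
  MonoidHom.map_zpowers _ _

theorem res_eq_bot_iff (hu : (u : ZMod m) = t) {d : ℕ} (h : d ∣ m) :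
    res h (Subgroup.zpowers u) = ⊥ ↔ (d : ℤ) ∣ t - 1 := by
  rw [res_zpowers, Subgroup.zpowers_eq_bot, Units.ext_iff, unitsMap_coe hu, Units.val_one,
    natCast_eq_one_iff]

theorem res_le_zpowers_neg_one_iff (hu : (u : ZMod m) = t) {d : ℕ} (h : d ∣ m) :
    res h (Subgroup.zpowers u) ≤ Subgroup.zpowers (-1) ↔ (d : ℤ) ∣ t - 1 ∨ (d : ℤ) ∣ t + 1 := by
  rw [res_zpowers, Subgroup.zpowers_le, ← natCast_eq_one_iff]
  have h1 : (d : ℤ) ∣ t + 1 ↔ (t : ZMod d) = -1 := by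
    rw [← ZMod.intCast_zmod_eq_zero_iff_dvd, eq_neg_iff_add_eq_zero]
    push_cast
    rfl
  rw [h1, ← unitsMap_coe hu h]
  constructor
  · rintro ⟨k, hk⟩
    rcases Int.even_or_odd k with he | ho
    · left
      rw [← hk]
      simp [he.neg_one_zpow]
    · right
      rw [← hk]
      simp [ho.neg_one_zpow]
  · rintro (h2 | h2)
    · rw [Units.val_eq_one] at h2
      rw [h2]
      exact one_mem _
    · have : ZMod.unitsMap h u = -1 := Units.ext (by simpa using h2)
      rw [this]
      exact Subgroup.mem_zpowers _

theorem isAdmissible_iff (hm : 0 < m) (hu : (u : ZMod m) = t) {d : ℕ} :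
    IsAdmissible (Subgroup.zpowers u) d ↔ d ∣ m ∧
      (∀ p k : ℕ, p.Prime → p ≠ 2 → p ^ k ∣ d → (p : ℤ) ^ k ∣ t - 1) ∧
      ∀ k : ℕ, 2 ^ k ∣ d → (2 : ℤ) ^ k ∣ t - 1 ∨ (2 : ℤ) ^ k ∣ t + 1 := by
  unfold IsAdmissible
  simp only [res_eq_bot_iff hu, res_le_zpowers_neg_one_iff hu, exists_prop]
  refine and_congr_right fun hd => ?_
  have hd0 : d ≠ 0 := ne_zero_of_dvd_ne_zero hm.ne' hd
  refine and_congr ?_ ?_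
  · rw [Int.natCast_dvd, Nat.dvd_iff_prime_pow_dvd_dvd]
    constructor
    · intro h p k hp hp2 hk
      have := h p k hp ((Nat.Coprime.dvd_of_dvd_mul_left (k := p ^ k) (m := 2 ^ d.factorization 2)
        (Nat.Coprime.pow _ _ ((Nat.coprime_primes hp Nat.prime_two).mpr hp2))
        (by rwa [Nat.ordProj_mul_ordCompl_eq_self])))
      exact_mod_cast Int.natCast_dvd.mpr this
    · intro h p k hp hk
      rw [← Int.natCast_dvd]
      push_cast
      rcases eq_or_ne p 2 with rfl | hp2
      · rcases Nat.eq_zero_or_pos k with rfl | hk0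
        · simp
        · exact absurd ((dvd_pow_self 2 hk0.ne').trans hk) (Nat.not_dvd_ordCompl Nat.prime_two hd0)
      · exact h p k hp hp2 (hk.trans (Nat.ordCompl_dvd d 2))
  · unfold pPart
    push_cast
    constructor
    · intro h k hk
      have : k ≤ d.factorization 2 := (Nat.prime_two.pow_dvd_iff_le_factorization hd0).mp hk
      exact h.imp (pow_dvd_pow _ this).trans (pow_dvd_pow _ this).trans
    · exact fun h => h _ (Nat.ordProj_dvd d 2)

theorem isAdmissible_rInv (hm : 0 < m) (hu : (u : ZMod m) = t) :
    IsAdmissible (Subgroup.zpowers u) (rInv (Subgroup.zpowers u)) := by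
  classical
  have h1 : IsAdmissible (Subgroup.zpowers u) 1 := by
    rw [isAdmissible_iff hm hu]
    refine ⟨one_dvd _, fun p k hp _ h => ?_, fun k h => ?_⟩
    · have := Nat.dvd_one.mp h
      rw [← Nat.cast_pow, this]
      simp
    · have := Nat.dvd_one.mp h
      have h2 : (2 : ℤ) ^ k = 1 := by exact_mod_cast this
      simp [h2]
  unfold rInv
  convert Nat.findGreatest_spec (P := IsAdmissible (Subgroup.zpowers u)) hm h1

theorem rInv_ne_zero (hm : 0 < m) (T : Subgroup (ZMod m)ˣ) : rInv T ≠ 0 :=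
  ne_zero_of_dvd_ne_zero hm.ne' (rInv_dvd T)

theorem pow_dvd_lcm {p k a b : ℕ} (hp : p.Prime) (ha : a ≠ 0) (hb : b ≠ 0) (h : p ^ k ∣ a.lcm b) :
    p ^ k ∣ a ∨ p ^ k ∣ b := by
  rw [hp.pow_dvd_iff_le_factorization (Nat.lcm_ne_zero ha hb), Nat.factorization_lcm ha hb,
    Finsupp.sup_apply, le_sup_iff] at h
  exact h.imp (hp.pow_dvd_iff_le_factorization ha).mpr (hp.pow_dvd_iff_le_factorization hb).mpr

theorem pow_dvd_rInv_of (hm : 0 < m) (hu : (u : ZMod m) = t) {p k : ℕ} (hp : p.Prime)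
    (hk : p ^ k ∣ m) (h : IsAdmissible (Subgroup.zpowers u) (p ^ k)) :
    p ^ k ∣ rInv (Subgroup.zpowers u) := by
  classical
  have hr := isAdmissible_rInv hm hu
  have h0 := rInv_ne_zero hm (Subgroup.zpowers u)
  have hp0 : p ^ k ≠ 0 := pow_ne_zero _ hp.ne_zero
  have had : IsAdmissible (Subgroup.zpowers u) ((rInv (Subgroup.zpowers u)).lcm (p ^ k)) := by
    rw [isAdmissible_iff hm hu] at h hr ⊢
    refine ⟨Nat.lcm_dvd hr.1 hk, fun q j hq hq2 hqj => ?_, fun j hj => ?_⟩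
    · rcases pow_dvd_lcm hq h0 hp0 hqj with h3 | h3
      · exact hr.2.1 q j hq hq2 h3
      · exact h.2.1 q j hq hq2 h3
    · rcases pow_dvd_lcm Nat.prime_two h0 hp0 hj with h3 | h3
      · exact hr.2.2 j h3
      · exact h.2.2 j h3
  have hle : (rInv (Subgroup.zpowers u)).lcm (p ^ k) ≤ rInv (Subgroup.zpowers u) := by
    conv_rhs => unfold rInv
    convert Nat.le_findGreatest (Nat.le_of_dvd hm had.1) had
  have := Nat.le_antisymm hle (Nat.le_of_dvd (Nat.pos_of_ne_zero (Nat.lcm_ne_zero h0 hp0))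
    (Nat.dvd_lcm_left _ _))
  exact this ▸ Nat.dvd_lcm_right _ _

theorem pow_dvd_rInv_iff (hm : 0 < m) (hu : (u : ZMod m) = t) {p k : ℕ} (hp : p.Prime)
    (hp2 : p ≠ 2) (hk : p ^ k ∣ m) :
    p ^ k ∣ rInv (Subgroup.zpowers u) ↔ (p : ℤ) ^ k ∣ t - 1 := by
  constructor
  · exact fun h => ((isAdmissible_iff hm hu).mp (isAdmissible_rInv hm hu)).2.1 p k hp hp2 h
  · intro h
    refine pow_dvd_rInv_of hm hu hp hk ((isAdmissible_iff hm hu).mpr ⟨hk, ?_, ?_⟩)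
    · intro q j hq _ hqj
      rcases Nat.eq_zero_or_pos j with rfl | hj
      · simp
      · obtain rfl : q = p := (Nat.prime_dvd_prime_iff_eq hq hp).mp
          (hq.dvd_of_dvd_pow ((dvd_pow_self q hj.ne').trans hqj))
        exact (pow_dvd_pow _ ((Nat.pow_dvd_pow_iff_le_right hp.one_lt).mp hqj)).trans h
    · intro j hj
      rcases Nat.eq_zero_or_pos j with rfl | hj0
      · simp
      · exact absurd ((Nat.prime_dvd_prime_iff_eq Nat.prime_two hp).mp
          (Nat.prime_two.dvd_of_dvd_pow ((dvd_pow_self 2 hj0.ne').trans hj))) hp2.symm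

theorem two_pow_dvd_rInv_iff (hm : 0 < m) (hu : (u : ZMod m) = t) {k : ℕ} (hk : 2 ^ k ∣ m) :
    2 ^ k ∣ rInv (Subgroup.zpowers u) ↔ (2 : ℤ) ^ k ∣ t - 1 ∨ (2 : ℤ) ^ k ∣ t + 1 := by
  constructor
  · exact fun h => ((isAdmissible_iff hm hu).mp (isAdmissible_rInv hm hu)).2.2 k h
  · intro h
    refine pow_dvd_rInv_of hm hu Nat.prime_two hk ((isAdmissible_iff hm hu).mpr ⟨hk, ?_, ?_⟩)
    · intro q j hq hq2 hqj
      rcases Nat.eq_zero_or_pos j with rfl | hj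
      · simp
      · exact absurd ((Nat.prime_dvd_prime_iff_eq hq Nat.prime_two).mp
          (hq.dvd_of_dvd_pow ((dvd_pow_self q hj.ne').trans hqj))) hq2
    · intro j hj
      have hjk := (Nat.pow_dvd_pow_iff_le_right (le_refl 2)).mp hj
      exact h.imp (pow_dvd_pow _ hjk).trans (pow_dvd_pow _ hjk).trans

theorem dvd_sub_one_of_two_dvd (hu : (u : ZMod m) = t) (h : 2 ∣ m) : (2 : ℤ) ∣ t - 1 := by
  have h1 := unitsMap_coe hu h
  have h2 : ∀ w : (ZMod 2)ˣ, (w : ZMod 2) = 1 := by decide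
  rw [h2] at h1
  exact_mod_cast (natCast_eq_one_iff (d := 2) t).mp h1.symm

theorem epsInv_eq_one_or (T : Subgroup (ZMod m)ˣ) : epsInv T = 1 ∨ epsInv T = -1 := by
  unfold epsInv
  split_ifs <;> simp

theorem epsInv_eq_neg_one_iff (hm : 0 < m) (hu : (u : ZMod m) = t) :
    epsInv (Subgroup.zpowers u) = -1 ↔ 4 ∣ m ∧ (4 : ℤ) ∣ t + 1 := by
  have h1 : epsInv (Subgroup.zpowers u) = -1 ↔
      ¬ ((pPart 2 (rInv (Subgroup.zpowers u)) : ℕ) : ℤ) ∣ t - 1 := by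
    rw [← res_eq_bot_iff hu ((pPart_dvd 2 _).trans (rInv_dvd _))]
    unfold epsInv
    split_ifs with h <;> simpa using h
  have hr0 := rInv_ne_zero hm (Subgroup.zpowers u)
  have hdvd := pPart_dvd 2 (rInv (Subgroup.zpowers u))
  rw [h1]
  constructor
  · intro h
    have h2 := (two_pow_dvd_rInv_iff hm hu (hdvd.trans (rInv_dvd _))).mp hdvd
    have h3 : 2 ≤ (rInv (Subgroup.zpowers u)).factorization 2 := by
      by_contra hlt
      push Not at hlt
      apply h
      unfold pPart at h hdvd ⊢
      interval_cases hR : (rInv (Subgroup.zpowers u)).factorization 2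
      · simp
      · simpa using dvd_sub_one_of_two_dvd hu ((by simpa using hdvd : 2 ∣ _).trans (rInv_dvd _))
    have h4 : 4 ∣ pPart 2 (rInv (Subgroup.zpowers u)) := by
      rw [show (4 : ℕ) = 2 ^ 2 by norm_num]
      exact pow_dvd_pow 2 h3
    refine ⟨h4.trans (hdvd.trans (rInv_dvd _)), ?_⟩
    have h5 := h2.resolve_left (by simpa [pPart] using h)
    simpa using (pow_dvd_pow (2 : ℤ) h3).trans h5
  · rintro ⟨h4, h5⟩ h
    have h6 : 2 ^ 2 ∣ rInv (Subgroup.zpowers u) :=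
      (two_pow_dvd_rInv_iff hm hu (by simpa using h4)).mpr (Or.inr (by simpa using h5))
    have h7 : 2 ^ 2 ∣ pPart 2 (rInv (Subgroup.zpowers u)) :=
      pow_dvd_pow 2 ((Nat.prime_two.pow_dvd_iff_le_factorization hr0).mp h6)
    have h8 : (4 : ℤ) ∣ t - 1 := by
      have := (Int.natCast_dvd_natCast.mpr h7).trans h
      simpa using this
    omega

theorem pow_dvd_rInv_iff_of_eps (hm : 0 < m) (hu : (u : ZMod m) = t) {p k : ℕ} (hp : p.Prime)
    (he : epsInv (Subgroup.zpowers u) ^ (p - 1) = 1) (hk : p ^ k ∣ m) :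
    p ^ k ∣ rInv (Subgroup.zpowers u) ↔ (p : ℤ) ^ k ∣ t - 1 := by
  rcases eq_or_ne p 2 with rfl | hp2
  · have he' : ¬ (4 ∣ m ∧ (4 : ℤ) ∣ t + 1) := by
      rw [← epsInv_eq_neg_one_iff hm hu]
      intro h
      rw [h] at he
      norm_num at he
    rw [two_pow_dvd_rInv_iff hm hu hk]
    refine ⟨fun h => ?_, Or.inl⟩
    rcases h with h | h
    · exact h
    · rcases Nat.lt_or_ge k 2 with hk2 | hk2
      · interval_cases k
        · simp
        · simpa using dvd_sub_one_of_two_dvd hu (by simpa using hk)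
      · exfalso
        apply he'
        exact ⟨by simpa using (pow_dvd_pow 2 hk2).trans hk,
          by simpa using (pow_dvd_pow (2 : ℤ) hk2).trans h⟩
  · exact pow_dvd_rInv_iff hm hu hp hp2 hk

theorem two_pow_dvd_rInv_iff_of_eps (hm : 0 < m) (hu : (u : ZMod m) = t) {k : ℕ}
    (he : epsInv (Subgroup.zpowers u) = -1) (hk : 2 ^ k ∣ m) :
    2 ^ k ∣ rInv (Subgroup.zpowers u) ↔ (2 : ℤ) ^ k ∣ t + 1 := by
  rw [two_pow_dvd_rInv_iff hm hu hk]
  rw [epsInv_eq_neg_one_iff hm hu] at he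
  refine ⟨fun h => ?_, Or.inr⟩
  rcases h with h | h
  · rcases Nat.lt_or_ge k 2 with hk2 | hk2
    · interval_cases k
      · simp
      · have := dvd_sub_one_of_two_dvd hu (by simpa using hk)
        norm_num
        omega
    · have := (pow_dvd_pow (2 : ℤ) hk2).trans h
      norm_num at this
      omega
  · exact h

theorem dvd_rInv_iff (hm : 0 < m) (hu : (u : ZMod m) = t) {p : ℕ} (hp : p.Prime) (hpm : p ∣ m) :
    p ∣ rInv (Subgroup.zpowers u) ↔ (p : ℤ) ∣ t - 1 := by
  rcases eq_or_ne p 2 with rfl | hp2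
  · have := dvd_sub_one_of_two_dvd hu hpm
    simpa [this] using two_pow_dvd_rInv_iff (k := 1) hm hu (by simpa using hpm)
  · simpa using pow_dvd_rInv_iff (k := 1) hm hu hp hp2 (by simpa using hpm)

theorem mem_primeFactors_rInv_iff (hm : 0 < m) (hu : (u : ZMod m) = t) {p : ℕ} :
    p ∈ (rInv (Subgroup.zpowers u)).primeFactors ↔ p.Prime ∧ p ∣ m ∧ (p : ℤ) ∣ t - 1 := by
  rw [Nat.mem_primeFactors_of_ne_zero (rInv_ne_zero hm _)]
  refine and_congr_right fun hp => ⟨fun h => ?_, fun h => (dvd_rInv_iff hm hu hp h.1).mpr h.2⟩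
  have := h.trans (rInv_dvd _)
  exact ⟨this, (dvd_rInv_iff hm hu hp this).mp h⟩

theorem mem_nuSet_iff (hm : 0 < m) (hu : (u : ZMod m) = t) {p : ℕ} :
    p ∈ nuSet (Subgroup.zpowers u) ↔ p.Prime ∧ p ∣ m ∧ ¬ (p : ℤ) ∣ t - 1 := by
  rw [nuSet, Finset.mem_sdiff, mem_primeFactors_rInv_iff hm hu,
    Nat.mem_primeFactors_of_ne_zero hm.ne']
  tauto

theorem pow_dvd_oInv_iff (hm : 0 < m) (hu : (u : ZMod m) = t) {p : ℕ} (hp : p.Prime)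
    (hν : p ∉ nuSet (Subgroup.zpowers u)) (k : ℕ) :
    p ^ k ∣ oInv (Subgroup.zpowers u) ↔
      p ^ k ∣ orderOf (t : ZMod (setPart (nuSet (Subgroup.zpowers u)) m)) := by
  have : NeZero m := ⟨hm.ne'⟩
  have : NeZero (setPart (nuSet (Subgroup.zpowers u)) m) :=
    ⟨ne_zero_of_dvd_ne_zero hm.ne' (setPart_dvd _ _)⟩
  unfold oInv
  rw [show res (setPart_dvd (nuSet (Subgroup.zpowers u)) m)
      (hallPart ((nuSet (Subgroup.zpowers u) : Set ℕ)ᶜ) (Subgroup.zpowers u)) =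
      hallPart _ (res (setPart_dvd (nuSet (Subgroup.zpowers u)) m) (Subgroup.zpowers u)) from
    map_hallPart _ _ _, res_zpowers, pow_dvd_card_hallPart_iff _ hp (by simpa using hν),
    ← orderOf_units, unitsMap_coe hu]

theorem oInv_ne_zero (hm : 0 < m) (T : Subgroup (ZMod m)ˣ) : oInv T ≠ 0 := by
  have : NeZero m := ⟨hm.ne'⟩
  have : NeZero (setPart (nuSet T) m) := ⟨ne_zero_of_dvd_ne_zero hm.ne' (setPart_dvd _ _)⟩
  exact Nat.card_pos.ne'

end Res

end Metacyclic

namespace Metacyclic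

open Finset

section TwoPairs

variable {G : Type*} [Group G] {m n s t t' v v' : ℕ} {a b x y : G}

theorem IsPair.exists_hom_left (h : IsPair m n s t a b) (hm : 0 < m) (hn : 0 < n) {p : ℕ}
    (hpm : p ∣ m) (hps : p ∣ s) (hpt : (p : ℤ) ∣ t - 1) :
    ∃ f : G →* Multiplicative (ZMod p),
      ∀ i j : ℕ, f (b ^ i * a ^ j) = Multiplicative.ofAdd (j : ZMod p) := by
  obtain ⟨f, fa, fb⟩ := h.exists_hom (a' := Multiplicative.ofAdd (1 : ZMod p)) (b' := 1) hm hn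
    (by rw [← ofAdd_nsmul]; simp [(ZMod.natCast_eq_zero_iff m p).mpr hpm])
    (by rw [← ofAdd_nsmul]; simp [(ZMod.natCast_eq_zero_iff s p).mpr hps])
    (by rw [← ofAdd_nsmul]; simp [(natCast_eq_one_iff t).mpr hpt])
  refine ⟨f, fun i j => ?_⟩
  rw [map_mul, map_pow, map_pow, fa, fb, one_pow, one_mul, ← ofAdd_nsmul]
  simp

theorem IsPair.exists_hom_right (h : IsPair m n s t a b) (hm : 0 < m) (hn : 0 < n) {p : ℕ}
    (hpn : p ∣ n) :
    ∃ f : G →* Multiplicative (ZMod p),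
      ∀ i j : ℕ, f (b ^ i * a ^ j) = Multiplicative.ofAdd (i : ZMod p) := by
  obtain ⟨f, fa, fb⟩ := h.exists_hom (b' := Multiplicative.ofAdd (1 : ZMod p)) (a' := 1) hm hn
    (by simp)
    (by rw [← ofAdd_nsmul]; simp [(ZMod.natCast_eq_zero_iff n p).mpr hpn])
    (by simp)
  refine ⟨f, fun i j => ?_⟩
  rw [map_mul, map_pow, map_pow, fa, fb, one_pow, mul_one, ← ofAdd_nsmul]
  simp

variable {e j k l : ℕ}

theorem IsPair.not_dvd_and_dvd (h : IsPair m n s t a b) (h' : IsPair m n s t' x y) (hm : 0 < m)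
    (hn : 0 < n) (hx : x = b ^ e * a ^ j) (hy : y = b ^ k * a ^ l) {p : ℕ} (hp : p.Prime)
    (hpn : p ∣ n) (hpe : p ∣ e) : ¬ p ∣ k := by
  have := Fact.mk hp
  intro hpk
  obtain ⟨f, hf⟩ := h.exists_hom_right hm hn hpn
  have fx : f x = 1 := by rw [hx, hf, (ZMod.natCast_eq_zero_iff e p).mpr hpe, ofAdd_zero]
  have fy : f y = 1 := by rw [hy, hf, (ZMod.natCast_eq_zero_iff k p).mpr hpk, ofAdd_zero]
  obtain ⟨i, i', hb⟩ := h'.exists_eq hm hn b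
  have h1 := hf 1 0
  rw [pow_one, pow_zero, mul_one, hb, map_mul, map_pow, map_pow, fx, fy] at h1
  have h2 := congrArg Multiplicative.toAdd h1
  simp at h2

theorem IsPair.not_dvd_and_dvd' (h : IsPair m n s t a b) (h' : IsPair m n s t' x y) (hm : 0 < m)
    (hn : 0 < n) (hx : x = b ^ e * a ^ j) (hy : y = b ^ k * a ^ l) {p : ℕ} (hp : p.Prime)
    (hpm : p ∣ m) (hps : p ∣ s) (hpt : (p : ℤ) ∣ t - 1)
    (hpn : p ∣ n) (hpe : p ∣ e) : ¬ p ∣ j := by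
  have := Fact.mk hp
  intro hpj
  obtain ⟨f, hf⟩ := h.exists_hom_right hm hn hpn
  obtain ⟨g, hg⟩ := h.exists_hom_left hm hn hpm hps hpt
  have fx : f x = 1 := by rw [hx, hf, (ZMod.natCast_eq_zero_iff e p).mpr hpe, ofAdd_zero]
  have gx : g x = 1 := by rw [hx, hg, (ZMod.natCast_eq_zero_iff j p).mpr hpj, ofAdd_zero]
  have fy : f y = Multiplicative.ofAdd (k : ZMod p) := by rw [hy, hf]
  have gy : g y = Multiplicative.ofAdd (l : ZMod p) := by rw [hy, hg]
  obtain ⟨i, i', ha⟩ := h'.exists_eq hm hn a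
  have h1 := hf 0 1
  have h2 := hg 0 1
  rw [pow_one, pow_zero, one_mul, ha, map_mul, map_pow, map_pow, fx, fy, one_pow, mul_one,
    ← ofAdd_nsmul] at h1
  rw [pow_one, pow_zero, one_mul, ha, map_mul, map_pow, map_pow, gx, gy, one_pow, mul_one,
    ← ofAdd_nsmul] at h2
  have h3 := congrArg Multiplicative.toAdd h1
  have h4 := congrArg Multiplicative.toAdd h2
  simp at h3 h4
  rcases h3 with h3 | h3
  · rw [h3] at h4
    simp at h4
  · exact h.not_dvd_and_dvd h' hm hn hx hy hp hpn hpe ((ZMod.natCast_eq_zero_iff k p).mp h3)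

theorem IsPair.pow_mem (h : IsPair m n s t a b) (h' : IsPair m n s (v' + 1) x y)
    (ht : t = v + 1) (hx : x = b ^ e * a ^ j) (hy : y = b ^ k * a ^ l) :
    a ^ (l * t ^ e + j) * x ^ v' = a ^ (j * t ^ k + l) ∧ x ^ v' ∈ Subgroup.zpowers (a ^ v) := by
  have h1 : a ^ (l * t ^ e + j) * x ^ v' = a ^ (j * t ^ k + l) := by
    have h2 := h'.mul_comm'
    rw [pow_succ', ← mul_assoc] at h2
    have h3 : x * y = b ^ (e + k) * a ^ (j * t ^ k + l) := by
      rw [hx, hy, mul_mul_mul_of_rel h.mul_comm']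
    have h4 : y * x = b ^ (e + k) * a ^ (l * t ^ e + j) := by
      rw [hx, hy, mul_mul_mul_of_rel h.mul_comm', add_comm k]
    rw [h3, h4, mul_assoc] at h2
    exact (mul_left_cancel h2).symm
  refine ⟨h1, ?_⟩
  have key : ∀ i : ℕ, ∃ c, t ^ i = 1 + v * c := by
    intro i
    have : (v : ℤ) ∣ (t : ℤ) ^ i - 1 := dvd_pow_sub_one (by rw [ht]; simp) i
    have h3 : v ∣ t ^ i - 1 := by
      have h4 : 1 ≤ t ^ i := Nat.one_le_pow _ _ (by omega)
      zify [h4]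
      exact this
    obtain ⟨c, hc⟩ := h3
    exact ⟨c, by have : 1 ≤ t ^ i := Nat.one_le_pow _ _ (by omega)
                 omega⟩
  obtain ⟨c, hc⟩ := key e
  obtain ⟨d, hd⟩ := key k
  have h5 : x ^ v' = (a ^ v) ^ (((j * d : ℕ) : ℤ) - ((l * c : ℕ) : ℤ)) := by
    rw [← zpow_natCast a v, ← zpow_mul, ← inv_mul_eq_iff_eq_mul.mpr h1.symm, ← zpow_natCast,
      ← zpow_natCast, ← zpow_neg, ← zpow_add, hc, hd]
    congr 1
    push_cast
    ring
  rw [h5]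
  exact Subgroup.zpow_mem _ (Subgroup.mem_zpowers _) _

/-- The relations between the exponents of two pairs of generators. -/
theorem IsPair.relations (h : IsPair m n s t a b) (h' : IsPair m n s t' x y) (hm : 0 < m)
    (hn : 0 < n) (ht : t = v + 1) (ht' : t' = v' + 1) :
    m.gcd v = m.gcd v' ∧ ∃ e j k l : ℕ, x = b ^ e * a ^ j ∧ y = b ^ k * a ^ l ∧
      t ^ k ≡ t' [MOD m / m.gcd v] ∧ t ^ e ≡ 1 [MOD m / m.gcd v] ∧
      (∃ w, n * w = e * v' ∧ s * w + j * ∑ i ∈ range v', (t ^ e) ^ i + (l * t ^ e + j) ≡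
        j * t ^ k + l [MOD m]) ∧
      ∃ w, n * w = e * s ∧ s * k + l * ∑ i ∈ range n, (t ^ k) ^ i ≡
        s * w + j * ∑ i ∈ range s, (t ^ e) ^ i [MOD m] := by
  obtain ⟨e, j, hx⟩ := h.exists_eq hm hn x
  obtain ⟨k, l, hy⟩ := h.exists_eq hm hn y
  obtain ⟨e', j', ha⟩ := h'.exists_eq hm hn a
  obtain ⟨k', l', hb⟩ := h'.exists_eq hm hn b
  obtain ⟨h1, h2⟩ := h.pow_mem (ht' ▸ h') ht hx hy
  obtain ⟨-, h3⟩ := h'.pow_mem (ht ▸ h) ht' ha hb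
  have hfa : IsOfFinOrder a := isOfFinOrder_iff_pow_eq_one.mpr ⟨m, hm, h.pow_eq_one⟩
  have hfx : IsOfFinOrder x := isOfFinOrder_iff_pow_eq_one.mpr ⟨m, hm, h'.pow_eq_one⟩
  have hz : Subgroup.zpowers (x ^ v') = Subgroup.zpowers (a ^ v) :=
    le_antisymm (Subgroup.zpowers_le.mpr h2) (Subgroup.zpowers_le.mpr h3)
  have hdiv : ∀ c d : ℕ, m / m.gcd c = m / m.gcd d → m.gcd c = m.gcd d := by
    intro c d hcd
    have e1 := Nat.div_mul_cancel (Nat.gcd_dvd_left m c)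
    have e2 := Nat.div_mul_cancel (Nat.gcd_dvd_left m d)
    rw [hcd] at e1
    have : 0 < m / m.gcd d := Nat.pos_of_ne_zero fun h0 => by rw [h0] at e2; omega
    exact Nat.eq_of_mul_eq_mul_left this (e1.trans e2.symm)
  have ho : ∀ c, orderOf (a ^ c) = m / m.gcd c := fun c => by
    rw [hfa.orderOf_pow, h.orderOf_eq]
  have ho' : ∀ c, orderOf (x ^ c) = m / m.gcd c := fun c => by
    rw [hfx.orderOf_pow, h'.orderOf_eq]
  have hg : m.gcd v = m.gcd v' := by
    refine hdiv _ _ ?_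
    rw [← ho v, ← ho' v', ← Nat.card_zpowers, ← Nat.card_zpowers, hz]
  obtain ⟨c, hc⟩ : ∃ c : ℕ, x ^ v' = a ^ c := by
    obtain ⟨c, hc⟩ := (hfa.mem_powers_iff_mem_zpowers).mpr
      (Subgroup.zpowers_le.mpr (Subgroup.pow_mem _ (Subgroup.mem_zpowers a) v) h2)
    exact ⟨c, hc.symm⟩
  have hgc : m.gcd c = m.gcd v := by
    refine hdiv _ _ ?_
    rw [← ho, ← ho, ← hc, ← Nat.card_zpowers, ← Nat.card_zpowers, hz]
  refine ⟨hg, e, j, k, l, hx, hy, ?_, ?_, ?_, ?_⟩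
  · have h4 := pow_mul_pow_of_rel h'.mul_comm' v' 1
    rw [pow_one, pow_one, pow_mul, hc, ← pow_mul, hy, mul_assoc (b ^ k), ← pow_add, ← mul_assoc,
      pow_mul_pow_of_rel h.mul_comm', mul_assoc, ← pow_add] at h4
    have h5 := h.modEq_of_eq (mul_left_cancel h4)
    rw [add_comm l] at h5
    rw [← hgc]
    exact Nat.ModEq.cancel_left_div_gcd hm (Nat.ModEq.add_right_cancel' l h5)
  · have h4 : x ^ v' * x = x * x ^ v' := by rw [← pow_succ, ← pow_succ']
    rw [hc, hx, ← mul_assoc, pow_mul_pow_of_rel h.mul_comm', mul_assoc, mul_assoc, ← pow_add,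
      ← pow_add] at h4
    have h5 := h.modEq_of_eq (mul_left_cancel h4)
    rw [add_comm j] at h5
    rw [← hgc]
    refine Nat.ModEq.cancel_left_div_gcd (c := c) hm ?_
    rw [mul_one]
    exact Nat.ModEq.add_right_cancel' j h5
  · have h4 := hc
    rw [hx, mul_pow_of_rel h.mul_comm'] at h4
    obtain ⟨w, hw⟩ := h.dvd_of_pow_mul_pow_eq h4
    refine ⟨w, hw.symm, ?_⟩
    have h5 : b ^ (n * w) = a ^ (s * w) := by rw [pow_mul, h.pow_eq, ← pow_mul]
    rw [hx, mul_pow_of_rel h.mul_comm', hw, h5, ← pow_add, ← pow_add] at h1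
    rw [add_comm (s * w + _)]
    exact h.modEq_of_eq h1
  · have h4 := h'.pow_eq
    rw [hx, hy, mul_pow_of_rel h.mul_comm', mul_pow_of_rel h.mul_comm', mul_comm k, pow_mul,
      h.pow_eq, ← pow_mul, ← pow_add] at h4
    obtain ⟨w, hw⟩ := h.dvd_of_pow_mul_pow_eq h4.symm
    refine ⟨w, hw.symm, ?_⟩
    rw [hw] at h4
    exact (h.modEq_of_pow_mul_pow_eq h4.symm).symm

end TwoPairs

end Metacyclic

namespace Metacyclic

open Finset

section Bracket

variable {m : ℕ} {T T' : Subgroup (ZMod m)ˣ} {n s p : ℕ}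

theorem localPart_of_pos (hp : p.Prime) (he : epsInv T ^ (p - 1) = 1) :
    localPart T n s p = p ^ min (m.factorization p)
      (min ((oInv T).factorization p + (rInv T).factorization p)
        (max ((rInv T).factorization p) (max (s.factorization p)
          ((rInv T).factorization p + s.factorization p + (oInv T).factorization p -
            n.factorization p)))) := by
  have hmono : Monotone fun k : ℕ => p ^ k := pow_right_mono₀ hp.one_le
  have hmin : ∀ a b : ℕ, p ^ min a b = min (p ^ a) (p ^ b) := fun a b => hmono.map_min
  have hmax : ∀ a b : ℕ, p ^ max a b = max (p ^ a) (p ^ b) := fun a b => hmono.map_max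
  unfold localPart pPart
  rw [if_pos he, hmin, hmin, pow_add, hmax]
  congr 3
  rw [← pow_add, ← pow_add]
  set X := (rInv T).factorization p + s.factorization p + (oInv T).factorization p
  rcases le_or_gt (n.factorization p) X with h | h
  · rw [Nat.pow_div h hp.pos, hmax]
  · rw [Nat.div_eq_of_lt (Nat.pow_lt_pow_right hp.one_lt h), Nat.sub_eq_zero_of_le h.le]
    simp

theorem localPart_two_of_neg (he : epsInv T = -1) :
    localPart T n s 2 = if (oInv T).factorization 2 ≤ 1 ∨
        m.factorization 2 ≤ (rInv T).factorization 2 + 1 then 2 ^ (rInv T).factorization 2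
      else if (oInv T).factorization 2 < n.factorization 2 ∧
        (s.factorization 2 ≠ n.factorization 2 + (rInv T).factorization 2 →
          s.factorization 2 + 1 = m.factorization 2 ∧
            m.factorization 2 < n.factorization 2 + (rInv T).factorization 2)
      then 2 ^ (m.factorization 2 - 1) else 2 ^ m.factorization 2 := by
  have hle : ∀ a b : ℕ, 2 ^ a ≤ 2 ^ b ↔ a ≤ b := fun a b => Nat.pow_le_pow_iff_right (by norm_num)
  have hlt : ∀ a b : ℕ, 2 ^ a < 2 ^ b ↔ a < b := fun a b => Nat.pow_lt_pow_iff_right (by norm_num)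
  have heq : ∀ a b : ℕ, 2 ^ a = 2 ^ b ↔ a = b := fun a b =>
    (Nat.pow_right_injective (le_refl 2)).eq_iff
  have h2 : ∀ a : ℕ, 2 * 2 ^ a = 2 ^ (a + 1) := fun a => by ring
  have h4 : ∀ a : ℕ, 4 * 2 ^ a = 2 ^ (a + 2) := fun a => by ring
  have e2 : ∀ a : ℕ, 2 ^ a ≤ 2 ↔ a ≤ 1 := fun a => hle a 1
  have e4 : ∀ a : ℕ, 4 ≤ 2 ^ a ↔ 2 ≤ a := fun a => hle 2 a
  unfold localPart pPart
  rw [he, if_neg (by norm_num)]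
  simp only [h2, h4, e2, e4, hle, hlt, heq, ← pow_add, ne_eq]
  by_cases h1 : (oInv T).factorization 2 ≤ 1 ∨ m.factorization 2 ≤ (rInv T).factorization 2 + 1
  · rw [if_pos h1, if_pos h1]
  · rw [if_neg h1, if_neg h1]
    push Not at h1
    have e3 : 2 ≤ (oInv T).factorization 2 := by omega
    have e4 : (rInv T).factorization 2 + 2 ≤ m.factorization 2 := by omega
    simp only [e3, e4, true_and]
    congr 1
    conv_lhs => rw [show m.factorization 2 = (m.factorization 2 - 1) + 1 by omega]
    rw [pow_succ, Nat.mul_div_cancel _ two_pos]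

theorem eps_pow_eq_one_or (T : Subgroup (ZMod m)ˣ) (hp : p.Prime) :
    epsInv T ^ (p - 1) = 1 ∨ p = 2 ∧ epsInv T = -1 := by
  rcases epsInv_eq_one_or T with h | h
  · left
    rw [h, one_pow]
  · rcases hp.eq_two_or_odd' with rfl | ho
    · exact Or.inr ⟨rfl, h⟩
    · left
      rw [h]
      exact (Nat.Odd.sub_odd ho odd_one).neg_one_pow

theorem localPart_congr (hp : p.Prime) (he : epsInv T = epsInv T')
    (hr : (rInv T).factorization p = (rInv T').factorization p)
    (ho : (oInv T).factorization p = (oInv T').factorization p) :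
    localPart T n s p = localPart T' n s p := by
  rcases eps_pow_eq_one_or T hp with h | ⟨rfl, h⟩
  · rw [localPart_of_pos hp h, localPart_of_pos hp (he ▸ h), hr, ho]
  · rw [localPart_two_of_neg h, localPart_two_of_neg (he ▸ h), hr, ho]

theorem bracket_congr (hν : nuSet T = nuSet T')
    (hr : (rInv T).primeFactors = (rInv T').primeFactors) (he : epsInv T = epsInv T')
    (h : ∀ p ∈ (rInv T).primeFactors, (rInv T).factorization p = (rInv T').factorization p ∧
      (oInv T).factorization p = (oInv T').factorization p) :
    bracket T n s = bracket T' n s := by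
  unfold bracket
  rw [hν, ← hr]
  congr 1
  exact prod_congr rfl fun p hp => localPart_congr (Nat.prime_of_mem_primeFactors hp) he
    (h p hp).1 (h p hp).2

theorem pPart_dvd_setPart {μ : Set ℕ} (hm : 0 < m) (hp : p.Prime) (hpm : p ∣ m) (hμ : p ∈ μ) :
    pPart p m ∣ setPart μ m := by
  classical
  unfold setPart
  exact dvd_prod_of_mem _ (mem_filter.mpr ⟨Nat.mem_primeFactors.mpr ⟨hp, hpm, hm.ne'⟩, hμ⟩)

theorem setPart_dvd_of {μ : Set ℕ} {X : ℤ}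
    (h : ∀ p : ℕ, p.Prime → p ∣ m → p ∈ μ → (p : ℤ) ^ m.factorization p ∣ X) :
    (setPart μ m : ℤ) ∣ X := by
  classical
  unfold setPart
  push_cast
  refine prod_dvd_of_coprime ?_ ?_
  · intro p hp q hq hpq
    have h1 := Nat.prime_of_mem_primeFactors (mem_filter.mp hp).1
    have h2 := Nat.prime_of_mem_primeFactors (mem_filter.mp hq).1
    exact Nat.isCoprime_iff_coprime.mpr (Nat.Coprime.pow _ _ ((Nat.coprime_primes h1 h2).mpr hpq))
  · intro p hp
    have := mem_filter.mp hp
    have := h p (Nat.prime_of_mem_primeFactors this.1) (Nat.dvd_of_mem_primeFactors this.1) this.2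
    simpa [pPart] using this

theorem dvd_of_forall_prime {q : ℕ} (hq : q ≠ 0) {X : ℤ}
    (h : ∀ p : ℕ, p.Prime → p ∣ q → (p : ℤ) ^ q.factorization p ∣ X) : (q : ℤ) ∣ X := by
  have h1 := setPart_dvd_of (m := q) (μ := Set.univ) (X := X) fun p hp hpq _ => h p hp hpq
  have h2 : setPart Set.univ q = q := by
    unfold setPart
    simp only [Set.mem_univ, filter_true]
    exact Nat.prod_factorization_pow_eq_self hq
  rwa [h2] at h1

theorem pPart_dvd_bracket (hm : 0 < m) (hp : p ∈ nuSet T) : pPart p m ∣ bracket T n s := by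
  have h := Nat.mem_primeFactors.mp (mem_sdiff.mp hp).1
  exact (pPart_dvd_setPart hm h.1 h.2.1 (mem_coe.mpr hp)).mul_right _

theorem localPart_dvd_bracket (hp : p ∈ (rInv T).primeFactors) :
    localPart T n s p ∣ bracket T n s :=
  (dvd_prod_of_mem _ hp).mul_left _

theorem exists_localPart_eq_pow (hm : 0 < m) (T : Subgroup (ZMod m)ˣ) (hp : p.Prime) :
    ∃ k ≤ m.factorization p, localPart T n s p = p ^ k :=
  (Nat.dvd_prime_pow hp).mp (localPart_dvd hm.ne' T n s p hp)

theorem bracket_dvd_of (hm : 0 < m) {X : ℤ}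
    (hν : ∀ p ∈ nuSet T, (p : ℤ) ^ m.factorization p ∣ X)
    (hr : ∀ p ∈ (rInv T).primeFactors, (localPart T n s p : ℤ) ∣ X) :
    (bracket T n s : ℤ) ∣ X := by
  have h1 : (setPart (nuSet T) m : ℤ) ∣ X := setPart_dvd_of fun p _ _ h => hν p h
  have h2 : ((∏ p ∈ (rInv T).primeFactors, localPart T n s p : ℕ) : ℤ) ∣ X := by
    push_cast
    refine prod_dvd_of_coprime ?_ hr
    intro p hp q hq hpq
    have hp' := Nat.prime_of_mem_primeFactors hp
    have hq' := Nat.prime_of_mem_primeFactors hq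
    obtain ⟨i, -, hi⟩ := exists_localPart_eq_pow (n := n) (s := s) hm T hp'
    obtain ⟨j, -, hj⟩ := exists_localPart_eq_pow (n := n) (s := s) hm T hq'
    refine Nat.isCoprime_iff_coprime.mpr ?_
    rw [hi, hj]
    exact Nat.Coprime.pow _ _ ((Nat.coprime_primes hp' hq').mpr hpq)
  unfold bracket
  rw [Nat.cast_mul]
  refine IsCoprime.mul_dvd ?_ h1 h2
  push_cast
  refine IsCoprime.prod_right fun p hp => ?_
  obtain ⟨i, -, hi⟩ := exists_localPart_eq_pow (n := n) (s := s) hm T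
    (Nat.prime_of_mem_primeFactors hp)
  rw [hi, Nat.cast_pow]
  refine IsCoprime.pow_right (Nat.isCoprime_iff_coprime.mpr ?_)
  refine setPart_coprime m (Nat.prime_of_mem_primeFactors hp) fun h => ?_
  exact (mem_sdiff.mp (mem_coe.mp h)).2 hp

theorem rInv_pow_dvd_localPart (hm : 0 < m) (hp : p.Prime) :
    p ^ (rInv T).factorization p ∣ localPart T n s p := by
  have hRM : (rInv T).factorization p ≤ m.factorization p :=
    (Nat.factorization_le_iff_dvd (rInv_ne_zero hm T) hm.ne').mpr (rInv_dvd T) p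
  rcases eps_pow_eq_one_or T hp with h | ⟨rfl, h⟩
  · rw [localPart_of_pos hp h]
    refine pow_dvd_pow _ ?_
    omega
  · rw [localPart_two_of_neg h]
    split_ifs with h1 h2 <;> refine pow_dvd_pow _ ?_ <;> omega

end Bracket

end Metacyclic

namespace Metacyclic

open Finset

section TwoAdic

theorem dvd_add_one_of_pow {q t : ℤ} (h : q ∣ t + 1) {k : ℕ} (hk : Odd k) : q ∣ t ^ k + 1 := by
  have := hk.add_dvd_pow_add_pow t 1
  rw [one_pow] at this
  exact h.trans this

theorem dvd_sub_one_of_even {q t : ℤ} (h : q ∣ t + 1) {k : ℕ} (hk : Even k) : q ∣ t ^ k - 1 := by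
  obtain ⟨i, rfl⟩ := hk
  rw [← two_mul, pow_mul]
  refine dvd_pow_sub_one ?_ i
  rw [show t ^ 2 - 1 = (t + 1) * (t - 1) by ring]
  exact h.mul_right _

theorem two_pow_not_dvd_two {M : ℕ} (hM : 2 ≤ M) : ¬ (2 : ℤ) ^ M ∣ 2 := by
  intro h
  have := (pow_dvd_pow (2 : ℤ) hM).trans h
  norm_num at this

theorem odd_of_dvd_pow_sub {t t' : ℤ} {M k : ℕ} (hM : 2 ≤ M) (ht : (2 : ℤ) ^ M ∣ t + 1)
    (ht' : (2 : ℤ) ^ M ∣ t' + 1) (h : (2 : ℤ) ^ M ∣ t ^ k - t') : Odd k := by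
  by_contra hk
  rw [Nat.not_odd_iff_even] at hk
  apply two_pow_not_dvd_two hM
  have := dvd_sub (dvd_add h ht') (dvd_sub_one_of_even ht hk)
  rwa [show t ^ k - t' + (t' + 1) - (t ^ k - 1) = 2 by ring] at this

theorem even_of_dvd_pow_sub_one {t : ℤ} {M k : ℕ} (hM : 2 ≤ M) (ht : (2 : ℤ) ^ M ∣ t + 1)
    (h : (2 : ℤ) ^ M ∣ t ^ k - 1) : Even k := by
  by_contra hk
  rw [Nat.not_even_iff_odd] at hk
  apply two_pow_not_dvd_two hM
  have := dvd_sub (dvd_add_one_of_pow ht hk) h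
  rwa [show t ^ k + 1 - (t ^ k - 1) = 2 by ring] at this

/-- The exact power of two dividing `t ^ e - 1`, for `t` congruent to `-1` modulo exactly
`2 ^ R`. -/
theorem exists_pow_sub_one_eq {t : ℤ} {R : ℕ} (hR : 2 ≤ R) (h : (2 : ℤ) ^ R ∣ t + 1)
    (h' : ¬ (2 : ℤ) ^ (R + 1) ∣ t + 1) {E e : ℕ} (hE : 1 ≤ E) (he : Odd e) :
    ∃ c, t ^ (2 ^ E * e) - 1 = 2 ^ (R + E) * c ∧ Odd c := by
  obtain ⟨a, ha⟩ := h
  have hao : Odd a := by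
    rw [← Int.not_even_iff_odd]
    rintro ⟨b, hb⟩
    exact h' ⟨b, by rw [ha, hb]; ring⟩
  have hsq : t ^ 2 - 1 = 2 ^ (R + 1) * (a * (2 ^ (R - 1) * a - 1)) := by
    obtain ⟨r, rfl⟩ : ∃ r, R = r + 1 := ⟨R - 1, by omega⟩
    have : t = 2 ^ (r + 1) * a - 1 := by linarith
    rw [this, Nat.add_sub_cancel]
    ring
  have hodd : ¬ ((2 : ℕ) : ℤ) ∣ a * (2 ^ (R - 1) * a - 1) := by
    rw [Nat.cast_ofNat, ← even_iff_two_dvd, Int.not_even_iff_odd]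
    refine hao.mul ?_
    have : Even ((2 : ℤ) ^ (R - 1) * a) := (even_two.pow_of_ne_zero (by omega)).mul_right _
    exact this.sub_odd odd_one
  obtain ⟨c, hc, hcc⟩ := exists_pow_prime_pow_sub_one Nat.prime_two (R := R + 1) (by omega)
    (fun _ => by omega) (by exact_mod_cast hsq) (E - 1)
  have hc2 : Odd c := by
    rw [← Int.not_even_iff_odd, even_iff_two_dvd]
    intro h2
    have h3 := dvd_sub (show ((2 : ℕ) : ℤ) ∣ c by exact_mod_cast h2) hcc
    rw [sub_sub_cancel] at h3
    exact hodd h3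
  rw [← pow_mul, ← pow_succ', Nat.sub_add_cancel hE, show R + 1 + (E - 1) = R + E by omega] at hc
  push_cast at hc
  refine ⟨c * ∑ i ∈ range e, (t ^ 2 ^ E) ^ i, ?_, hc2.mul ?_⟩
  · rw [pow_mul, ← mul_geom_sum, hc]
    ring
  · have h2 : (2 : ℤ) ∣ t ^ 2 ^ E - 1 := by
      rw [hc]
      exact (dvd_pow_self 2 (by omega)).mul_right _
    have h3 := dvd_geom_sum_sub h2 e
    rw [← even_iff_two_dvd, Int.even_sub, Int.even_coe_nat] at h3
    rw [← Int.not_even_iff_odd, h3, Nat.not_even_iff_odd]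
    exact he

end TwoAdic

/-- Relations between the exponents expressing the generators of a second presentation in terms of
those of a first one. -/
structure Linked (m n s t t' v' e j k l : ℕ) : Prop where
  eq_succ : t' = v' + 1
  dvd_iff : ∀ d : ℕ, d ∣ m → ((d : ℤ) ∣ t - 1 ↔ (d : ℤ) ∣ t' - 1)
  dvd_pow : ∀ d : ℕ, d * m.gcd v' ∣ m → (d : ℤ) ∣ (t : ℤ) ^ k - t' ∧ (d : ℤ) ∣ (t : ℤ) ^ e - 1
  rel : ∃ w : ℕ, n * w = e * v' ∧ (m : ℤ) ∣ s * w + j * ∑ i ∈ range v', ((t : ℤ) ^ e) ^ i +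
    (l * (t : ℤ) ^ e + j) - (j * (t : ℤ) ^ k + l)
  rel' : ∃ w : ℕ, n * w = e * s ∧ (m : ℤ) ∣ s * k + l * ∑ i ∈ range n, ((t : ℤ) ^ k) ^ i -
    (s * w + j * ∑ i ∈ range s, ((t : ℤ) ^ e) ^ i)
  gen : ∀ p : ℕ, p.Prime → p ∣ n → p ∣ e → ¬ p ∣ k
  gen' : ∀ p : ℕ, p.Prime → p ∣ n → p ∣ m → p ∣ s → (p : ℤ) ∣ t - 1 → p ∣ e → ¬ p ∣ j

theorem IsPair.exists_linked {G : Type*} [Group G] {m n s t t' v v' : ℕ} {a b x y : G}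
    (h : IsPair m n s t a b) (h' : IsPair m n s t' x y) (hm : 0 < m)
    (hn : 0 < n) (ht : t = v + 1) (ht' : t' = v' + 1) :
    ∃ e j k l, Linked m n s t t' v' e j k l := by
  obtain ⟨hg, e, j, k, l, hx, hy, h1, h2, ⟨w, hw, h3⟩, w', hw', h4⟩ := h.relations h' hm hn ht ht'
  refine ⟨e, j, k, l, ht', ?_, ?_, ⟨w, hw, ?_⟩, ⟨w', hw', ?_⟩, ?_, ?_⟩
  · intro d hd
    rw [ht, ht']
    push_cast
    rw [add_sub_cancel_right, add_sub_cancel_right, Int.natCast_dvd_natCast, Int.natCast_dvd_natCast]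
    constructor
    · exact fun h => ((Nat.dvd_gcd hd h).trans hg.dvd).trans (Nat.gcd_dvd_right _ _)
    · exact fun h => ((Nat.dvd_gcd hd h).trans hg.symm.dvd).trans (Nat.gcd_dvd_right _ _)
  · intro d hd
    rw [← hg] at hd
    have hd' : d ∣ m / m.gcd v := (Nat.dvd_div_iff_mul_dvd (Nat.gcd_dvd_left _ _)).mpr
      (by rwa [mul_comm])
    have e1 := (Nat.modEq_iff_dvd.mp (h1.of_dvd hd').symm)
    have e2 := (Nat.modEq_iff_dvd.mp (h2.of_dvd hd').symm)
    push_cast at e1 e2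
    exact ⟨e1, e2⟩
  · have := Nat.modEq_iff_dvd.mp h3.symm
    push_cast at this
    exact this
  · have := Nat.modEq_iff_dvd.mp h4.symm
    push_cast at this
    exact this
  · exact fun p hp hpn hpe => h.not_dvd_and_dvd h' hm hn hx hy hp hpn hpe
  · exact fun p hp hpn hpm hps hpt hpe => h.not_dvd_and_dvd' h' hm hn hx hy hp hpm hps hpt hpn hpe

section Local

variable {m n s t t' v' e j k l : ℕ}

theorem Linked.dvd_of_pos (L : Linked m n s t t' v' e j k l) {p M R S O N n' : ℕ} (hp : p.Prime)
    (hR : 1 ≤ R) (hM : p ^ M ∣ m) (hn : n = p ^ N * n') (hn' : ¬ p ∣ n')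
    (hS : p ^ S ∣ s) (ht : (p : ℤ) ^ R ∣ t - 1)
    (ht' : (p : ℤ) ^ R ∣ t' - 1) (hO : p ^ O ∣ e) (hj : 1 ≤ O → R < M → ¬ p ∣ j) :
    (p : ℤ) ^ min M (min (O + R) (max R (max S (R + S + O - N)))) ∣ (t : ℤ) ^ k - t' := by
  set X := min M (min (O + R) (max R (max S (R + S + O - N)))) with hX
  rcases le_or_gt X R with hXR | hXR
  · refine (pow_dvd_pow _ hXR).trans ?_
    have := dvd_sub (dvd_pow_sub_one ht k) ht'
    rwa [show (t : ℤ) ^ k - 1 - (t' - 1) = t ^ k - t' by ring] at this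
  have hXM : X ≤ M := by omega
  have hXO : X ≤ R + O := by omega
  have hXS : X ≤ S ∨ (X ≤ S + (R + O - N) ∧ N ≤ R + O) := by omega
  have hj' : ¬ p ∣ j := hj (by omega) (by omega)
  have hτ : (p : ℤ) ^ X ∣ (t : ℤ) ^ e - 1 :=
    (pow_dvd_pow _ hXO).trans (pow_add_dvd_pow_sub_one hR ht hO)
  obtain ⟨w, hw, hrel⟩ := L.rel
  have hsw : (p : ℤ) ^ X ∣ s * w := by
    rcases hXS with h | ⟨h, hN⟩
    · have : (p : ℤ) ^ S ∣ s := by exact_mod_cast hS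
      exact ((pow_dvd_pow _ h).trans this).mul_right _
    · have h1 : p ^ (R + O) ∣ n * w := by
        rw [hw, mul_comm e, pow_add]
        refine mul_dvd_mul ?_ hO
        have : (p : ℤ) ^ R ∣ (v' : ℤ) := by
          rw [L.eq_succ] at ht'
          push_cast at ht'
          rwa [add_sub_cancel_right] at ht'
        exact_mod_cast this
      rw [hn, mul_assoc, show R + O = N + (R + O - N) by omega, pow_add,
        Nat.mul_dvd_mul_iff_left (pow_pos hp.pos N)] at h1
      have h2 : p ^ (R + O - N) ∣ w := by
        refine Nat.Coprime.dvd_of_dvd_mul_left (Nat.Coprime.pow_left _ ?_) h1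
        exact (Nat.Prime.coprime_iff_not_dvd hp).mpr hn'
      have h3 : p ^ X ∣ s * w := (pow_dvd_pow _ h).trans (by rw [pow_add]; exact mul_dvd_mul hS h2)
      exact_mod_cast h3
  have h1 : (p : ℤ) ^ X ∣ s * w + j * ∑ i ∈ range v', ((t : ℤ) ^ e) ^ i +
      (l * (t : ℤ) ^ e + j) - (j * (t : ℤ) ^ k + l) := by
    refine (pow_dvd_pow _ hXM).trans (Dvd.dvd.trans ?_ hrel)
    exact_mod_cast hM
  have h2 := dvd_geom_sum_sub hτ v'
  have h3 : (p : ℤ) ^ X ∣ j * ((t : ℤ) ^ k - t') := by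
    have := dvd_sub (dvd_add hsw (dvd_add (h2.mul_left (j : ℤ)) (hτ.mul_left (l : ℤ)))) h1
    refine this.trans (dvd_of_eq ?_)
    rw [L.eq_succ]
    push_cast
    ring
  refine IsCoprime.dvd_of_dvd_mul_left (IsCoprime.pow_left ?_) h3
  exact Nat.isCoprime_iff_coprime.mpr ((Nat.Prime.coprime_iff_not_dvd hp).mpr hj')

theorem two_not_dvd_of_rel {c : ℤ} (h : (4 : ℤ) ∣ t' + 1) (hv : t' = v' + 1)
    (hc : (v' : ℤ) = 2 * c) : Odd c := by
  rw [hv] at h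
  push_cast at h
  rw [Int.odd_iff]
  omega

theorem Linked.not_jump (L : Linked m n s t t' v' e j k l) {M O : ℕ} (hM3 : 3 ≤ M)
    (hM : 2 ^ M ∣ m) (ht : (2 : ℤ) ^ M ∣ t + 1) (ht' : (2 : ℤ) ^ (M - 1) ∣ t' + 1)
    (ht'' : ¬ (2 : ℤ) ^ M ∣ t' + 1) (hk : (2 : ℤ) ^ (M - 1) ∣ (t : ℤ) ^ k - t')
    (he : (2 : ℤ) ^ (M - 1) ∣ (t : ℤ) ^ e - 1) (hs : 2 ^ (M - 1) ∣ s) (hn : 2 ∣ n)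
    (hO : 2 ^ O ∣ e) (hcan : 4 ∣ n → 2 ^ (O + 1) ∣ n → 2 ^ M ∣ s) : False := by
  have ht1 : (2 : ℤ) ^ (M - 1) ∣ t + 1 := (pow_dvd_pow _ (by omega)).trans ht
  have hk1 : Odd k := odd_of_dvd_pow_sub (by omega) ht1 ht' hk
  have he1 : Even e := even_of_dvd_pow_sub_one (by omega) ht1 he
  have hτ : (2 : ℤ) ^ M ∣ (t : ℤ) ^ e - 1 := dvd_sub_one_of_even ht he1
  have htk : (2 : ℤ) ^ M ∣ (t : ℤ) ^ k + 1 := dvd_add_one_of_pow ht hk1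
  have h4 : (4 : ℤ) ∣ t' + 1 := by
    have := (pow_dvd_pow (2 : ℤ) (show 2 ≤ M - 1 by omega)).trans ht'
    simpa using this
  have h4t : (4 : ℤ) ∣ t + 1 := by
    have := (pow_dvd_pow (2 : ℤ) (show 2 ≤ M by omega)).trans ht
    simpa using this
  have h2m : 2 ∣ m := (dvd_pow_self 2 (by omega)).trans hM
  have h2s : 2 ∣ s := (dvd_pow_self 2 (by omega)).trans hs
  have hj : Odd j := by
    rw [← Nat.not_even_iff_odd, even_iff_two_dvd]
    exact L.gen' 2 Nat.prime_two hn h2m h2s (by push_cast; omega) he1.two_dvd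
  obtain ⟨w, hw, hrel⟩ := L.rel
  have hrel2 : (2 : ℤ) ^ M ∣ s * w + j * ∑ i ∈ range v', ((t : ℤ) ^ e) ^ i +
      (l * (t : ℤ) ^ e + j) - (j * (t : ℤ) ^ k + l) :=
    Dvd.dvd.trans (by exact_mod_cast hM) hrel
  have h2 := dvd_geom_sum_sub hτ v'
  have h3 : (2 : ℤ) ^ M ∣ s * w + j * ((t' : ℤ) + 1) := by
    have := dvd_add (dvd_sub hrel2 (dvd_add (h2.mul_left (j : ℤ)) (hτ.mul_left (l : ℤ))))
      (htk.mul_left (j : ℤ))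
    refine this.trans (dvd_of_eq ?_)
    rw [L.eq_succ]
    push_cast
    ring
  obtain ⟨s', hs'⟩ := hs
  obtain ⟨d, hd⟩ := ht'
  have hdo : Odd d := by
    rw [← Int.not_even_iff_odd]
    rintro ⟨f, hf⟩
    refine ht'' ⟨f, ?_⟩
    rw [hd, hf, show (2 : ℤ) ^ M = 2 ^ (M - 1) * 2 by rw [← pow_succ, Nat.sub_add_cancel (by omega)]]
    ring
  have h5 : (2 : ℤ) ∣ s' * w + j * d := by
    have e1 : (2 : ℤ) ^ (M - 1) * 2 ∣ 2 ^ (M - 1) * (s' * w + j * d) := by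
      rw [← pow_succ, Nat.sub_add_cancel (by omega : 1 ≤ M)]
      refine h3.trans (dvd_of_eq ?_)
      rw [hd, hs']
      push_cast
      ring
    exact (mul_dvd_mul_iff_left (by positivity)).mp e1
  have h6 : Odd (s' * w) := by
    rw [← even_iff_two_dvd, Int.even_add, Int.even_mul, Int.even_mul] at h5
    rw [← Nat.not_even_iff_odd, Nat.even_mul]
    rw [← Int.not_even_iff_odd] at hdo
    rw [← Nat.not_even_iff_odd] at hj
    simp only [Int.even_coe_nat] at h5
    tauto
  have hs'o := Nat.odd_mul.mp h6
  obtain ⟨c, hc⟩ : 2 ∣ v' := by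
    have := L.eq_succ
    have : (2 : ℤ) ∣ v' := by
      rw [L.eq_succ] at h4
      push_cast at h4
      omega
    exact_mod_cast this
  have hwc : Nat.Coprime 2 w := by
    rw [Nat.coprime_two_left]
    exact hs'o.2
  obtain ⟨e', he'⟩ := he1.two_dvd
  have e1 : 4 ∣ n := by
    refine Nat.Coprime.dvd_of_dvd_mul_right (n := w) (Nat.Coprime.pow_left 2 hwc) ?_
    rw [hw, he', hc]
    exact ⟨e' * c, by ring⟩
  have e2 : 2 ^ (O + 1) ∣ n := by
    refine Nat.Coprime.dvd_of_dvd_mul_right (n := w) (Nat.Coprime.pow_left _ hwc) ?_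
    rw [hw, hc, pow_succ]
    exact mul_dvd_mul hO ⟨c, rfl⟩
  obtain ⟨f, hf⟩ := hcan e1 e2
  have h7 : s' = 2 * f := by
    have : 2 ^ (M - 1) * s' = 2 ^ (M - 1) * (2 * f) := by
      rw [← hs', hf, ← mul_assoc, ← pow_succ, Nat.sub_add_cancel (by omega)]
    exact Nat.eq_of_mul_eq_mul_left (by positivity) this
  exact (Nat.not_even_iff_odd.mpr hs'o.1) (by rw [h7]; exact even_two_mul f)

end Local

end Metacyclic

namespace Metacyclic

open Finset

variable {m n s t t' v' e j k l : ℕ}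

theorem pow_mul_dvd_pow_mul_iff {M : ℕ} (hM : 1 ≤ M) {a : ℤ} :
    (2 : ℤ) ^ M ∣ 2 ^ (M - 1) * a ↔ Even a := by
  rw [show (2 : ℤ) ^ M = 2 ^ (M - 1) * 2 by rw [← pow_succ, Nat.sub_add_cancel hM],
    mul_dvd_mul_iff_left (by positivity), even_iff_two_dvd]

theorem odd_sum_geom_sum {x : ℤ} (hx : (2 : ℤ) ∣ x - 1) {v c : ℕ} (hv : v = 2 * c) (hc : Odd c) :
    Odd (∑ j ∈ range v, ∑ i ∈ range j, x ^ i) := by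
  have h5 : (2 : ℤ) ∣ ∑ j ∈ range v, (∑ i ∈ range j, x ^ i - (j : ℤ)) :=
    dvd_sum fun j _ => dvd_geom_sum_sub hx j
  rw [sum_sub_distrib, ← even_iff_two_dvd, Int.even_sub, ← Nat.cast_sum, Int.even_coe_nat] at h5
  rw [← Int.not_even_iff_odd, h5, Nat.not_even_iff_odd]
  have h6 := sum_range_id_mul_two v
  have hpos : 0 < c := hc.pos
  have h7 : ∑ i ∈ range v, i = c * (2 * c - 1) := by
    rw [hv] at h6 ⊢
    have : (∑ i ∈ range (2 * c), i) * 2 = c * (2 * c - 1) * 2 := by rw [h6]; ring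
    exact Nat.eq_of_mul_eq_mul_right two_pos this
  rw [h7]
  exact hc.mul ⟨c - 1, by omega⟩

theorem Linked.dvd_of_geom_trivial (L : Linked m n s t t' v' e j k l) {M : ℕ} (hM : 2 ^ M ∣ m)
    (hj : Odd j) {w : ℕ}
    (hrel : (m : ℤ) ∣ s * w + j * ∑ i ∈ range v', ((t : ℤ) ^ e) ^ i +
      (l * (t : ℤ) ^ e + j) - (j * (t : ℤ) ^ k + l)) (hsw : (2 : ℤ) ^ M ∣ s * w)
    (hτ : (2 : ℤ) ^ M ∣ (t : ℤ) ^ e - 1) : (2 : ℤ) ^ M ∣ (t : ℤ) ^ k - t' := by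
  have h1 := (show (2 : ℤ) ^ M ∣ m by exact_mod_cast hM).trans hrel
  have h2 := dvd_geom_sum_sub hτ v'
  have h3 : (2 : ℤ) ^ M ∣ j * ((t : ℤ) ^ k - t') := by
    have := dvd_sub (dvd_add hsw (dvd_add (h2.mul_left (j : ℤ)) (hτ.mul_left (l : ℤ)))) h1
    refine this.trans (dvd_of_eq ?_)
    rw [L.eq_succ]
    push_cast
    ring
  refine IsCoprime.dvd_of_dvd_mul_left (IsCoprime.pow_left ?_) h3
  exact Nat.isCoprime_iff_coprime.mpr (Nat.coprime_two_left.mpr hj)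

theorem Linked.two_pow_dvd (L : Linked m n s t t' v' e j k l) {M R S O N n' s' : ℕ}
    (hM : 2 ^ M ∣ m) (hn : n = 2 ^ N * n') (hn' : Odd n') (hs : s = 2 ^ S * s') (hs' : Odd s')
    (hSM : S ≤ M) (hMS : M ≤ S + 1) (hR : 2 ≤ R) (hRM : R + 2 ≤ M) (hO : 2 ≤ O) (hOe : 2 ^ O ∣ e)
    (ht : (2 : ℤ) ^ R ∣ t + 1) (ht1 : ¬ (2 : ℤ) ^ (R + 1) ∣ t + 1) (ht' : (4 : ℤ) ∣ t' + 1)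
    (hk : (2 : ℤ) ^ (M - 1) ∣ (t : ℤ) ^ k - t')
    (htn : (2 : ℤ) ^ M ∣ (t : ℤ) ^ n - 1) (hc1 : S ≠ N + R)
    (hc2 : O < N → ¬ (S + 1 = M ∧ M < N + R)) : (2 : ℤ) ^ M ∣ (t : ℤ) ^ k - t' := by
  have h4t : (2 : ℤ) ^ 2 ∣ t + 1 := (pow_dvd_pow (2 : ℤ) hR).trans ht
  have hneven : Even n :=
    even_of_dvd_pow_sub_one le_rfl h4t ((pow_dvd_pow (2 : ℤ) (by omega)).trans htn)
  have hN : 1 ≤ N := by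
    by_contra h0
    have : N = 0 := by omega
    rw [hn, this, pow_zero, one_mul] at hneven
    exact Nat.not_even_iff_odd.mpr hn' hneven
  have hodd_pow : ∀ c : ℕ, Odd c → ∃ d, (t : ℤ) ^ (2 ^ N * c) - 1 = 2 ^ (R + N) * d ∧ Odd d :=
    fun c hc => exists_pow_sub_one_eq hR ht ht1 hN hc
  have hNR : M ≤ R + N := by
    obtain ⟨d, hd, hdo⟩ := hodd_pow n' hn'
    rw [← hn] at hd
    rw [hd] at htn
    by_contra hlt
    have h1 := (pow_dvd_pow (2 : ℤ) (show R + N + 1 ≤ M by omega)).trans htn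
    rw [pow_succ, mul_dvd_mul_iff_left (by positivity), ← even_iff_two_dvd] at h1
    exact Int.not_even_iff_odd.mpr hdo h1
  have hkodd : Odd k := odd_of_dvd_pow_sub le_rfl h4t (by simpa using ht')
    ((pow_dvd_pow (2 : ℤ) (by omega)).trans hk)
  have heeven : Even e := by
    rw [even_iff_two_dvd]
    exact (dvd_pow_self 2 (by omega)).trans hOe
  have h2m : 2 ∣ m := (dvd_pow_self 2 (by omega)).trans hM
  have h2s : 2 ∣ s := by
    rw [hs]
    exact (dvd_pow_self 2 (by omega)).mul_right _
  have hj : Odd j := by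
    rw [← Nat.not_even_iff_odd, even_iff_two_dvd]
    refine L.gen' 2 Nat.prime_two hneven.two_dvd h2m h2s ?_ heeven.two_dvd
    push_cast
    norm_num at h4t
    omega
  obtain ⟨c, hc⟩ : 2 ∣ v' := by
    have : (2 : ℤ) ∣ v' := by
      rw [L.eq_succ] at ht'
      push_cast at ht'
      omega
    exact_mod_cast this
  have hco : Odd c := by
    have := two_not_dvd_of_rel (c := c) ht' L.eq_succ (by rw [hc]; push_cast; ring)
    exact_mod_cast this
  obtain ⟨w, hw, hrel⟩ := L.rel
  obtain ⟨w', hw', hrel'⟩ := L.rel'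
  by_cases hNe : 2 ^ N ∣ e
  · obtain ⟨f, hf⟩ := hNe
    have hτ : (2 : ℤ) ^ M ∣ (t : ℤ) ^ e - 1 := by
      obtain ⟨d, hd, -⟩ := hodd_pow 1 odd_one
      rw [mul_one] at hd
      rw [hf, pow_mul]
      refine dvd_pow_sub_one ?_ f
      rw [hd]
      exact (pow_dvd_pow _ hNR).mul_right _
    have hwe : 2 ∣ w := by
      have h1 : n' * w = 2 * (f * c) := by
        refine Nat.eq_of_mul_eq_mul_left (show 0 < 2 ^ N by positivity) ?_
        rw [← mul_assoc, ← hn, hw, hf, hc]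
        ring
      exact Nat.Coprime.dvd_of_dvd_mul_left (Nat.coprime_two_left.mpr hn') ⟨_, h1⟩
    have hsw : 2 ^ M ∣ s * w := by
      rw [hs]
      refine (pow_dvd_pow 2 hMS).trans ?_
      rw [pow_succ]
      exact mul_dvd_mul (dvd_mul_right _ _) hwe
    exact L.dvd_of_geom_trivial hM hj hrel (by exact_mod_cast hsw) hτ
  have he : ∃ f, e = 2 ^ (N - 1) * f ∧ Odd f := by
    have h1 : 2 ^ N ∣ e * v' := by
      rw [← hw, hn, mul_assoc]
      exact dvd_mul_right _ _
    rw [hc, ← mul_assoc] at h1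
    have h2 : 2 ^ N ∣ e * 2 :=
      Nat.Coprime.dvd_of_dvd_mul_right (Nat.Coprime.pow_left _ (Nat.coprime_two_left.mpr hco)) h1
    rw [show N = (N - 1) + 1 by omega, pow_succ] at h2
    obtain ⟨f, hf⟩ := Nat.dvd_of_mul_dvd_mul_right two_pos h2
    refine ⟨f, hf, ?_⟩
    rw [← Nat.not_even_iff_odd]
    rintro ⟨g, hg⟩
    refine hNe ⟨g, ?_⟩
    rw [hf, hg, show 2 ^ N = 2 ^ (N - 1) * 2 by rw [← pow_succ, Nat.sub_add_cancel hN]]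
    ring
  obtain ⟨f, hf, hfo⟩ := he
  have hON : O < N := by
    by_contra hlt
    exact hNe ((pow_dvd_pow 2 (by omega)).trans hOe)
  obtain ⟨d, hd, hdo⟩ := exists_pow_sub_one_eq hR ht ht1 (show 1 ≤ N - 1 by omega) hfo
  rw [← hf] at hd
  rcases Nat.lt_or_ge M (N + R) with hlt | hge
  · have hS : S = M := by
      have := hc2 hON
      omega
    refine L.dvd_of_geom_trivial hM hj hrel ?_ ?_
    · rw [hs, hS]
      push_cast
      rw [mul_assoc]
      exact dvd_mul_right _ _
    · rw [hd]
      exact (pow_dvd_pow _ (by omega)).mul_right _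
  have hMNR : R + N = M := by omega
  have hSM1 : S = M - 1 := by omega
  have hM1 : 1 ≤ M := by omega
  rw [show R + (N - 1) = M - 1 by omega] at hd
  have hwo : Odd w := by
    have h1 : n' * w = f * c := by
      refine Nat.eq_of_mul_eq_mul_left (show 0 < 2 ^ N by positivity) ?_
      rw [← mul_assoc, ← hn, hw, hf, hc, show 2 ^ N = 2 ^ (N - 1) * 2 by
        rw [← pow_succ, Nat.sub_add_cancel hN]]
      ring
    exact (Nat.odd_mul.mp (h1 ▸ hfo.mul hco)).2
  have hw'e : Even w' := by
    have h1 : n' * w' = 2 * (2 ^ (M - 3) * f * s') := by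
      refine Nat.eq_of_mul_eq_mul_left (show 0 < 2 ^ N by positivity) ?_
      rw [← mul_assoc, ← hn, hw', hf, hs, hSM1, show 2 ^ N = 2 ^ (N - 1) * 2 by
        rw [← pow_succ, Nat.sub_add_cancel hN], show M - 1 = M - 3 + 2 by omega]
      ring
    exact even_iff_two_dvd.mpr
      (Nat.Coprime.dvd_of_dvd_mul_left (Nat.coprime_two_left.mpr hn') ⟨_, h1⟩)
  have hMm : (2 : ℤ) ^ M ∣ m := by exact_mod_cast hM
  have hsZ : (s : ℤ) = 2 ^ (M - 1) * s' := by
    rw [hs, hSM1]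
    push_cast
    ring
  have hle : Even (l : ℤ) := by
    obtain ⟨d₁, hd₁, hd₁o⟩ := hodd_pow (n' * k) (hn'.mul hkodd)
    rw [hMNR] at hd₁
    have h5 := mul_geom_sum ((t : ℤ) ^ k) n
    rw [← pow_mul, show k * n = 2 ^ N * (n' * k) by rw [hn]; ring, hd₁] at h5
    have h6 : ∃ d₂, (t : ℤ) ^ k - 1 = 2 * d₂ ∧ Odd d₂ := by
      obtain ⟨a, ha⟩ := dvd_add_one_of_pow h4t hkodd
      exact ⟨2 * a - 1, by linarith, ⟨a - 1, by ring⟩⟩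
    obtain ⟨d₂, hd₂, hd₂o⟩ := h6
    have h7 : d₂ * ∑ i ∈ range n, ((t : ℤ) ^ k) ^ i = 2 ^ (M - 1) * d₁ := by
      rw [hd₂, show (2 : ℤ) ^ M = 2 * 2 ^ (M - 1) by rw [← pow_succ', Nat.sub_add_cancel hM1],
        mul_assoc, mul_assoc] at h5
      exact mul_left_cancel₀ two_ne_zero h5
    obtain ⟨d₃, hd₃⟩ : (2 : ℤ) ^ (M - 1) ∣ ∑ i ∈ range n, ((t : ℤ) ^ k) ^ i := by
      refine IsCoprime.dvd_of_dvd_mul_left (IsCoprime.pow_left ?_) ⟨d₁, h7⟩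
      obtain ⟨a, ha⟩ := hd₂o
      exact ⟨-a, 1, by rw [ha]; ring⟩
    have hd₃o : Odd d₃ := by
      have h8 : d₂ * d₃ = d₁ := by
        have : (2 : ℤ) ^ (M - 1) * (d₂ * d₃) = 2 ^ (M - 1) * d₁ := by
          rw [← h7, hd₃]
          ring
        exact mul_left_cancel₀ (by positivity) this
      exact (Int.odd_mul.mp (h8 ▸ hd₁o)).2
    have h9 : (2 : ℤ) ^ M ∣ ∑ i ∈ range s, ((t : ℤ) ^ e) ^ i - s := by
      have := pow_succ_dvd_geom_sum_sub Nat.prime_two (x := (t : ℤ) ^ e) (k := M - 1) (v := s)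
        (by
          rw [hd]
          exact (dvd_pow_self _ (by omega)).mul_right _)
        (fun _ => by
          rw [hd, show (4 : ℤ) = 2 ^ 2 by norm_num]
          exact (pow_dvd_pow _ (by omega)).mul_right _)
        (by rw [hs, hSM1]; exact dvd_mul_right _ _)
      rw [Nat.sub_add_cancel hM1] at this
      exact_mod_cast this
    have h10 : (2 : ℤ) ^ M ∣ 2 ^ (M - 1) * (s' * k + l * d₃ - s' * w' - j * s') := by
      have := dvd_add (hMm.trans hrel') (h9.mul_left (j : ℤ))
      refine this.trans (dvd_of_eq ?_)
      rw [hd₃, hsZ]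
      ring
    rw [pow_mul_dvd_pow_mul_iff hM1] at h10
    simp only [Int.even_sub, Int.even_add, Int.even_mul, Int.even_coe_nat] at h10 ⊢
    rw [← Nat.not_even_iff_odd] at hs' hj hkodd
    rw [← Int.not_even_iff_odd] at hd₃o
    tauto
  have hH := odd_sum_geom_sum (x := (t : ℤ) ^ e)
    (by rw [hd]; exact (dvd_pow_self _ (by omega)).mul_right _) hc hco
  have h11 := geom_sum_sub_eq ((t : ℤ) ^ e) v'
  set H := ∑ j ∈ range v', ∑ i ∈ range j, ((t : ℤ) ^ e) ^ i
  have h12 : (2 : ℤ) ^ M ∣ 2 ^ (M - 1) * (s' * w + d * j * H + d * l) := by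
    rw [pow_mul_dvd_pow_mul_iff hM1]
    simp only [Int.even_add, Int.even_mul, Int.even_coe_nat] at hle ⊢
    rw [← Nat.not_even_iff_odd] at hs' hj hwo
    rw [← Int.not_even_iff_odd] at hdo hH
    tauto
  have h13 : (2 : ℤ) ^ M ∣ j * ((t : ℤ) ^ k - t') := by
    have := dvd_sub h12 (hMm.trans hrel)
    refine this.trans (dvd_of_eq ?_)
    rw [eq_add_of_sub_eq h11, hsZ, hd, L.eq_succ, show (t : ℤ) ^ e = 2 ^ (M - 1) * d + 1 by linarith]
    push_cast
    ring
  refine IsCoprime.dvd_of_dvd_mul_left (IsCoprime.pow_left ?_) h13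
  exact Nat.isCoprime_iff_coprime.mpr (Nat.coprime_two_left.mpr hj)

end Metacyclic

namespace Metacyclic

open Finset

section Invariants

variable {m n s t t' : ℕ} {u u' : (ZMod m)ˣ} {p : ℕ}

theorem factorization_eq_of_pow_dvd_iff {a b p : ℕ} (hp : p.Prime) (ha : a ≠ 0) (hb : b ≠ 0)
    (h : ∀ k, p ^ k ∣ a ↔ p ^ k ∣ b) : a.factorization p = b.factorization p :=
  le_antisymm
    ((hp.pow_dvd_iff_le_factorization hb).mp ((h _).mp (Nat.ordProj_dvd a p)))
    ((hp.pow_dvd_iff_le_factorization ha).mp ((h _).mpr (Nat.ordProj_dvd b p)))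

theorem nuSet_eq (hm : 0 < m) (hu : (u : ZMod m) = t) (hu' : (u' : ZMod m) = t')
    (h : ∀ p : ℕ, p.Prime → p ∣ m → ((p : ℤ) ∣ t - 1 ↔ (p : ℤ) ∣ t' - 1)) :
    nuSet (Subgroup.zpowers u) = nuSet (Subgroup.zpowers u') := by
  ext p
  rw [mem_nuSet_iff hm hu, mem_nuSet_iff hm hu']
  refine and_congr_right fun hp => and_congr_right fun hpm => not_congr (h p hp hpm)

theorem primeFactors_rInv_eq (hm : 0 < m) (hu : (u : ZMod m) = t) (hu' : (u' : ZMod m) = t')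
    (h : ∀ p : ℕ, p.Prime → p ∣ m → ((p : ℤ) ∣ t - 1 ↔ (p : ℤ) ∣ t' - 1)) :
    (rInv (Subgroup.zpowers u)).primeFactors = (rInv (Subgroup.zpowers u')).primeFactors := by
  ext p
  rw [mem_primeFactors_rInv_iff hm hu, mem_primeFactors_rInv_iff hm hu']
  refine and_congr_right fun hp => and_congr_right fun hpm => h p hp hpm

theorem epsInv_eq (hm : 0 < m) (hu : (u : ZMod m) = t) (hu' : (u' : ZMod m) = t')
    (h : 4 ∣ m → ((4 : ℤ) ∣ t + 1 ↔ (4 : ℤ) ∣ t' + 1)) :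
    epsInv (Subgroup.zpowers u) = epsInv (Subgroup.zpowers u') := by
  have h1 : epsInv (Subgroup.zpowers u) = -1 ↔ epsInv (Subgroup.zpowers u') = -1 := by
    rw [epsInv_eq_neg_one_iff hm hu, epsInv_eq_neg_one_iff hm hu']
    exact and_congr_right h
  rcases epsInv_eq_one_or (Subgroup.zpowers u) with h2 | h2 <;>
    rcases epsInv_eq_one_or (Subgroup.zpowers u') with h3 | h3 <;> simp_all

theorem not_mem_nuSet (hp : p ∈ (rInv (Subgroup.zpowers u)).primeFactors) :
    p ∉ nuSet (Subgroup.zpowers u) := fun h => (mem_sdiff.mp h).2 hp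

theorem orderOf_dvd_of_dvd_pow_sub {q K : ℕ} (h : (q : ℤ) ∣ (t : ℤ) ^ K - t') :
    orderOf (t' : ZMod q) ∣ orderOf (t : ZMod q) := by
  have : (t' : ZMod q) = (t : ZMod q) ^ K := by
    have h1 := (ZMod.intCast_zmod_eq_zero_iff_dvd _ _).mpr h
    push_cast at h1
    exact (sub_eq_zero.mp h1).symm
  rw [this]
  exact orderOf_pow_dvd K

theorem oInv_factorization_eq (hm : 0 < m) (hu : (u : ZMod m) = t) (hu' : (u' : ZMod m) = t')
    (hν : nuSet (Subgroup.zpowers u) = nuSet (Subgroup.zpowers u')) {K K' : ℕ}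
    (h : (setPart (nuSet (Subgroup.zpowers u)) m : ℤ) ∣ (t : ℤ) ^ K - t')
    (h' : (setPart (nuSet (Subgroup.zpowers u)) m : ℤ) ∣ (t' : ℤ) ^ K' - t)
    (hp : p.Prime) (hpν : p ∉ nuSet (Subgroup.zpowers u)) :
    (oInv (Subgroup.zpowers u)).factorization p = (oInv (Subgroup.zpowers u')).factorization p := by
  refine factorization_eq_of_pow_dvd_iff hp (oInv_ne_zero hm _) (oInv_ne_zero hm _) fun k => ?_
  rw [pow_dvd_oInv_iff hm hu hp hpν, pow_dvd_oInv_iff hm hu' hp (hν ▸ hpν), ← hν,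
    Nat.dvd_antisymm (orderOf_dvd_of_dvd_pow_sub h) (orderOf_dvd_of_dvd_pow_sub h')]

theorem rInv_factorization_le (hm : 0 < m) (T : Subgroup (ZMod m)ˣ) (p : ℕ) :
    (rInv T).factorization p ≤ m.factorization p :=
  (Nat.factorization_le_iff_dvd (rInv_ne_zero hm T) hm.ne').mpr (rInv_dvd T) p

theorem rInv_pow_dvd (T : Subgroup (ZMod m)ˣ) (p : ℕ) : p ^ (rInv T).factorization p ∣ m :=
  (Nat.ordProj_dvd _ _).trans (rInv_dvd T)

theorem pos_dvd (hm : 0 < m) (hu : (u : ZMod m) = t) (hp : p.Prime)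
    (he : epsInv (Subgroup.zpowers u) ^ (p - 1) = 1) :
    (p : ℤ) ^ (rInv (Subgroup.zpowers u)).factorization p ∣ t - 1 :=
  (pow_dvd_rInv_iff_of_eps hm hu hp he (rInv_pow_dvd _ _)).mp (Nat.ordProj_dvd _ _)

theorem pos_not_dvd (hm : 0 < m) (hu : (u : ZMod m) = t) (hp : p.Prime)
    (he : epsInv (Subgroup.zpowers u) ^ (p - 1) = 1)
    (hR : (rInv (Subgroup.zpowers u)).factorization p < m.factorization p) :
    ¬ (p : ℤ) ^ ((rInv (Subgroup.zpowers u)).factorization p + 1) ∣ t - 1 := by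
  rw [← pow_dvd_rInv_iff_of_eps hm hu hp he
    ((hp.pow_dvd_iff_le_factorization hm.ne').mpr hR), hp.pow_dvd_iff_le_factorization
    (rInv_ne_zero hm _)]
  omega

theorem neg_dvd (hm : 0 < m) (hu : (u : ZMod m) = t) (he : epsInv (Subgroup.zpowers u) = -1) :
    (2 : ℤ) ^ (rInv (Subgroup.zpowers u)).factorization 2 ∣ t + 1 :=
  (two_pow_dvd_rInv_iff_of_eps hm hu he (rInv_pow_dvd _ _)).mp (Nat.ordProj_dvd _ _)

theorem neg_not_dvd (hm : 0 < m) (hu : (u : ZMod m) = t) (he : epsInv (Subgroup.zpowers u) = -1)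
    (hR : (rInv (Subgroup.zpowers u)).factorization 2 < m.factorization 2) :
    ¬ (2 : ℤ) ^ ((rInv (Subgroup.zpowers u)).factorization 2 + 1) ∣ t + 1 := by
  rw [← two_pow_dvd_rInv_iff_of_eps hm hu he
    ((Nat.prime_two.pow_dvd_iff_le_factorization hm.ne').mpr hR),
    Nat.prime_two.pow_dvd_iff_le_factorization (rInv_ne_zero hm _)]
  omega

theorem neg_two_le (hm : 0 < m) (hu : (u : ZMod m) = t) (he : epsInv (Subgroup.zpowers u) = -1) :
    2 ≤ (rInv (Subgroup.zpowers u)).factorization 2 := by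
  rw [← Nat.prime_two.pow_dvd_iff_le_factorization (rInv_ne_zero hm _)]
  have h := (epsInv_eq_neg_one_iff hm hu).mp he
  exact (two_pow_dvd_rInv_iff_of_eps hm hu he (by simpa using h.1)).mpr (by simpa using h.2)

theorem dvd_mul_sub_one (hu : (u : ZMod m) = t) (h : Subgroup.zpowers u ≤ unitsSub m n s) :
    (m : ℤ) ∣ s * (t - 1) := by
  have h1 := (h (Subgroup.mem_zpowers u)).1
  rw [hu] at h1
  rw [← ZMod.intCast_zmod_eq_zero_iff_dvd]
  push_cast
  exact h1

theorem dvd_pow_n_sub_one (hu : (u : ZMod m) = t) (h : Subgroup.zpowers u ≤ unitsSub m n s) :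
    (m : ℤ) ∣ (t : ℤ) ^ n - 1 := by
  have h1 := congrArg (Units.val) (h (Subgroup.mem_zpowers u)).2
  rw [Units.val_pow_eq_pow_val, hu, Units.val_one] at h1
  rw [← ZMod.intCast_zmod_eq_zero_iff_dvd]
  push_cast
  rw [h1, sub_self]

theorem neg_s (hm : 0 < m) (hs : 0 < s) (hsm : s ∣ m) (hu : (u : ZMod m) = t)
    (he : epsInv (Subgroup.zpowers u) = -1) (h : Subgroup.zpowers u ≤ unitsSub m n s) :
    s.factorization 2 ≤ m.factorization 2 ∧ m.factorization 2 ≤ s.factorization 2 + 1 := by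
  refine ⟨(Nat.factorization_le_iff_dvd hs.ne' hm.ne').mpr hsm 2, ?_⟩
  obtain ⟨h4, h4t⟩ := (epsInv_eq_neg_one_iff hm hu).mp he
  have h1 : (2 : ℤ) ^ m.factorization 2 ∣ s * (t - 1) :=
    Dvd.dvd.trans (by exact_mod_cast Nat.ordProj_dvd m 2) (dvd_mul_sub_one hu h)
  obtain ⟨c, hc⟩ := h4t
  have h2 : (2 : ℤ) ^ m.factorization 2 ∣ s * 2 := by
    have hco : IsCoprime ((2 : ℤ) ^ m.factorization 2) (2 * c - 1) :=
      IsCoprime.pow_left ⟨c, -1, by ring⟩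
    refine hco.dvd_of_dvd_mul_right ?_
    rwa [mul_assoc, show 2 * (2 * c - 1) = (t : ℤ) - 1 by linarith]
  have h3 : 2 ^ m.factorization 2 ∣ s * 2 := by exact_mod_cast h2
  rw [Nat.prime_two.pow_dvd_iff_le_factorization (by positivity),
    Nat.factorization_mul hs.ne' two_ne_zero] at h3
  simpa [Nat.prime_two.factorization_self] using h3

theorem neg_even_n (hm : 0 < m) (hu : (u : ZMod m) = t)
    (he : epsInv (Subgroup.zpowers u) = -1) (h : Subgroup.zpowers u ≤ unitsSub m n s) :
    2 ∣ n := by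
  obtain ⟨h4, h4t⟩ := (epsInv_eq_neg_one_iff hm hu).mp he
  refine (even_of_dvd_pow_sub_one (t := t) le_rfl (by simpa using h4t) ?_).two_dvd
  refine Dvd.dvd.trans ?_ (dvd_pow_n_sub_one hu h)
  norm_num
  exact_mod_cast h4

theorem neg_factorization (hm : 0 < m) (hu : (u : ZMod m) = t)
    (he : epsInv (Subgroup.zpowers u) = -1) : 2 ≤ m.factorization 2 :=
  (neg_two_le hm hu he).trans (rInv_factorization_le hm _ 2)

end Invariants

section LinkedInvariants

variable {m n s t t' v' e j k l : ℕ} {u u' : (ZMod m)ˣ}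

theorem Linked.nu (L : Linked m n s t t' v' e j k l) (hm : 0 < m) (hu : (u : ZMod m) = t) :
    (setPart (nuSet (Subgroup.zpowers u)) m : ℤ) ∣ (t : ℤ) ^ k - t' ∧
      (setPart (nuSet (Subgroup.zpowers u)) m : ℤ) ∣ (t : ℤ) ^ e - 1 := by
  refine L.dvd_pow _ (Nat.Coprime.mul_dvd_of_dvd_of_dvd ?_ (setPart_dvd _ _) (Nat.gcd_dvd_left _ _))
  refine Nat.Coprime.symm (Nat.coprime_of_dvd fun q hq h1 h2 => ?_)
  have h3 : q ∈ nuSet (Subgroup.zpowers u) := by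
    by_contra h3
    exact (Nat.Prime.coprime_iff_not_dvd hq).mp (setPart_coprime m hq (by simpa using h3)).symm h2
  rw [mem_nuSet_iff hm hu] at h3
  refine h3.2.2 ((L.dvd_iff q h3.2.1).mpr ?_)
  rw [L.eq_succ]
  push_cast
  rw [add_sub_cancel_right]
  exact_mod_cast h1.trans (Nat.gcd_dvd_right _ _)

theorem Linked.two (L : Linked m n s t t' v' e j k l) (hm : 0 < m) (hu : (u : ZMod m) = t)
    (he : epsInv (Subgroup.zpowers u) = -1) :
    (2 : ℤ) ^ (m.factorization 2 - 1) ∣ (t : ℤ) ^ k - t' ∧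
      (2 : ℤ) ^ (m.factorization 2 - 1) ∣ (t : ℤ) ^ e - 1 := by
  obtain ⟨h4, h4t⟩ := (epsInv_eq_neg_one_iff hm hu).mp he
  have h2 : ((2 : ℕ) : ℤ) ∣ t' - 1 :=
    (L.dvd_iff 2 ((by norm_num : 2 ∣ 4).trans h4)).mp (by push_cast; omega)
  have h4' : ¬ ((4 : ℕ) : ℤ) ∣ t' - 1 := by
    rw [← L.dvd_iff 4 h4]
    push_cast
    omega
  rw [L.eq_succ] at h2 h4'
  push_cast at h2 h4'
  rw [add_sub_cancel_right] at h2 h4'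
  have h2n : 2 ∣ v' := by exact_mod_cast h2
  have h4n : ¬ 4 ∣ v' := by exact_mod_cast h4'
  have hg0 : m.gcd v' ≠ 0 := (Nat.gcd_pos_of_pos_left _ hm).ne'
  have hM := neg_factorization hm hu he
  have key : 2 ^ (m.factorization 2 - 1) * m.gcd v' ∣ m := by
    obtain ⟨c, hc⟩ : 2 ∣ m.gcd v' := Nat.dvd_gcd ((by norm_num : 2 ∣ 4).trans h4) h2n
    have hco : Nat.Coprime 2 c := by
      rw [Nat.Prime.coprime_iff_not_dvd Nat.prime_two]
      rintro ⟨d, hd⟩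
      refine h4n (Dvd.dvd.trans ?_ (Nat.gcd_dvd_right m v'))
      rw [hc, hd]
      exact ⟨d, by ring⟩
    rw [hc, ← mul_assoc, ← pow_succ, Nat.sub_add_cancel (by omega)]
    refine Nat.Coprime.mul_dvd_of_dvd_of_dvd (Nat.Coprime.pow_left _ hco) (Nat.ordProj_dvd m 2) ?_
    exact Dvd.dvd.trans ⟨2, by rw [hc, mul_comm]⟩ (Nat.gcd_dvd_left m v')
  have := L.dvd_pow _ key
  push_cast at this
  exact this

theorem Linked.pow_o_dvd (L : Linked m n s t t' v' e j k l) (hm : 0 < m) (hu : (u : ZMod m) = t)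
    {p : ℕ} (hp : p.Prime) (hpν : p ∉ nuSet (Subgroup.zpowers u)) :
    p ^ (oInv (Subgroup.zpowers u)).factorization p ∣ e := by
  refine ((pow_dvd_oInv_iff hm hu hp hpν _).mp (Nat.ordProj_dvd _ _)).trans ?_
  rw [orderOf_dvd_iff_pow_eq_one]
  have := (L.nu hm hu).2
  rw [← ZMod.intCast_zmod_eq_zero_iff_dvd] at this
  push_cast at this
  exact sub_eq_zero.mp this

theorem Linked.eps (L : Linked m n s t t' v' e j k l) (hm : 0 < m) (hu : (u : ZMod m) = t)
    (hu' : (u' : ZMod m) = t') :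
    epsInv (Subgroup.zpowers u) = epsInv (Subgroup.zpowers u') := by
  refine epsInv_eq hm hu hu' fun h4 => ?_
  have h2 : 2 ∣ m := (by norm_num : 2 ∣ 4).trans h4
  have e1 := dvd_sub_one_of_two_dvd hu h2
  have e2 := dvd_sub_one_of_two_dvd hu' h2
  have e3 := L.dvd_iff 4 h4
  push_cast at e3
  omega

theorem Linked.r_pos (L : Linked m n s t t' v' e j k l) (hm : 0 < m) (hu : (u : ZMod m) = t)
    (hu' : (u' : ZMod m) = t') {p : ℕ} (hp : p.Prime)
    (he : epsInv (Subgroup.zpowers u) ^ (p - 1) = 1) :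
    (rInv (Subgroup.zpowers u)).factorization p = (rInv (Subgroup.zpowers u')).factorization p := by
  refine factorization_eq_of_pow_dvd_iff hp (rInv_ne_zero hm _) (rInv_ne_zero hm _) fun i => ?_
  by_cases hi : p ^ i ∣ m
  · rw [pow_dvd_rInv_iff_of_eps hm hu hp he hi,
      pow_dvd_rInv_iff_of_eps hm hu' hp (L.eps hm hu hu' ▸ he) hi]
    have := L.dvd_iff (p ^ i) hi
    push_cast at this
    exact this
  · exact iff_of_false (fun h => hi (h.trans (rInv_dvd _))) fun h => hi (h.trans (rInv_dvd _))

theorem Linked.r_neg_le (L : Linked m n s t t' v' e j k l) (hm : 0 < m)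
    (hu : (u : ZMod m) = t) (hu' : (u' : ZMod m) = t')
    (he : epsInv (Subgroup.zpowers u) = -1) {X : ℕ} (hX : X ≤ m.factorization 2 - 1)
    (h : X ≤ (rInv (Subgroup.zpowers u)).factorization 2) :
    X ≤ (rInv (Subgroup.zpowers u')).factorization 2 := by
  have he' := (L.eps hm hu hu').symm.trans he
  rcases le_or_gt X 2 with h2 | h2
  · exact h2.trans (neg_two_le hm hu' he')
  have hXm : 2 ^ X ∣ m := (Nat.prime_two.pow_dvd_iff_le_factorization hm.ne').mpr (by omega)
  rw [← Nat.prime_two.pow_dvd_iff_le_factorization (rInv_ne_zero hm _),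
    two_pow_dvd_rInv_iff_of_eps hm hu' he' hXm]
  have e1 : (2 : ℤ) ^ X ∣ t + 1 := (pow_dvd_pow _ h).trans (neg_dvd hm hu he)
  have e2 : (2 : ℤ) ^ X ∣ (t : ℤ) ^ k - t' := (pow_dvd_pow _ hX).trans (L.two hm hu he).1
  have e3 : (2 : ℤ) ^ 2 ∣ t' + 1 := by
    simpa using ((epsInv_eq_neg_one_iff hm hu').mp he').2
  have hk : Odd k := odd_of_dvd_pow_sub le_rfl ((pow_dvd_pow _ h2.le).trans e1) e3
    ((pow_dvd_pow _ h2.le).trans e2)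
  have := dvd_sub (dvd_add_one_of_pow e1 hk) e2
  rwa [show (t : ℤ) ^ k + 1 - (t ^ k - t') = t' + 1 by ring] at this

theorem Linked.r_not_jump (L : Linked m n s t t' v' e j k l) (hm : 0 < m) (hn : 0 < n)
    (hs : 0 < s) (hsm : s ∣ m) (hu : (u : ZMod m) = t) (hu' : (u' : ZMod m) = t')
    (hT : IsCanonical n s (Subgroup.zpowers u))
    (he : epsInv (Subgroup.zpowers u) = -1)
    (hR : (rInv (Subgroup.zpowers u)).factorization 2 = m.factorization 2)
    (hR' : (rInv (Subgroup.zpowers u')).factorization 2 + 1 = m.factorization 2) : False := by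
  have he' := (L.eps hm hu hu').symm.trans he
  have h2 := neg_two_le hm hu' he'
  obtain ⟨hS1, hS2⟩ := neg_s hm hs hsm hu he hT.le_unitsSub
  have h2m : 2 ∣ m := (by norm_num : 2 ∣ 4).trans ((epsInv_eq_neg_one_iff hm hu).mp he).1
  have hν : 2 ∉ nuSet (Subgroup.zpowers u) := by
    rw [mem_nuSet_iff hm hu]
    exact fun h => h.2.2 (dvd_sub_one_of_two_dvd hu h2m)
  refine L.not_jump (M := m.factorization 2) (by omega) (Nat.ordProj_dvd m 2) ?_ ?_ ?_
    (L.two hm hu he).1 (L.two hm hu he).2 ?_ (neg_even_n hm hu he hT.le_unitsSub)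
    (L.pow_o_dvd hm hu Nat.prime_two hν) ?_
  · exact hR ▸ neg_dvd hm hu he
  · have := neg_dvd hm hu' he'
    rwa [show (rInv (Subgroup.zpowers u')).factorization 2 = m.factorization 2 - 1 by omega] at this
  · have := neg_not_dvd hm hu' he' (by omega)
    rwa [hR'] at this
  · rw [Nat.prime_two.pow_dvd_iff_le_factorization hs.ne']
    omega
  · intro h4 hO
    have hcan := hT.neg_le he
    unfold pPart at hcan
    rw [show (8 : ℕ) = 2 ^ 3 by norm_num, show (4 : ℕ) = 2 ^ 2 by norm_num,
      Nat.pow_le_pow_iff_right (by norm_num), Nat.pow_le_pow_iff_right (by norm_num),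
      Nat.pow_le_pow_iff_right (by norm_num), Nat.pow_lt_pow_iff_right (by norm_num)] at hcan
    rw [Nat.prime_two.pow_dvd_iff_le_factorization hs.ne', ← hR]
    refine hcan (by omega) ?_ ?_
    · rw [← Nat.prime_two.pow_dvd_iff_le_factorization hn.ne']
      simpa using h4
    · exact (Nat.prime_two.pow_dvd_iff_le_factorization hn.ne').mp hO

end LinkedInvariants

end Metacyclic

namespace Metacyclic

open Finset

variable {m n s t t' v' e j k l : ℕ} {u u' : (ZMod m)ˣ}

theorem orderOf_dvd_n (hu : (u : ZMod m) = t) (h : Subgroup.zpowers u ≤ unitsSub m n s) {q : ℕ}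
    (hq : q ∣ m) : orderOf (t : ZMod q) ∣ n := by
  rw [orderOf_dvd_iff_pow_eq_one]
  have := (Int.natCast_dvd_natCast.mpr hq).trans (dvd_pow_n_sub_one hu h)
  rw [← ZMod.intCast_zmod_eq_zero_iff_dvd] at this
  push_cast at this
  exact sub_eq_zero.mp this

theorem pow_o_dvd_n (hm : 0 < m) (hu : (u : ZMod m) = t)
    (h : Subgroup.zpowers u ≤ unitsSub m n s) {p : ℕ} (hp : p.Prime)
    (hpν : p ∉ nuSet (Subgroup.zpowers u)) :
    p ^ (oInv (Subgroup.zpowers u)).factorization p ∣ n :=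
  ((pow_dvd_oInv_iff hm hu hp hpν _).mp (Nat.ordProj_dvd _ _)).trans
    (orderOf_dvd_n hu h (setPart_dvd _ _))

theorem exists_eq_pow_mul {n : ℕ} (hn : n ≠ 0) {p : ℕ} (hp : p.Prime) :
    ∃ n', n = p ^ n.factorization p * n' ∧ ¬ p ∣ n' :=
  ⟨_, (Nat.ordProj_mul_ordCompl_eq_self n p).symm, Nat.not_dvd_ordCompl hp hn⟩

theorem Linked.localPart_dvd_pos (L : Linked m n s t t' v' e j k l) (hm : 0 < m) (hn : 0 < n)
    (hu : (u : ZMod m) = t) (hu' : (u' : ZMod m) = t')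
    (hT : IsCanonical n s (Subgroup.zpowers u)) {p : ℕ}
    (hpr : p ∈ (rInv (Subgroup.zpowers u)).primeFactors)
    (he : epsInv (Subgroup.zpowers u) ^ (p - 1) = 1) :
    (localPart (Subgroup.zpowers u) n s p : ℤ) ∣ (t : ℤ) ^ k - t' := by
  have hp := Nat.prime_of_mem_primeFactors hpr
  have hpν := not_mem_nuSet hpr
  obtain ⟨-, hpm, hpt⟩ := (mem_primeFactors_rInv_iff hm hu).mp hpr
  obtain ⟨n', hn', hnp⟩ := exists_eq_pow_mul hn.ne' hp
  have hR1 : 1 ≤ (rInv (Subgroup.zpowers u)).factorization p :=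
    (hp.dvd_iff_one_le_factorization (rInv_ne_zero hm _)).mp (Nat.dvd_of_mem_primeFactors hpr)
  rw [localPart_of_pos hp he, Nat.cast_pow]
  refine L.dvd_of_pos hp hR1 (Nat.ordProj_dvd m p) hn' hnp (Nat.ordProj_dvd s p)
    (pos_dvd hm hu hp he) ?_ (L.pow_o_dvd hm hu hp hpν) ?_
  · rw [L.r_pos hm hu hu' hp he]
    exact pos_dvd hm hu' hp (L.eps hm hu hu' ▸ he)
  · intro hO hRM
    have hpO : p ∣ p ^ (oInv (Subgroup.zpowers u)).factorization p :=
      dvd_pow_self p (by omega)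
    refine L.gen' p hp (hpO.trans (pow_o_dvd_n hm hu hT.le_unitsSub hp hpν)) hpm ?_ hpt
      (hpO.trans (L.pow_o_dvd hm hu hp hpν))
    by_contra hps
    have h1 : (p : ℤ) ^ m.factorization p ∣ s * (t - 1) :=
      Dvd.dvd.trans (by exact_mod_cast Nat.ordProj_dvd m p) (dvd_mul_sub_one hu hT.le_unitsSub)
    have h2 : (p : ℤ) ^ m.factorization p ∣ t - 1 := by
      refine IsCoprime.dvd_of_dvd_mul_left (IsCoprime.pow_left ?_) h1
      exact Nat.isCoprime_iff_coprime.mpr ((Nat.Prime.coprime_iff_not_dvd hp).mpr hps)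
    exact pos_not_dvd hm hu hp he hRM ((pow_dvd_pow _ hRM).trans h2)

theorem Linked.localPart_dvd_neg (L : Linked m n s t t' v' e j k l) (hm : 0 < m) (hn : 0 < n)
    (hs : 0 < s) (hsm : s ∣ m) (hu : (u : ZMod m) = t) (hu' : (u' : ZMod m) = t')
    (hT : IsCanonical n s (Subgroup.zpowers u)) (he : epsInv (Subgroup.zpowers u) = -1)
    (hR : (rInv (Subgroup.zpowers u)).factorization 2 =
      (rInv (Subgroup.zpowers u')).factorization 2) :
    (localPart (Subgroup.zpowers u) n s 2 : ℤ) ∣ (t : ℤ) ^ k - t' ∨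
      localPart (Subgroup.zpowers u) n s 2 = 4 ∧
        (oInv (Subgroup.zpowers u)).factorization 2 = 0 ∧ Even k := by
  have he' := (L.eps hm hu hu').symm.trans he
  have h2R := neg_two_le hm hu he
  have hRM := rInv_factorization_le hm (Subgroup.zpowers u) 2
  obtain ⟨hS1, hS2⟩ := neg_s hm hs hsm hu he hT.le_unitsSub
  have h4 := (epsInv_eq_neg_one_iff hm hu).mp he
  have h4' := (epsInv_eq_neg_one_iff hm hu').mp he'
  have h2m : 2 ∣ m := (by norm_num : 2 ∣ 4).trans h4.1
  have hν : 2 ∉ nuSet (Subgroup.zpowers u) := by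
    rw [mem_nuSet_iff hm hu]
    exact fun h => h.2.2 (dvd_sub_one_of_two_dvd hu h2m)
  have hO := L.pow_o_dvd hm hu Nat.prime_two hν
  have hn2 := neg_even_n hm hu he hT.le_unitsSub
  have htwo := (L.two hm hu he).1
  have ht := neg_dvd hm hu he
  rw [localPart_two_of_neg he]
  split_ifs with h1 h2
  · rw [Nat.cast_pow]
    rcases Nat.lt_or_ge ((rInv (Subgroup.zpowers u)).factorization 2) (m.factorization 2)
      with hlt | hge
    · left
      exact (pow_dvd_pow _ (by omega)).trans htwo
    by_cases hk : Odd k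
    · left
      have := dvd_sub (dvd_add_one_of_pow ht hk) (hR ▸ neg_dvd hm hu' he')
      rwa [show (t : ℤ) ^ k + 1 - (t' + 1) = t ^ k - t' by ring] at this
    · right
      have hM : m.factorization 2 = 2 := by
        by_contra hM
        refine hk (odd_of_dvd_pow_sub (t := t) (t' := t') le_rfl (by simpa using h4.2)
          (by simpa using h4'.2) ((pow_dvd_pow _ ?_).trans htwo))
        omega
      rw [show (rInv (Subgroup.zpowers u)).factorization 2 = 2 by omega]
      refine ⟨by norm_num, ?_, Nat.not_odd_iff_even.mp hk⟩
      by_contra hO0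
      exact L.gen 2 Nat.prime_two hn2 ((dvd_pow_self 2 hO0).trans hO)
        (even_iff_two_dvd.mp (Nat.not_odd_iff_even.mp hk))
  · left
    rw [Nat.cast_pow]
    exact htwo
  · left
    push Not at h1
    rw [Nat.cast_pow]
    obtain ⟨n', hn', hnp⟩ := exists_eq_pow_mul hn.ne' Nat.prime_two
    obtain ⟨s', hs', hsp⟩ := exists_eq_pow_mul hs.ne' Nat.prime_two
    rw [← even_iff_two_dvd, Nat.not_even_iff_odd] at hnp hsp
    have hSNR : s.factorization 2 ≠ n.factorization 2 +
        (rInv (Subgroup.zpowers u)).factorization 2 := by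
      intro h
      refine hT.neg_ne he ?_
      unfold pPart
      rw [h, pow_add, mul_comm]
    refine L.two_pow_dvd (Nat.ordProj_dvd m 2) hn' hnp hs' hsp hS1 hS2 h2R (by omega)
      (by omega) hO ht (neg_not_dvd hm hu he (by omega)) h4'.2 htwo ?_ hSNR ?_
    · refine Dvd.dvd.trans ?_ (dvd_pow_n_sub_one hu hT.le_unitsSub)
      exact_mod_cast Nat.ordProj_dvd m 2
    · exact fun hON hc => h2 ⟨hON, fun _ => hc⟩

theorem pow_dvd_pow_sub_of_mem_nuSet (hm : 0 < m) {T : Subgroup (ZMod m)ˣ} {X : ℤ}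
    (h : (setPart (nuSet T) m : ℤ) ∣ X) {p : ℕ} (hp : p ∈ nuSet T) :
    (p : ℤ) ^ m.factorization p ∣ X := by
  have h1 := Nat.mem_primeFactors.mp (mem_sdiff.mp hp).1
  refine Dvd.dvd.trans ?_ h
  have := Int.natCast_dvd_natCast.mpr (pPart_dvd_setPart hm h1.1 h1.2.1 (mem_coe.mpr hp))
  simpa [pPart] using this

theorem Linked.exists_pow (L : Linked m n s t t' v' e j k l) (hm : 0 < m) (hn : 0 < n)
    (hs : 0 < s) (hsm : s ∣ m) (hu : (u : ZMod m) = t) (hu' : (u' : ZMod m) = t')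
    (hT : IsCanonical n s (Subgroup.zpowers u))
    (hR : epsInv (Subgroup.zpowers u) = -1 → (rInv (Subgroup.zpowers u)).factorization 2 =
      (rInv (Subgroup.zpowers u')).factorization 2) :
    ∃ K : ℕ, (bracket (Subgroup.zpowers u) n s : ℤ) ∣ (t : ℤ) ^ K - t' := by
  by_cases hex : epsInv (Subgroup.zpowers u) = -1 ∧ localPart (Subgroup.zpowers u) n s 2 = 4 ∧
        (oInv (Subgroup.zpowers u)).factorization 2 = 0 ∧ Even k
  · obtain ⟨he, hl4, hO, hk⟩ := hex
    have he' := (L.eps hm hu hu').symm.trans he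
    have h4 := (epsInv_eq_neg_one_iff hm hu).mp he
    have h4' := (epsInv_eq_neg_one_iff hm hu').mp he'
    have hν : 2 ∉ nuSet (Subgroup.zpowers u) := by
      rw [mem_nuSet_iff hm hu]
      exact fun h => h.2.2 (dvd_sub_one_of_two_dvd hu ((by norm_num : 2 ∣ 4).trans h4.1))
    set D := orderOf (t : ZMod (setPart (nuSet (Subgroup.zpowers u)) m)) *
      (m / 2 ^ m.factorization 2) with hD
    have hDo : Odd D := by
      rw [hD, Nat.odd_mul, ← Nat.not_even_iff_odd, ← Nat.not_even_iff_odd, even_iff_two_dvd,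
        even_iff_two_dvd]
      refine ⟨fun h => ?_, Nat.not_dvd_ordCompl Nat.prime_two hm.ne'⟩
      have h1 := (pow_dvd_oInv_iff hm hu Nat.prime_two hν 1).mpr (by simpa using h)
      rw [Nat.prime_two.pow_dvd_iff_le_factorization (oInv_ne_zero hm _)] at h1
      omega
    have hadd : ∀ q : ℤ, q ∣ (t : ℤ) ^ k - t' → q ∣ (t : ℤ) ^ D - 1 →
        q ∣ (t : ℤ) ^ (k + D) - t' := by
      intro q h1 h2
      refine (dvd_add h1 (h2.mul_left ((t : ℤ) ^ k))).trans (dvd_of_eq ?_)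
      ring
    refine ⟨k + D, bracket_dvd_of hm (fun p hp => ?_) (fun p hp => ?_)⟩
    · refine pow_dvd_pow_sub_of_mem_nuSet hm (hadd _ (L.nu hm hu).1 ?_) hp
      rw [← ZMod.intCast_zmod_eq_zero_iff_dvd]
      push_cast
      rw [hD, pow_mul, pow_orderOf_eq_one, one_pow, sub_self]
    · have hpp := Nat.prime_of_mem_primeFactors hp
      rcases eq_or_ne p 2 with rfl | hp2
      · rw [hl4]
        have h1 := dvd_sub (dvd_add_one_of_pow h4.2 (hk.add_odd hDo)) h4'.2
        push_cast
        rwa [show (t : ℤ) ^ (k + D) + 1 - (t' + 1) = t ^ (k + D) - t' by ring] at h1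
      · have hep := (eps_pow_eq_one_or (Subgroup.zpowers u) hpp).resolve_right fun h => hp2 h.1
        refine hadd _ (L.localPart_dvd_pos hm hn hu hu' hT hp hep) ?_
        obtain ⟨-, hpm, hpt⟩ := (mem_primeFactors_rInv_iff hm hu).mp hp
        have h1 : p ^ m.factorization p ∣ D := by
          refine Dvd.dvd.mul_left ?_ _
          refine Nat.Coprime.dvd_of_dvd_mul_left (m := 2 ^ m.factorization 2)
            (Nat.Coprime.pow _ _ ((Nat.coprime_primes hpp Nat.prime_two).mpr hp2)) ?_
          rw [Nat.ordProj_mul_ordCompl_eq_self]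
          exact Nat.ordProj_dvd m p
        have h2 := pow_add_dvd_pow_sub_one (R := 1) le_rfl (by simpa using hpt) h1
        obtain ⟨i, hi, hi'⟩ := exists_localPart_eq_pow (n := n) (s := s) hm (Subgroup.zpowers u) hpp
        rw [hi', Nat.cast_pow]
        exact (pow_dvd_pow _ (by omega)).trans h2
  · refine ⟨k, bracket_dvd_of hm (fun p hp => pow_dvd_pow_sub_of_mem_nuSet hm (L.nu hm hu).1 hp)
      (fun p hp => ?_)⟩
    rcases eps_pow_eq_one_or (Subgroup.zpowers u) (Nat.prime_of_mem_primeFactors hp) with h | ⟨rfl, h⟩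
    · exact L.localPart_dvd_pos hm hn hu hu' hT hp h
    · exact (L.localPart_dvd_neg hm hn hs hsm hu hu' hT h (hR h)).resolve_right
        fun h' => hex ⟨h, h'⟩

theorem bracket_eq_of_pairs {G : Type*} [Group G] {v : ℕ} {a b x y : G}
    (h : IsPair m n s t a b) (h' : IsPair m n s t' x y) (hm : 0 < m)
    (hn : 0 < n) (hs : 0 < s) (hsm : s ∣ m) (ht : t = v + 1) (ht' : t' = v' + 1)
    (hu : (u : ZMod m) = t) (hu' : (u' : ZMod m) = t')
    (hT : IsCanonical n s (Subgroup.zpowers u)) (hT' : IsCanonical n s (Subgroup.zpowers u')) :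
    bracket (Subgroup.zpowers u) n s = bracket (Subgroup.zpowers u') n s ∧
      (∃ K : ℕ, (bracket (Subgroup.zpowers u) n s : ℤ) ∣ (t : ℤ) ^ K - t') ∧
      ∃ K : ℕ, (bracket (Subgroup.zpowers u') n s : ℤ) ∣ (t' : ℤ) ^ K - t := by
  obtain ⟨e, j, k, l, L⟩ := h.exists_linked h' hm hn ht ht'
  obtain ⟨e', j', k', l', L'⟩ := h'.exists_linked h hm hn ht' ht
  have hprime : ∀ p : ℕ, p.Prime → p ∣ m → ((p : ℤ) ∣ t - 1 ↔ (p : ℤ) ∣ t' - 1) :=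
    fun p _ => L.dvd_iff p
  have hν := nuSet_eq hm hu hu' hprime
  have hpr := primeFactors_rInv_eq hm hu hu' hprime
  have heps := L.eps hm hu hu'
  have hR : epsInv (Subgroup.zpowers u) = -1 → (rInv (Subgroup.zpowers u)).factorization 2 =
      (rInv (Subgroup.zpowers u')).factorization 2 := by
    intro he
    have he' := heps.symm.trans he
    have h1 := L.r_neg_le hm hu hu' he
      (X := min ((rInv (Subgroup.zpowers u)).factorization 2) (m.factorization 2 - 1))
      (min_le_right _ _) (min_le_left _ _)
    have h2 := L'.r_neg_le hm hu' hu he'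
      (X := min ((rInv (Subgroup.zpowers u')).factorization 2) (m.factorization 2 - 1))
      (min_le_right _ _) (min_le_left _ _)
    have h3 := rInv_factorization_le hm (Subgroup.zpowers u) 2
    have h4 := rInv_factorization_le hm (Subgroup.zpowers u') 2
    have h5 := neg_factorization hm hu he
    by_contra hne
    rcases Nat.lt_or_gt_of_ne hne with h6 | h6
    · exact L'.r_not_jump hm hn hs hsm hu' hu hT' he' (by omega) (by omega)
    · exact L.r_not_jump hm hn hs hsm hu hu' hT he (by omega) (by omega)
  refine ⟨bracket_congr hν hpr heps fun p hp => ?_, L.exists_pow hm hn hs hsm hu hu' hT hR,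
    L'.exists_pow hm hn hs hsm hu' hu hT' fun he => (hR (heps.trans he)).symm⟩
  have hpp := Nat.prime_of_mem_primeFactors hp
  refine ⟨?_, oInv_factorization_eq (K' := k') hm hu hu' hν (L.nu hm hu).1 ?_ hpp (not_mem_nuSet hp)⟩
  · rcases eps_pow_eq_one_or (Subgroup.zpowers u) hpp with he | ⟨rfl, he⟩
    · exact L.r_pos hm hu hu' hpp he
    · exact hR he
  · rw [hν]
    exact (L'.nu hm hu').1

end Metacyclic

namespace Metacyclic

open Finset

theorem exists_coprime_lift {d K N : ℕ} (hd : d ≠ 0) (hN : N ≠ 0) (h : Nat.Coprime K d) :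
    ∃ K', K' ≡ K [MOD d] ∧ Nat.Coprime K' N := by
  have : NeZero (d * N) := ⟨Nat.mul_ne_zero hd hN⟩
  obtain ⟨w, hw⟩ := ZMod.unitsMap_surjective (Dvd.intro N rfl : d ∣ d * N) (ZMod.unitOfCoprime K h)
  refine ⟨(w : ZMod (d * N)).val, ?_, ?_⟩
  · have h1 := congrArg Units.val hw
    rw [ZMod.unitsMap_val, ZMod.coe_unitOfCoprime] at h1
    rw [← ZMod.natCast_eq_natCast_iff, ← h1, ZMod.natCast_val]
  · exact Nat.Coprime.coprime_mul_left_right (ZMod.val_coe_unit_coprime w)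

theorem exists_coprime_pow_eq {G : Type*} [Group G] {g h : G} (hg : IsOfFinOrder g)
    (hgh : Subgroup.zpowers g = Subgroup.zpowers h) {N : ℕ} (hN : N ≠ 0) :
    ∃ K : ℕ, Nat.Coprime K N ∧ g ^ K = h := by
  have h1 : h ∈ Subgroup.zpowers g := hgh ▸ Subgroup.mem_zpowers h
  obtain ⟨K, hK⟩ := (hg.mem_powers_iff_mem_zpowers).mpr h1
  have hK' : g ^ K = h := hK
  have ho : orderOf h = orderOf g := by rw [← Nat.card_zpowers, ← Nat.card_zpowers, hgh]
  have hpos := hg.orderOf_pos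
  have hco : Nat.Coprime K (orderOf g) := by
    have h2 := IsOfFinOrder.orderOf_pow g K hg
    rw [hK', ho] at h2
    have h3 := Nat.div_mul_cancel (Nat.gcd_dvd_left (orderOf g) K)
    rw [← h2] at h3
    exact Nat.Coprime.symm (Nat.eq_of_mul_eq_mul_left hpos (by rw [h3, mul_one]))
  obtain ⟨K', h4, h5⟩ := exists_coprime_lift hpos.ne' hN hco
  exact ⟨K', h5, by rw [← hK', pow_eq_pow_iff_modEq]; exact h4⟩

theorem mem_of_pow_mem {G : Type*} [Group G] {g : G} {N K : ℕ} (hN : g ^ N = 1)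
    (hK : Nat.Coprime K N) {H : Subgroup G} (h : g ^ K ∈ H) : g ∈ H := by
  have h1 : Nat.Coprime K (orderOf g) := hK.coprime_dvd_right (orderOf_dvd_of_pow_eq_one hN)
  obtain ⟨c, hc⟩ := exists_pow_eq_self_of_coprime h1
  rw [← hc]
  exact H.pow_mem h c

theorem gcd_eq_of_dvd {m s c : ℕ} (hm : 0 < m) (hs : s ∣ m) {c₁ Y : ℤ}
    (hc : (c : ℤ) = s * c₁ + Y) (hc₁ : ∀ p : ℕ, p.Prime → p ∣ m → ¬ (p : ℤ) ∣ c₁)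
    (hY : ∀ p : ℕ, p.Prime → p ∣ m →
      (p : ℤ) ^ min (s.factorization p + 1) (m.factorization p) ∣ Y) : m.gcd c = s := by
  have hs0 : s ≠ 0 := ne_zero_of_dvd_ne_zero hm.ne' hs
  have hsY : (s : ℤ) ∣ Y := by
    refine dvd_of_forall_prime hs0 fun p hp hps => (pow_dvd_pow _ ?_).trans (hY p hp (hps.trans hs))
    exact le_min (Nat.le_succ _) ((Nat.factorization_le_iff_dvd hs0 hm.ne').mpr hs p)
  have hsc : s ∣ c := by
    have : (s : ℤ) ∣ c := hc ▸ dvd_add (dvd_mul_right _ _) hsY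
    exact_mod_cast this
  obtain ⟨f, hf⟩ := Nat.dvd_gcd hs hsc
  suffices f = 1 by rw [hf, this, mul_one]
  by_contra hf1
  obtain ⟨q, hq, hqf⟩ := Nat.exists_prime_and_dvd hf1
  have hqg : s * q ∣ m.gcd c := hf ▸ mul_dvd_mul_left s hqf
  have hqm : s * q ∣ m := hqg.trans (Nat.gcd_dvd_left _ _)
  have hqp : q ^ (s.factorization q + 1) ∣ s * q := by
    rw [pow_succ]
    exact mul_dvd_mul (Nat.ordProj_dvd s q) dvd_rfl
  have h1 := (hq.pow_dvd_iff_le_factorization hm.ne').mp (hqp.trans hqm)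
  have hqm' := (dvd_mul_left q s).trans hqm
  have h2 := hY q hq hqm'
  rw [min_eq_left h1] at h2
  have h3 : (q : ℤ) ^ (s.factorization q + 1) ∣ c := by
    exact_mod_cast hqp.trans (hqg.trans (Nat.gcd_dvd_right _ _))
  have h4 : (q : ℤ) ^ (s.factorization q + 1) ∣ s * c₁ := by
    have := dvd_sub h3 h2
    rwa [hc, add_sub_cancel_right] at this
  obtain ⟨s', hs', hqs'⟩ := exists_eq_pow_mul hs0 hq
  apply hc₁ q hq hqm'
  have h5 : (q : ℤ) ∣ s' * c₁ := by
    have : (q : ℤ) ^ s.factorization q * q ∣ (q : ℤ) ^ s.factorization q * (s' * c₁) := by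
      rw [← pow_succ, ← mul_assoc]
      have e : (s : ℤ) = (q : ℤ) ^ s.factorization q * s' := by exact_mod_cast hs'
      rwa [← e]
    exact (mul_dvd_mul_iff_left (pow_ne_zero _ (by exact_mod_cast hq.ne_zero))).mp this
  exact ((Nat.prime_iff_prime_int.mp hq).dvd_or_dvd h5).resolve_left
    fun h => hqs' (by exact_mod_cast h)

section Pairs

variable {G : Type*} [Group G] {m n s t v' : ℕ} {a b : G}

theorem IsPair.isOfFinOrder (h : IsPair m n s t a b) (hm : 0 < m) : IsOfFinOrder a :=
  isOfFinOrder_iff_pow_eq_one.mpr ⟨m, hm, h.pow_eq_one⟩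

theorem IsPair.zpowers_eq (h : IsPair m n s t a b) (hm : 0 < m) {c s' : ℕ} (hc : m.gcd c = s') :
    Subgroup.zpowers (a ^ c) = Subgroup.zpowers (a ^ s') := by
  have hfa := h.isOfFinOrder hm
  have hle : Subgroup.zpowers (a ^ c) ≤ Subgroup.zpowers (a ^ s') := by
    obtain ⟨d, hd⟩ : s' ∣ c := hc ▸ Nat.gcd_dvd_right m c
    rw [Subgroup.zpowers_le, hd, pow_mul]
    exact Subgroup.pow_mem _ (Subgroup.mem_zpowers _) _
  have hs' : m.gcd s' = s' := Nat.gcd_eq_right (hc ▸ Nat.gcd_dvd_left m c)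
  have : Finite (Subgroup.zpowers (a ^ s')) := (hfa.pow).finite_zpowers
  refine Subgroup.eq_of_le_of_card_ge hle ?_
  rw [Nat.card_zpowers, Nat.card_zpowers, hfa.orderOf_pow, hfa.orderOf_pow, h.orderOf_eq, hc, hs']

theorem IsPair.card_eq (h : IsPair m n s t a b) (hm : 0 < m) (hn : 0 < n) :
    Nat.card G = n * m := by
  have hbij : Function.Bijective fun x : Fin n × Fin m => b ^ (x.1 : ℕ) * a ^ (x.2 : ℕ) := by
    constructor
    · have key : ∀ i j i' j' : ℕ, i ≤ i' → i' < n → b ^ i * a ^ j = b ^ i' * a ^ j' → i = i' := by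
        intro i j i' j' hii hi' hij
        obtain ⟨d, rfl⟩ := Nat.exists_eq_add_of_le hii
        rw [pow_add, mul_assoc] at hij
        have h1 := h.dvd_of_pow_mul_pow_eq (mul_left_cancel hij).symm
        have := Nat.eq_zero_of_dvd_of_lt h1 (by omega)
        omega
      rintro ⟨⟨i, hi⟩, ⟨j, hj⟩⟩ ⟨⟨i', hi'⟩, ⟨j', hj'⟩⟩ hij
      dsimp only at hij
      have hii : i = i' := by
        rcases le_total i i' with h1 | h1
        · exact key i j i' j' h1 hi' hij
        · exact (key i' j' i j h1 hi hij.symm).symm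
      subst hii
      have := h.modEq_of_eq (mul_left_cancel hij)
      have hjj : j = j' := Nat.ModEq.eq_of_lt_of_lt this hj hj'
      subst hjj
      rfl
    · intro g
      obtain ⟨i, j, rfl⟩ := h.exists_eq hm hn g
      refine ⟨⟨⟨i % n, Nat.mod_lt _ hn⟩, ⟨(s * (i / n) + j) % m, Nat.mod_lt _ hm⟩⟩, ?_⟩
      dsimp only
      rw [h.pow_eq_pow (Nat.mod_modEq _ _), pow_add, pow_mul, ← h.pow_eq, ← pow_mul, ← mul_assoc,
        ← pow_add, Nat.mod_add_div]
  rw [← Nat.card_congr (Equiv.ofBijective _ hbij), Nat.card_prod, Nat.card_fin, Nat.card_fin]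

/-- Replacing the generators by powers with an exponent prime to the order. -/
theorem IsPair.pow (h : IsPair m n s t a b) (hm : 0 < m) {K : ℕ} (hK : Nat.Coprime K (m * n)) :
    IsPair m n s (t ^ K) (a ^ K) (b ^ K) where
  pow_eq_one := by rw [← pow_mul, mul_comm, pow_mul, h.pow_eq_one, one_pow]
  pow_eq := by rw [← pow_mul, mul_comm, pow_mul, h.pow_eq, ← pow_mul, mul_comm, pow_mul]
  mul_comm' := by rw [pow_mul_pow_of_rel h.mul_comm', pow_mul]
  closure_eq := by
    rw [eq_top_iff, ← h.closure_eq, Subgroup.closure_le]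
    rintro x (rfl | rfl)
    · exact mem_of_pow_mem h.pow_eq_one hK.coprime_mul_right_right
        (Subgroup.subset_closure (Set.mem_insert _ _))
    · refine mem_of_pow_mem (N := m * n) ?_ hK
        (Subgroup.subset_closure (Set.mem_insert_of_mem _ rfl))
      rw [mul_comm, pow_mul, h.pow_eq, ← pow_mul, mul_comm, pow_mul, h.pow_eq_one, one_pow]
  orderOf_eq := by
    rw [(h.isOfFinOrder hm).orderOf_pow, h.orderOf_eq,
      Nat.Coprime.gcd_eq_one hK.coprime_mul_right_right.symm, Nat.div_one]
  dvd_of_mem i hi := by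
    rw [← pow_mul] at hi
    have : n ∣ K * i := h.dvd_of_mem _
      ((Subgroup.zpowers_le.mpr (Subgroup.pow_mem _ (Subgroup.mem_zpowers a) K)) hi)
    exact Nat.Coprime.dvd_of_dvd_mul_left hK.coprime_mul_left_right.symm this

theorem IsRelPair.isPair {t' : ℕ} {x y : G} (h : IsPair m n s t a b)
    (h' : IsRelPair m n s t' x y) (hm : 0 < m) (hn : 0 < n) {u' : (ZMod m)ˣ}
    (hu' : (u' : ZMod m) = t') (hmem : u' ∈ unitsSub m n s) : IsPair m n s t' x y := by
  have hP := presented_isPair (t := t') (t' := t') hn u' (by simpa using hu') hu' hmem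
  obtain ⟨f, fx, fy⟩ := exists_hom_presented (m := m) (n := n) (s := s) (t := t') (t' := t')
    (by simp) h'.pow_eq_one h'.pow_eq h'.mul_comm'
  have hsurj : Function.Surjective f := by
    rw [← MonoidHom.range_eq_top, eq_top_iff, ← h'.closure_eq, Subgroup.closure_le]
    rintro z (rfl | rfl)
    · exact ⟨_, fx⟩
    · exact ⟨_, fy⟩
  have hc := h.card_eq hm hn
  have hcP := hP.card_eq hm hn
  have : Finite (MetacyclicGroup m n s (t' : ℤ)) :=
    Nat.finite_of_card_ne_zero (by rw [hcP]; positivity)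
  have hbij : Function.Bijective f := by
    refine (Nat.bijective_iff_surjective_and_card f).mpr ⟨hsurj, ?_⟩
    rw [hc, hcP]
  have := hP.map_equiv (MulEquiv.ofBijective f hbij)
  rwa [MulEquiv.ofBijective_apply, MulEquiv.ofBijective_apply, fx, fy] at this

theorem IsPair.exists_pair (h : IsPair m n s t a b) (hm : 0 < m) (hn : 0 < n) (hs : s ∣ m)
    {u' : (ZMod m)ˣ} (hu' : (u' : ZMod m) = ((v' + 1 : ℕ) : ZMod m)) (hmem : u' ∈ unitsSub m n s)
    {e l w w' : ℕ} (hw : n * w = e * v') (hw' : n * w' = e * s)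
    (hrel : (m : ℤ) ∣ s * w - (t - (v' + 1 : ℕ)) +
      (∑ i ∈ range v', ((t : ℤ) ^ e) ^ i - v' + l * ((t : ℤ) ^ e - 1)))
    (hl : ∀ p : ℕ, p.Prime → p ∣ m → p ∣ l)
    (hτ : ∀ p : ℕ, p.Prime → p ∣ m → (p : ℤ) ∣ (t : ℤ) ^ e - 1)
    (hc : ∀ p : ℕ, p.Prime → p ∣ m → ¬ p ∣ 1 + w')
    (hY : ∀ p : ℕ, p.Prime → p ∣ m → (p : ℤ) ^ min (s.factorization p + 1) (m.factorization p) ∣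
      l * ∑ i ∈ range n, (t : ℤ) ^ i)
    (hY' : ∀ p : ℕ, p.Prime → p ∣ m → (p : ℤ) ^ min (s.factorization p + 1) (m.factorization p) ∣
      ∑ i ∈ range s, ((t : ℤ) ^ e) ^ i - s) :
    ∃ x y : G, IsPair m n s (v' + 1) x y := by
  have hx_m : (b ^ e * a) ^ m = 1 := by
    have h1 := mul_pow_of_rel h.mul_comm' e 1 m
    rw [pow_one, one_mul] at h1
    obtain ⟨d, hd⟩ := hs
    have h2 : m ∣ ∑ i ∈ range m, (t ^ e) ^ i := by
      have : (m : ℤ) ∣ ∑ i ∈ range m, ((t : ℤ) ^ e) ^ i := dvd_of_forall_prime hm.ne'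
        fun p hp hpm => pow_dvd_geom_sum (hτ p hp hpm) (Nat.ordProj_dvd m p)
      exact_mod_cast this
    obtain ⟨f, hf⟩ := h2
    rw [h1, hf, pow_mul a, h.pow_eq_one, one_pow, mul_one, hd, ← mul_assoc, ← hw', mul_assoc,
      pow_mul, h.pow_eq, ← pow_mul, show s * (w' * d) = m * w' by rw [hd]; ring, pow_mul,
      h.pow_eq_one, one_pow]
  have hx_v : (b ^ e * a) ^ v' = a ^ (s * w + ∑ i ∈ range v', (t ^ e) ^ i) := by
    have h1 := mul_pow_of_rel h.mul_comm' e 1 v'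
    rw [pow_one, one_mul] at h1
    rw [h1, ← hw, pow_mul, h.pow_eq, ← pow_mul, ← pow_add]
  have hx_s : (b ^ e * a) ^ s = a ^ (s * w' + ∑ i ∈ range s, (t ^ e) ^ i) := by
    have h1 := mul_pow_of_rel h.mul_comm' e 1 s
    rw [pow_one, one_mul] at h1
    rw [h1, ← hw', pow_mul, h.pow_eq, ← pow_mul, ← pow_add]
  have hy_n : (b * a ^ l) ^ n = a ^ (s + l * ∑ i ∈ range n, t ^ i) := by
    have h1 := mul_pow_of_rel h.mul_comm' 1 l n
    rw [pow_one, one_mul, pow_one] at h1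
    rw [h1, h.pow_eq, ← pow_add]
  have hconj : (b ^ e * a) * (b * a ^ l) = (b * a ^ l) * (b ^ e * a) ^ (v' + 1) := by
    have h1 := mul_mul_mul_of_rel h.mul_comm' e 1 1 l
    have h2 := mul_mul_mul_of_rel h.mul_comm' 1 l e 1
    rw [pow_one, pow_one, one_mul, pow_one] at h1
    rw [pow_one, pow_one] at h2
    rw [pow_succ', h1, ← mul_assoc (b * a ^ l), h2, hx_v, mul_assoc, ← pow_add, add_comm e]
    congr 1
    refine h.pow_eq_pow ?_
    rw [Nat.modEq_iff_dvd]
    refine hrel.trans (dvd_of_eq ?_)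
    push_cast
    ring
  have hz : Subgroup.zpowers ((b ^ e * a) ^ s) = Subgroup.zpowers ((b * a ^ l) ^ n) := by
    rw [hx_s, hy_n]
    refine (h.zpowers_eq hm (s' := s) ?_).trans (h.zpowers_eq hm (s' := s) ?_).symm
    · refine gcd_eq_of_dvd hm hs (c₁ := 1 + w') (Y := ∑ i ∈ range s, ((t : ℤ) ^ e) ^ i - s) ?_ ?_ hY'
      · push_cast
        ring
      · exact fun p hp hpm h1 => hc p hp hpm (by exact_mod_cast h1)
    · refine gcd_eq_of_dvd hm hs (c₁ := 1) (Y := l * ∑ i ∈ range n, (t : ℤ) ^ i) ?_ ?_ hY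
      · push_cast
        ring
      · intro p hp _ h1
        exact hp.one_lt.ne' (by exact_mod_cast Int.eq_one_of_dvd_one (by positivity) h1)
  have hfin : IsOfFinOrder (b ^ e * a) := isOfFinOrder_iff_pow_eq_one.mpr ⟨m, hm, hx_m⟩
  obtain ⟨K, hK, hK'⟩ := exists_coprime_pow_eq hfin.pow hz hm.ne'
  refine ⟨(b ^ e * a) ^ K, b * a ^ l, IsRelPair.isPair h ⟨?_, ?_, ?_, ?_⟩ hm hn hu' hmem⟩
  · rw [← pow_mul, mul_comm, pow_mul, hx_m, one_pow]
  · rw [← hK', ← pow_mul, mul_comm, pow_mul]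
  · have := pow_mul_pow_of_rel hconj K 1
    rw [pow_one, pow_one, pow_mul] at this
    exact this
  · set H := Subgroup.closure {(b ^ e * a) ^ K, b * a ^ l} with hH
    have hxH : b ^ e * a ∈ H :=
      mem_of_pow_mem hx_m hK (Subgroup.subset_closure (Set.mem_insert _ _))
    have hyH : b * a ^ l ∈ H := Subgroup.subset_closure (Set.mem_insert_of_mem _ rfl)
    have haH : a ∈ H := by
      set g := l * ∑ i ∈ range e, t ^ i with hg
      have h1 : (b * a ^ l) ^ e = b ^ e * a ^ g := by
        have := mul_pow_of_rel h.mul_comm' 1 l e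
        rwa [pow_one, one_mul, pow_one] at this
      have h2 : a ^ (1 - (g : ℤ)) ∈ H := by
        have : a ^ (1 - (g : ℤ)) = ((b * a ^ l) ^ e)⁻¹ * (b ^ e * a) := by
          rw [h1, mul_inv_rev, mul_assoc, inv_mul_cancel_left, sub_eq_neg_add, zpow_add, zpow_neg,
            zpow_natCast, zpow_one]
        rw [this]
        exact H.mul_mem (H.inv_mem (H.pow_mem hyH e)) hxH
      have h3 : IsCoprime (1 - (g : ℤ)) m := by
        rw [Int.isCoprime_iff_gcd_eq_one]
        by_contra hne
        obtain ⟨p, hp, hpd⟩ := Nat.exists_prime_and_dvd hne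
        have e1 : (p : ℤ) ∣ 1 - g := (Int.natCast_dvd_natCast.mpr hpd).trans (Int.gcd_dvd_left _ _)
        have e2 : p ∣ m := by
          exact_mod_cast (Int.natCast_dvd_natCast.mpr hpd).trans (Int.gcd_dvd_right _ _)
        have e3 : (p : ℤ) ∣ g := by
          exact_mod_cast (hl p hp e2).mul_right _
        have e4 := dvd_add e1 e3
        rw [sub_add_cancel] at e4
        exact hp.one_lt.ne' (by exact_mod_cast Int.eq_one_of_dvd_one (by positivity) e4)
      obtain ⟨c, d, hcd⟩ := h3
      have h4 : a = (a ^ (1 - (g : ℤ))) ^ c := by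
        rw [← zpow_mul, mul_comm, eq_sub_of_add_eq hcd, zpow_sub, zpow_one, mul_comm d, zpow_mul,
          zpow_natCast, h.pow_eq_one, one_zpow, inv_one, mul_one]
      rw [h4]
      exact H.zpow_mem h2 c
    have hbH : b ∈ H := by
      have : b = (b * a ^ l) * (a ^ l)⁻¹ := by rw [mul_inv_cancel_right]
      rw [this]
      exact H.mul_mem hyH (H.inv_mem (H.pow_mem haH l))
    rw [eq_top_iff, ← h.closure_eq, Subgroup.closure_le]
    rintro z (rfl | rfl)
    · exact haH
    · exact hbH

end Pairs

end Metacyclic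

namespace Metacyclic

open Finset

section InvariantsOfBracket

variable {m n s t t' : ℕ} {u u' : (ZMod m)ˣ} {p : ℕ}

theorem prime_dvd_bracket (hm : 0 < m) (hu : (u : ZMod m) = t) (hp : p.Prime) (hpm : p ∣ m) :
    p ∣ bracket (Subgroup.zpowers u) n s := by
  by_cases hpt : (p : ℤ) ∣ t - 1
  · have h1 := (mem_primeFactors_rInv_iff hm hu).mpr ⟨hp, hpm, hpt⟩
    refine Dvd.dvd.trans ?_ ((rInv_pow_dvd_localPart hm hp).trans (localPart_dvd_bracket h1))
    refine dvd_pow_self p ?_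
    exact (hp.factorization_pos_of_dvd (rInv_ne_zero hm _)
      (Nat.dvd_of_mem_primeFactors h1)).ne'
  · refine Dvd.dvd.trans ?_ (pPart_dvd_bracket hm ((mem_nuSet_iff hm hu).mpr ⟨hp, hpm, hpt⟩))
    exact dvd_pow_self p (hp.factorization_pos_of_dvd hm.ne' hpm).ne'

theorem four_dvd_bracket (hm : 0 < m) (hu : (u : ZMod m) = t) (h4 : 4 ∣ m) :
    4 ∣ bracket (Subgroup.zpowers u) n s := by
  have h2 : 2 ∣ m := (by norm_num : 2 ∣ 4).trans h4
  have h1 := dvd_sub_one_of_two_dvd hu h2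
  refine Dvd.dvd.trans ?_ ((rInv_pow_dvd_localPart hm Nat.prime_two).trans (localPart_dvd_bracket
    ((mem_primeFactors_rInv_iff hm hu).mpr ⟨Nat.prime_two, h2, by exact_mod_cast h1⟩)))
  have h3 : 2 ^ 2 ∣ rInv (Subgroup.zpowers u) := by
    rw [two_pow_dvd_rInv_iff hm hu (by simpa using h4)]
    norm_num
    omega
  rw [Nat.prime_two.pow_dvd_iff_le_factorization (rInv_ne_zero hm _)] at h3
  exact pow_dvd_pow 2 h3

theorem dvd_sub_one_of_dvd_pow_sub {q x y : ℤ} {K : ℕ} (h : q ∣ x ^ K - y) (hx : q ∣ x - 1) :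
    q ∣ y - 1 := by
  have := dvd_sub (dvd_pow_sub_one hx K) h
  rwa [sub_sub_sub_cancel_left] at this

theorem invariants_eq_of_bracket (hm : 0 < m) (hu : (u : ZMod m) = t) (hu' : (u' : ZMod m) = t')
    (hb : bracket (Subgroup.zpowers u) n s = bracket (Subgroup.zpowers u') n s) {K K' : ℕ}
    (h : (bracket (Subgroup.zpowers u) n s : ℤ) ∣ (t : ℤ) ^ K - t')
    (h' : (bracket (Subgroup.zpowers u) n s : ℤ) ∣ (t' : ℤ) ^ K' - t) :
    nuSet (Subgroup.zpowers u) = nuSet (Subgroup.zpowers u') ∧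
    (rInv (Subgroup.zpowers u)).primeFactors = (rInv (Subgroup.zpowers u')).primeFactors ∧
    epsInv (Subgroup.zpowers u) = epsInv (Subgroup.zpowers u') ∧
    ∀ p ∈ (rInv (Subgroup.zpowers u)).primeFactors,
      (rInv (Subgroup.zpowers u)).factorization p = (rInv (Subgroup.zpowers u')).factorization p ∧
      (oInv (Subgroup.zpowers u)).factorization p =
        (oInv (Subgroup.zpowers u')).factorization p := by
  have hprime : ∀ p : ℕ, p.Prime → p ∣ m → ((p : ℤ) ∣ t - 1 ↔ (p : ℤ) ∣ t' - 1) := by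
    intro p hp hpm
    have h1 : (p : ℤ) ∣ bracket (Subgroup.zpowers u) n s := by
      exact_mod_cast prime_dvd_bracket hm hu hp hpm
    exact ⟨dvd_sub_one_of_dvd_pow_sub (h1.trans h), dvd_sub_one_of_dvd_pow_sub (h1.trans h')⟩
  have hν := nuSet_eq hm hu hu' hprime
  have hpr := primeFactors_rInv_eq hm hu hu' hprime
  have heps : epsInv (Subgroup.zpowers u) = epsInv (Subgroup.zpowers u') := by
    refine epsInv_eq hm hu hu' fun h4 => ?_
    have h1 : ((4 : ℕ) : ℤ) ∣ bracket (Subgroup.zpowers u) n s := by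
      exact_mod_cast four_dvd_bracket hm hu h4
    have h2 : 2 ∣ m := (by norm_num : 2 ∣ 4).trans h4
    have e1 := dvd_sub_one_of_two_dvd hu h2
    have e2 := dvd_sub_one_of_two_dvd hu' h2
    have e3 : (4 : ℤ) ∣ t - 1 ↔ (4 : ℤ) ∣ t' - 1 :=
      ⟨dvd_sub_one_of_dvd_pow_sub (h1.trans h), dvd_sub_one_of_dvd_pow_sub (h1.trans h')⟩
    omega
  refine ⟨hν, hpr, heps, fun p hp => ?_⟩
  have hpp := Nat.prime_of_mem_primeFactors hp
  have hνb : (setPart (nuSet (Subgroup.zpowers u)) m : ℤ) ∣ bracket (Subgroup.zpowers u) n s := by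
    exact_mod_cast dvd_mul_right _ _
  refine ⟨?_, oInv_factorization_eq hm hu hu' hν (hνb.trans h) (hνb.trans h') hpp
    (not_mem_nuSet hp)⟩
  have key : ∀ {t t' K : ℕ} {u u' : (ZMod m)ˣ}, (u : ZMod m) = t → (u' : ZMod m) = t' →
      epsInv (Subgroup.zpowers u) = epsInv (Subgroup.zpowers u') →
      p ∈ (rInv (Subgroup.zpowers u)).primeFactors →
      (bracket (Subgroup.zpowers u) n s : ℤ) ∣ (t : ℤ) ^ K - t' →
      (rInv (Subgroup.zpowers u)).factorization p ≤
        (rInv (Subgroup.zpowers u')).factorization p := by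
    intro t t' K u u' hu hu' heps hp h
    have h1 : (p : ℤ) ^ (rInv (Subgroup.zpowers u)).factorization p ∣ (t : ℤ) ^ K - t' := by
      refine Dvd.dvd.trans ?_ h
      exact_mod_cast (rInv_pow_dvd_localPart hm hpp).trans (localPart_dvd_bracket hp)
    rw [← hpp.pow_dvd_iff_le_factorization (rInv_ne_zero hm _)]
    rcases eps_pow_eq_one_or (Subgroup.zpowers u) hpp with he | ⟨rfl, he⟩
    · rw [pow_dvd_rInv_iff_of_eps hm hu' hpp (heps ▸ he) (rInv_pow_dvd _ _)]
      exact dvd_sub_one_of_dvd_pow_sub h1 (pos_dvd hm hu hpp he)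
    · have he' := heps.symm.trans he
      rw [two_pow_dvd_rInv_iff_of_eps hm hu' he' (rInv_pow_dvd _ _)]
      have e1 := neg_dvd hm hu he
      have e2 := neg_two_le hm hu he
      have hk : Odd K := odd_of_dvd_pow_sub le_rfl ((pow_dvd_pow _ e2).trans e1)
        ((pow_dvd_pow _ (neg_two_le hm hu' he')).trans (neg_dvd hm hu' he'))
        ((pow_dvd_pow _ e2).trans h1)
      have := dvd_sub (dvd_add_one_of_pow e1 hk) h1
      rwa [show (t : ℤ) ^ K + 1 - (t ^ K - t') = t' + 1 by ring] at this
  exact le_antisymm (key hu hu' heps hp h) (key hu' hu heps.symm (hpr ▸ hp) (hb ▸ h'))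

/-- The integer `d` is, at the prime `p` dividing `r`, divisible by enough powers of `p` for the
generators of the group to be modified so that the parameter `t` changes by `d`. -/
def IsSmall (T : Subgroup (ZMod m)ˣ) (n s p : ℕ) (d : ℤ) : Prop :=
  (p : ℤ) ^ m.factorization p ∣ d ∨
  (epsInv T ^ (p - 1) = 1 ∧ (rInv T).factorization p < m.factorization p ∧
    ∃ D, (rInv T).factorization p ≤ D ∧ s.factorization p ≤ D ∧
      (rInv T).factorization p + s.factorization p + (oInv T).factorization p ≤
        n.factorization p + D ∧ D < m.factorization p ∧ (p : ℤ) ^ D ∣ d) ∨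
  (p = 2 ∧ epsInv T = -1 ∧ 2 ≤ (oInv T).factorization 2 ∧
    (oInv T).factorization 2 < n.factorization 2 ∧ s.factorization 2 + 1 = m.factorization 2 ∧
    m.factorization 2 < n.factorization 2 + (rInv T).factorization 2 ∧
    (rInv T).factorization 2 + 2 ≤ m.factorization 2 ∧
    (2 : ℤ) ^ (m.factorization 2 - 1) ∣ d ∧ ¬ (2 : ℤ) ^ m.factorization 2 ∣ d)

theorem IsSmall.congr {T : Subgroup (ZMod m)ˣ} {d d' : ℤ} (h : IsSmall T n s p d)
    (hd : (p : ℤ) ^ m.factorization p ∣ d' - d) : IsSmall T n s p d' := by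
  have key : ∀ j ≤ m.factorization p, (p : ℤ) ^ j ∣ d → (p : ℤ) ^ j ∣ d' := fun j hj hjd => by
    have := dvd_add ((pow_dvd_pow _ hj).trans hd) hjd
    rwa [sub_add_cancel] at this
  rcases h with h | ⟨h1, h2, D, h3, h4, h5, h6, h7⟩ | ⟨rfl, h1, h2, h3, h4, h5, h6, h7, h8⟩
  · exact Or.inl (key _ le_rfl h)
  · exact Or.inr (Or.inl ⟨h1, h2, D, h3, h4, h5, h6, key D h6.le h7⟩)
  · refine Or.inr (Or.inr ⟨rfl, h1, h2, h3, h4, h5, h6, key _ (Nat.sub_le _ _) h7, fun h => h8 ?_⟩)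
    have := dvd_sub h hd
    rwa [sub_sub_cancel] at this

theorem two_le_rInv_of_pos (hm : 0 < m) (hu : (u : ZMod m) = t)
    (he : epsInv (Subgroup.zpowers u) = 1) (hM : 2 ≤ m.factorization 2) :
    2 ≤ (rInv (Subgroup.zpowers u)).factorization 2 := by
  have h4 : 2 ^ 2 ∣ m := (Nat.prime_two.pow_dvd_iff_le_factorization hm.ne').mpr hM
  rw [← Nat.prime_two.pow_dvd_iff_le_factorization (rInv_ne_zero hm _)]
  have h5 : ¬ (4 ∣ m ∧ (4 : ℤ) ∣ t + 1) := by
    rw [← epsInv_eq_neg_one_iff hm hu, he]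
    norm_num
  have h1 := dvd_sub_one_of_two_dvd hu ((by norm_num : 2 ∣ 2 ^ 2).trans h4)
  rw [two_pow_dvd_rInv_iff hm hu h4]
  norm_num at h4 ⊢
  omega

theorem exists_isSmall_pow (hm : 0 < m) (hu : (u : ZMod m) = t) (hu' : (u' : ZMod m) = t')
    (hT : IsCanonical n s (Subgroup.zpowers u))
    (he : epsInv (Subgroup.zpowers u) = epsInv (Subgroup.zpowers u'))
    (hp : p ∈ (rInv (Subgroup.zpowers u)).primeFactors)
    (hr : (rInv (Subgroup.zpowers u)).factorization p =
      (rInv (Subgroup.zpowers u')).factorization p)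
    (h : (localPart (Subgroup.zpowers u) n s p : ℤ) ∣ t - t') :
    ∃ k : ℕ, k ≡ 1 [MOD p ^ (oInv (Subgroup.zpowers u)).factorization p] ∧ ¬ p ∣ k ∧
      IsSmall (Subgroup.zpowers u) n s p ((t : ℤ) ^ k - t') := by
  have hpp := Nat.prime_of_mem_primeFactors hp
  have hone : IsSmall (Subgroup.zpowers u) n s p ((t : ℤ) - t') →
    ∃ k : ℕ, k ≡ 1 [MOD p ^ (oInv (Subgroup.zpowers u)).factorization p] ∧ ¬ p ∣ k ∧
      IsSmall (Subgroup.zpowers u) n s p ((t : ℤ) ^ k - t') := fun h' =>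
    ⟨1, rfl, hpp.one_lt.ne' ∘ Nat.dvd_one.mp, by rwa [pow_one]⟩
  have hR1 : 1 ≤ (rInv (Subgroup.zpowers u)).factorization p :=
    hpp.factorization_pos_of_dvd (rInv_ne_zero hm _) (Nat.dvd_of_mem_primeFactors hp)
  have hRM := rInv_factorization_le hm (Subgroup.zpowers u) p
  have hRd : (p : ℤ) ^ (rInv (Subgroup.zpowers u)).factorization p ∣ t - t' := by
    refine Dvd.dvd.trans ?_ h
    exact_mod_cast rInv_pow_dvd_localPart hm hpp
  rcases hRM.eq_or_lt with hRM | hRM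
  · exact hone (Or.inl (hRM ▸ hRd))
  rcases eps_pow_eq_one_or (Subgroup.zpowers u) hpp with hep | ⟨rfl, hen⟩
  · rw [localPart_of_pos hpp hep, Nat.cast_pow] at h
    have hy := pos_not_dvd hm hu' hpp (he ▸ hep) (hr ▸ hRM)
    have hx := pos_not_dvd hm hu hpp hep hRM
    rw [← hr] at hy
    by_cases hOR : (p : ℤ) ^ ((rInv (Subgroup.zpowers u)).factorization p +
        (oInv (Subgroup.zpowers u)).factorization p) ∣ t - t'
    · have h22 : p = 2 → 2 ≤ (rInv (Subgroup.zpowers u)).factorization p := by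
        rintro rfl
        exact two_le_rInv_of_pos hm hu (by simpa using hep) (by omega)
      obtain ⟨k, h1, h2, h3⟩ := exists_coprime_pow_sub_dvd hpp hR1 hRM h22
        (pos_dvd hm hu hpp hep) hx hy hOR
      exact ⟨k, h1, h2, Or.inl h3⟩
    · apply hone
      by_cases hM : (p : ℤ) ^ m.factorization p ∣ t - t'
      · exact Or.inl hM
      refine Or.inr (Or.inl ⟨hep, hRM, _, ?_, ?_, ?_, ?_, h⟩)
      all_goals
        have h1 : ¬ (_ ≤ _) := fun hle => hM ((pow_dvd_pow _ hle).trans h)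
        have h2 : ¬ (_ ≤ _) := fun hle => hOR ((pow_dvd_pow _ hle).trans h)
        omega
  · have hen' := he.symm.trans hen
    have hx := neg_not_dvd hm hu hen hRM
    have hy := neg_not_dvd hm hu' hen' (hr ▸ hRM)
    rw [← hr] at hy
    have hx0 := neg_dvd hm hu hen
    have hy0 := neg_dvd hm hu' hen'
    rw [← hr] at hy0
    rw [localPart_two_of_neg hen] at h
    split_ifs at h with h1 h2
    · rcases h1 with h1 | h1
      · have hneg : ∀ z : ℕ, -(z : ℤ) - 1 = -(z + 1) := fun z => by ring
        obtain ⟨k, -, h4, h5⟩ := exists_coprime_pow_sub_dvd (x := -t) (y := -t') (O := 0)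
          Nat.prime_two hR1 hRM (fun _ => neg_two_le hm hu hen)
          (by rw [hneg, dvd_neg]; exact_mod_cast hx0) (by rw [hneg, dvd_neg]; exact_mod_cast hx)
          (by rw [hneg, dvd_neg]; exact_mod_cast hy)
          (by rw [neg_sub_neg, dvd_sub_comm]; simpa using hRd)
        have hk : Odd k := by rwa [← Nat.not_even_iff_odd, even_iff_two_dvd]
        refine ⟨k, ?_, h4, Or.inl ?_⟩
        · refine Nat.ModEq.of_dvd (pow_dvd_pow 2 h1) ?_
          rw [pow_one]
          exact Nat.odd_iff.mp hk
        · rw [hk.neg_pow, neg_sub_neg, dvd_sub_comm] at h5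
          exact h5
      · apply hone
        left
        have hM : m.factorization 2 = (rInv (Subgroup.zpowers u)).factorization 2 + 1 := by omega
        rw [hM]
        obtain ⟨a, ha⟩ := hx0
        obtain ⟨b, hb⟩ := hy0
        have ha' : ¬ Even a := by
          rintro ⟨c, hc⟩
          exact hx ⟨c, by rw [ha, hc]; ring⟩
        have hb' : ¬ Even b := by
          rintro ⟨c, hc⟩
          exact hy ⟨c, by rw [hb, hc]; ring⟩
        obtain ⟨c, hc⟩ := (Int.not_even_iff_odd.mp ha').sub_odd (Int.not_even_iff_odd.mp hb')
        refine ⟨c, ?_⟩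
        push_cast
        rw [show (t : ℤ) - t' = t + 1 - (t' + 1) by ring, ha, hb, ← mul_sub, hc]
        ring
    · apply hone
      by_cases hM : (2 : ℤ) ^ m.factorization 2 ∣ t - t'
      · left
        exact_mod_cast hM
      push Not at h1
      have hS : s.factorization 2 ≠ n.factorization 2 +
          (rInv (Subgroup.zpowers u)).factorization 2 := by
        intro h
        refine hT.neg_ne hen ?_
        unfold pPart
        rw [h, pow_add, mul_comm]
      obtain ⟨h3, h4⟩ := h2.2 hS
      exact Or.inr (Or.inr ⟨rfl, hen, h1.1, h2.1, h3, h4, h1.2, by exact_mod_cast h, hM⟩)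
    · apply hone
      left
      exact_mod_cast h

end InvariantsOfBracket

end Metacyclic

namespace Metacyclic

open Finset

/-- The conditions at the prime `p` on an exponent `e` for `b ^ e * a` to satisfy the relations of
the presentation in which the parameter `v + 1 + d` is replaced by `v + 1`. -/
structure IsLocalExp (p M N O n s v : ℕ) (d e : ℤ) : Prop where
  dvd_mul_v : (p : ℤ) ^ N ∣ e * v
  dvd_mul_s : (p : ℤ) ^ N ∣ e * s
  dvd : (p : ℤ) ^ O ∣ e
  rel : (p : ℤ) ^ (N + M) ∣ s * (e * v) - n * d
  not_dvd : M ≠ 0 → ¬ (p : ℤ) ^ (N + 1) ∣ n + e * s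

section LocalExp

variable {p M N O n s v : ℕ} {d e e' : ℤ}

theorem IsLocalExp.congr (h : IsLocalExp p M N O n s v d e) (hO : O ≤ N)
    (he : (p : ℤ) ^ (N + M) ∣ e' - e) : IsLocalExp p M N O n s v d e' := by
  have key : ∀ {j : ℕ} {x y : ℤ}, j ≤ N + M → (e' - e) ∣ y - x → (p : ℤ) ^ j ∣ x →
      (p : ℤ) ^ j ∣ y := fun hj h1 h2 => by
    have := dvd_add (((pow_dvd_pow _ hj).trans he).trans h1) h2
    rwa [sub_add_cancel] at this
  refine ⟨key (by omega) ⟨v, by ring⟩ h.dvd_mul_v, key (by omega) ⟨s, by ring⟩ h.dvd_mul_s,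
    key (by omega) dvd_rfl h.dvd, key le_rfl ⟨s * v, by ring⟩ h.rel, fun hM hd => h.not_dvd hM ?_⟩
  refine key (by omega) ⟨-s, by ring⟩ hd

theorem IsLocalExp.mono {O' : ℕ} (h : IsLocalExp p M N O n s v d e) (hO : O' ≤ O) :
    IsLocalExp p M N O' n s v d e :=
  ⟨h.dvd_mul_v, h.dvd_mul_s, (pow_dvd_pow _ hO).trans h.dvd, h.rel, h.not_dvd⟩

theorem isLocalExp_zero (hn : ((p : ℤ) ^ N) ∣ n) (hn' : ¬ (p : ℤ) ^ (N + 1) ∣ n)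
    (hd : (p : ℤ) ^ M ∣ d) : IsLocalExp p M N N n s v d 0 where
  dvd_mul_v := by simp
  dvd_mul_s := by simp
  dvd := by simp
  rel := by
    rw [zero_mul, mul_zero, zero_sub, dvd_neg, pow_add]
    exact mul_dvd_mul hn hd
  not_dvd _ := by simpa using hn'

theorem exists_isLocalExp {R S D n' s' v' : ℕ} (hp : p.Prime) (hn : n = p ^ N * n')
    (hn' : ¬ p ∣ n') (hs : s = p ^ S * s') (hs' : ¬ p ∣ s') (hv : v = p ^ R * v') (hv' : ¬ p ∣ v')
    (hd : (p : ℤ) ^ D ∣ d) (hRD : R ≤ D) (hSD : S ≤ D) (hO : R + S + O ≤ N + D) (hDM : D < M)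
    (ht : ¬ (p : ℤ) ^ (R + 1) ∣ v + d) :
    ∃ e : ℕ, IsLocalExp p M N O n s v d e := by
  obtain ⟨d', rfl⟩ := hd
  have hpZ := Nat.prime_iff_prime_int.mp hp
  have hco : IsCoprime ((s' * v' : ℕ) : ℤ) ((p ^ M : ℕ) : ℤ) := by
    rw [Nat.isCoprime_iff_coprime]
    exact Nat.Coprime.pow_right _ (Nat.Coprime.symm
      ((hp.coprime_iff_not_dvd).mpr fun h => (hp.dvd_mul.mp h).elim hs' hv'))
  obtain ⟨α, β, hαβ⟩ := hco
  obtain ⟨f, hf⟩ : ∃ f : ℕ, (p : ℤ) ^ M ∣ s' * v' * f - n' * d' := by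
    have hpM : (0 : ℤ) < (p : ℤ) ^ M := pow_pos (by exact_mod_cast hp.pos) _
    refine ⟨(α * (n' * d') % (p : ℤ) ^ M).toNat, ?_⟩
    rw [Int.toNat_of_nonneg (Int.emod_nonneg _ hpM.ne'), Int.emod_def]
    push_cast at hαβ
    refine ⟨- β * (n' * d') - s' * v' * (α * (n' * d') / (p : ℤ) ^ M), ?_⟩
    linear_combination (n' * d' : ℤ) * hαβ
  obtain ⟨E, hE⟩ : ∃ E, N + D = R + S + E := ⟨N + D - (R + S), by omega⟩
  refine ⟨p ^ E * f, ?_, ?_, ?_, ?_, fun hM h => ?_⟩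
  · rw [hv]
    push_cast
    refine (pow_dvd_pow (p : ℤ) (show N ≤ E + R by omega)).trans ⟨f * v', by rw [pow_add]; ring⟩
  · rw [hs]
    push_cast
    refine (pow_dvd_pow (p : ℤ) (show N ≤ E + S by omega)).trans ⟨f * s', by rw [pow_add]; ring⟩
  · push_cast
    exact (pow_dvd_pow (p : ℤ) (show O ≤ E by omega)).mul_right _
  · rw [hn, hs, hv]
    push_cast
    obtain ⟨g, hg⟩ := hf
    have h1 : (p : ℤ) ^ (N + M) ∣ (p : ℤ) ^ (N + D) * p ^ M := by
      rw [← pow_add]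
      exact pow_dvd_pow _ (by omega)
    refine h1.trans ⟨g, ?_⟩
    have e1 : (p : ℤ) ^ (N + D) = p ^ R * p ^ S * p ^ E := by rw [hE, pow_add, pow_add]
    have e2 : (p : ℤ) ^ (N + D) = p ^ N * p ^ D := pow_add _ _ _
    linear_combination (p : ℤ) ^ (N + D) * hg - (s' * f * v' : ℤ) * e1 + (n' * d' : ℤ) * e2
  · obtain ⟨F, rfl⟩ := Nat.exists_eq_add_of_le hRD
    have h1 : (p : ℤ) ^ (N + 1) ∣ p ^ N * (n' + p ^ F * (f * s')) := by
      refine h.trans (dvd_of_eq ?_)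
      rw [hn, hs]
      push_cast
      have : (p : ℤ) ^ E * p ^ S = p ^ N * p ^ F := by
        rw [← pow_add, ← pow_add]
        congr 1
        omega
      linear_combination (f * s' : ℤ) * this
    rw [pow_succ, mul_dvd_mul_iff_left (pow_ne_zero _ (by exact_mod_cast hp.ne_zero))] at h1
    apply ht
    rw [hv]
    push_cast
    rw [show (p : ℤ) ^ R * v' + p ^ (R + F) * d' = p ^ R * (v' + p ^ F * d') by rw [pow_add]; ring,
      pow_succ]
    refine mul_dvd_mul_left _ ?_
    have h2 : (p : ℤ) ∣ s' * v' * f - n' * d' :=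
      (dvd_pow_self _ (by omega)).trans hf
    have h3 : ¬ (p : ℤ) ∣ n' := by exact_mod_cast hn'
    have h4 : (p : ℤ) ∣ n' * (v' + p ^ F * d') := by
      have := dvd_sub (h1.mul_left (v' : ℤ)) (h2.mul_left ((p : ℤ) ^ F))
      refine this.trans (dvd_of_eq ?_)
      ring
    exact (hpZ.dvd_or_dvd h4).resolve_left h3

theorem isLocalExp_two {n' s' v' R : ℕ} {d' : ℤ} (hn : n = 2 ^ N * n') (hn' : Odd n')
    (hs : s = 2 ^ (M - 1) * s') (hs' : Odd s') (hv : v = 2 * v') (hv' : Odd v')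
    (hd : d = 2 ^ (M - 1) * d') (hd' : Odd d') (hON : O < N) (hR : 2 ≤ R) (hRM : R + 2 ≤ M) :
    IsLocalExp 2 M N O n s v d ((2 ^ (N - 1) : ℕ) : ℤ) := by
  obtain ⟨N, rfl⟩ : ∃ N', N = N' + 1 := ⟨N - 1, by omega⟩
  obtain ⟨M, rfl⟩ : ∃ M', M = M' + 1 := ⟨M - 1, by omega⟩
  simp only [Nat.add_sub_cancel] at hs hd ⊢
  have hc : Odd ((s' * v' : ℕ) : ℤ) := by exact_mod_cast hs'.mul hv'
  have hc' : Odd ((n' : ℤ) * d') := (by exact_mod_cast hn' : Odd (n' : ℤ)).mul hd'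
  refine ⟨?_, ?_, ?_, ?_, fun _ h => ?_⟩
  · rw [hv]
    push_cast
    exact ⟨v', by ring⟩
  · rw [hs]
    push_cast
    exact (pow_dvd_pow _ (show N + 1 ≤ N + M by omega)).trans ⟨s', by ring⟩
  · push_cast
    exact pow_dvd_pow _ (by omega)
  · obtain ⟨c, hc⟩ := hc.sub_odd hc'
    refine ⟨c, ?_⟩
    rw [hs, hv, hn, hd]
    push_cast at hc ⊢
    linear_combination (2 : ℤ) ^ (N + 1 + M) * hc
  · obtain ⟨c, hc⟩ := hn'
    obtain ⟨g, rfl⟩ : ∃ g, M = g + 2 := ⟨M - 2, by omega⟩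
    have h1 : (2 : ℤ) ^ (N + 1) * 2 ∣ 2 ^ (N + 1) * 1 := by
      have h2 : (2 : ℤ) ^ (N + 1) * 2 ∣ 2 ^ (N + 1) * (2 * c + 2 ^ g * 2 * s') :=
        mul_dvd_mul_left _ (dvd_add (dvd_mul_right _ _) ⟨2 ^ g * s', by ring⟩)
      have h3 : (2 : ℤ) ^ (N + 1) * 2 ∣ n + 2 ^ N * s := by
        refine Dvd.dvd.trans (dvd_of_eq ?_) (h.trans (dvd_of_eq ?_)) <;> push_cast <;> ring
      refine (dvd_sub h3 h2).trans (dvd_of_eq ?_)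
      rw [hn, hs, hc]
      push_cast
      ring
    rw [mul_dvd_mul_iff_left (by positivity)] at h1
    norm_num at h1

end LocalExp

end Metacyclic

namespace Metacyclic

open Finset

theorem exists_forall_modEq (S : Finset ℕ) (hS : ∀ p ∈ S, p.Prime) (B f : ℕ → ℕ) :
    ∃ k : ℕ, ∀ p ∈ S, k ≡ f p [MOD p ^ B p] := by
  obtain ⟨k, hk⟩ := Nat.chineseRemainderOfFinset f (fun p => p ^ B p) S
    (fun p hp => pow_ne_zero _ (hS p hp).ne_zero) fun p hp q hq hpq =>
      Nat.Coprime.pow _ _ ((Nat.coprime_primes (hS p hp) (hS q hq)).mpr hpq)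
  exact ⟨k, hk⟩

theorem pow_dvd_of_pow_add_dvd_mul {p N M n n' : ℕ} (hp : p.Prime) (hn : n = p ^ N * n')
    (hn' : ¬ p ∣ n') {X : ℤ} (h : (p : ℤ) ^ (N + M) ∣ n * X) : (p : ℤ) ^ M ∣ X := by
  rw [hn, pow_add] at h
  push_cast at h
  rw [mul_assoc, mul_dvd_mul_iff_left (pow_ne_zero _ (by exact_mod_cast hp.ne_zero))] at h
  exact (Nat.prime_iff_prime_int.mp hp).pow_dvd_of_dvd_mul_left M (by exact_mod_cast hn') h

section Exponent

variable {m n s t t' v' : ℕ} {u u' : (ZMod m)ˣ} {p : ℕ}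

theorem exists_isLocalExp_of_isSmall (hm : 0 < m) (hn : 0 < n) (hs : 0 < s) (ht' : t' = v' + 1)
    (hu : (u : ZMod m) = t) (hu' : (u' : ZMod m) = t')
    (hT : Subgroup.zpowers u ≤ unitsSub m n s)
    (he : epsInv (Subgroup.zpowers u) = epsInv (Subgroup.zpowers u'))
    (hp : p ∈ (rInv (Subgroup.zpowers u)).primeFactors)
    (hr : (rInv (Subgroup.zpowers u)).factorization p =
      (rInv (Subgroup.zpowers u')).factorization p)
    (h : IsSmall (Subgroup.zpowers u) n s p (t - t')) :
    ∃ e : ℕ, IsLocalExp p (m.factorization p) (n.factorization p)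
        ((oInv (Subgroup.zpowers u)).factorization p) n s v' (t - t') e ∧
      (p ^ m.factorization p ∣ e ∨ (epsInv (Subgroup.zpowers u) ^ (p - 1) = 1 ∧
        (rInv (Subgroup.zpowers u)).factorization p < m.factorization p) ∨
        (p = 2 ∧ epsInv (Subgroup.zpowers u) = -1 ∧ 3 ≤ n.factorization 2 ∧
          m.factorization 2 < n.factorization 2 + (rInv (Subgroup.zpowers u)).factorization 2 ∧
          2 ^ (n.factorization 2 - 1) ∣ e)) := by
  have hpp := Nat.prime_of_mem_primeFactors hp
  obtain ⟨n', hn', hnp⟩ := exists_eq_pow_mul hn.ne' hpp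
  obtain ⟨s', hs', hsp⟩ := exists_eq_pow_mul hs.ne' hpp
  have hv : (t' : ℤ) - 1 = v' := by rw [ht']; push_cast; ring
  rcases h with h | ⟨h1, h2, D, h3, h4, h5, h6, h7⟩ | ⟨rfl, h1, h2, h3, h4, h5, h6, h7, h8⟩
  · refine ⟨0, IsLocalExp.mono (O := n.factorization p) ?_ ?_, Or.inl (dvd_zero _)⟩
    · rw [Nat.cast_zero]
      refine isLocalExp_zero ?_ ?_ h
      · exact_mod_cast Nat.ordProj_dvd n p
      · exact_mod_cast Nat.pow_succ_factorization_not_dvd hn.ne' hpp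
    · exact (hpp.pow_dvd_iff_le_factorization hn.ne').mp (pow_o_dvd_n hm hu hT hpp (not_mem_nuSet hp))
  · have e1 := pos_dvd hm hu' hpp (he ▸ h1)
    have e2 := pos_not_dvd hm hu' hpp (he ▸ h1) (hr ▸ h2)
    have e3 := pos_not_dvd hm hu hpp h1 h2
    rw [← hr, hv] at e1 e2
    obtain ⟨v'', hv''⟩ : p ^ (rInv (Subgroup.zpowers u)).factorization p ∣ v' := by exact_mod_cast e1
    have hvp : ¬ p ∣ v'' := by
      rintro ⟨c, rfl⟩
      refine e2 ⟨c, ?_⟩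
      rw [hv'']
      push_cast
      ring
    obtain ⟨e, he⟩ := exists_isLocalExp (O := (oInv (Subgroup.zpowers u)).factorization p)
      hpp hn' hnp hs' hsp hv'' hvp h7 h3 h4 h5 h6 (by rwa [← hv, sub_add_sub_cancel'])
    exact ⟨e, he, Or.inr (Or.inl ⟨h1, h2⟩)⟩
  · have e1 := ((epsInv_eq_neg_one_iff hm hu').mp (he.symm.trans h1)).2
    have hR2 := neg_two_le hm hu h1
    obtain ⟨d', hd'⟩ := h7
    have hd'o : Odd d' := by
      rw [← Int.not_even_iff_odd]
      rintro ⟨c, rfl⟩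
      refine h8 ⟨c, ?_⟩
      rw [hd', ← two_mul, ← mul_assoc, ← pow_succ, Nat.sub_add_cancel (by omega)]
    rw [← even_iff_two_dvd, Nat.not_even_iff_odd] at hnp hsp
    rw [show s.factorization 2 = m.factorization 2 - 1 by omega] at hs'
    obtain ⟨v'', hv'', hvo⟩ : ∃ v'', v' = 2 * v'' ∧ Odd v'' := by
      refine ⟨v' / 2, by omega, ?_⟩
      rw [Nat.odd_iff]
      omega
    refine ⟨2 ^ (n.factorization 2 - 1), isLocalExp_two hn' hnp hs' hsp hv'' hvo hd' hd'o h3 hR2 h6,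
      Or.inr (Or.inr ⟨rfl, h1, by omega, h5, dvd_rfl⟩)⟩

theorem exists_exponent (hm : 0 < m) (hn : 0 < n) (hs : 0 < s) (ht' : t' = v' + 1)
    (hu : (u : ZMod m) = t) (hu' : (u' : ZMod m) = t')
    (hT : Subgroup.zpowers u ≤ unitsSub m n s)
    (he : epsInv (Subgroup.zpowers u) = epsInv (Subgroup.zpowers u'))
    (hr : ∀ p ∈ (rInv (Subgroup.zpowers u)).primeFactors,
      (rInv (Subgroup.zpowers u)).factorization p = (rInv (Subgroup.zpowers u')).factorization p)
    (hν : (setPart (nuSet (Subgroup.zpowers u)) m : ℤ) ∣ t - t')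
    (hsmall : ∀ p ∈ (rInv (Subgroup.zpowers u)).primeFactors,
      IsSmall (Subgroup.zpowers u) n s p (t - t')) :
    ∃ e : ℕ, (∀ p ∈ (m * n).primeFactors, IsLocalExp p (m.factorization p) (n.factorization p) 0
        n s v' (t - t') e) ∧
      (setPart (nuSet (Subgroup.zpowers u)) m : ℤ) ∣ (t : ℤ) ^ e - 1 ∧
      ∀ p ∈ (rInv (Subgroup.zpowers u)).primeFactors,
        (p : ℤ) ^ m.factorization p ∣ (t : ℤ) ^ e - 1 ∨
        (epsInv (Subgroup.zpowers u) ^ (p - 1) = 1 ∧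
          (rInv (Subgroup.zpowers u)).factorization p < m.factorization p) := by
  classical
  have hloc : ∀ p : ℕ, ∃ e : ℕ, (p ∈ (m * n).primeFactors →
      IsLocalExp p (m.factorization p) (n.factorization p)
        (if p ∈ (rInv (Subgroup.zpowers u)).primeFactors then
          (oInv (Subgroup.zpowers u)).factorization p else n.factorization p)
        n s v' (t - t') e) ∧ (p ∈ (rInv (Subgroup.zpowers u)).primeFactors →
      (p ^ m.factorization p ∣ e ∨ (epsInv (Subgroup.zpowers u) ^ (p - 1) = 1 ∧
        (rInv (Subgroup.zpowers u)).factorization p < m.factorization p) ∨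
        (p = 2 ∧ epsInv (Subgroup.zpowers u) = -1 ∧ 3 ≤ n.factorization 2 ∧
          m.factorization 2 < n.factorization 2 + (rInv (Subgroup.zpowers u)).factorization 2 ∧
          2 ^ (n.factorization 2 - 1) ∣ e))) := by
    intro p
    by_cases hp : p ∈ (rInv (Subgroup.zpowers u)).primeFactors
    · obtain ⟨e, h1, h2⟩ := exists_isLocalExp_of_isSmall hm hn hs ht' hu hu' hT he hp (hr p hp)
        (hsmall p hp)
      rw [if_pos hp]
      exact ⟨e, fun _ => h1, fun _ => h2⟩
    · rw [if_neg hp]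
      refine ⟨0, fun hpmn => ?_, fun h => absurd h hp⟩
      have hpp := Nat.prime_of_mem_primeFactors hpmn
      rw [Nat.cast_zero]
      refine isLocalExp_zero ?_ ?_ ?_
      · exact_mod_cast Nat.ordProj_dvd n p
      · exact_mod_cast Nat.pow_succ_factorization_not_dvd hn.ne' hpp
      · by_cases hpm : p ∣ m
        · exact pow_dvd_pow_sub_of_mem_nuSet hm hν
            (mem_sdiff.mpr ⟨Nat.mem_primeFactors.mpr ⟨hpp, hpm, hm.ne'⟩, hp⟩)
        · rw [Nat.factorization_eq_zero_of_not_dvd hpm, pow_zero]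
          exact one_dvd _
  choose f hf1 hf2 using hloc
  obtain ⟨e, hef⟩ := exists_forall_modEq (m * n).primeFactors
    (fun p hp => Nat.prime_of_mem_primeFactors hp)
    (fun p => n.factorization p + m.factorization p) f
  have hrmn : ∀ p ∈ (rInv (Subgroup.zpowers u)).primeFactors, p ∈ (m * n).primeFactors :=
    fun p hp => Nat.primeFactors_mono ((rInv_dvd _).trans (dvd_mul_right m n))
      (Nat.mul_pos hm hn).ne' hp
  have hO : ∀ p ∈ (rInv (Subgroup.zpowers u)).primeFactors,
      (oInv (Subgroup.zpowers u)).factorization p ≤ n.factorization p := fun p hp =>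
    ((Nat.prime_of_mem_primeFactors hp).pow_dvd_iff_le_factorization hn.ne').mp
      (pow_o_dvd_n hm hu hT (Nat.prime_of_mem_primeFactors hp) (not_mem_nuSet hp))
  have hloc : ∀ p ∈ (m * n).primeFactors, IsLocalExp p (m.factorization p) (n.factorization p)
        (if p ∈ (rInv (Subgroup.zpowers u)).primeFactors then
          (oInv (Subgroup.zpowers u)).factorization p else n.factorization p)
        n s v' (t - t') e := by
    intro p hp
    refine (hf1 p hp).congr ?_ ?_
    · split_ifs with h
      · exact hO p h
      · exact le_rfl
    · have := Nat.modEq_iff_dvd.mp (hef p hp).symm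
      exact_mod_cast this
  refine ⟨e, fun p hp => (hloc p hp).mono (Nat.zero_le _), ?_, fun p hp => ?_⟩
  · have h1 : orderOf (t : ZMod (setPart (nuSet (Subgroup.zpowers u)) m)) ∣ e := by
      have hdn := orderOf_dvd_n hu hT (setPart_dvd (nuSet (Subgroup.zpowers u)) m)
      have hd0 : orderOf (t : ZMod (setPart (nuSet (Subgroup.zpowers u)) m)) ≠ 0 :=
        ne_zero_of_dvd_ne_zero hn.ne' hdn
      have : (orderOf (t : ZMod (setPart (nuSet (Subgroup.zpowers u)) m)) : ℤ) ∣ e := by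
        refine dvd_of_forall_prime hd0 fun p hp hpd => ?_
        have hpmn : p ∈ (m * n).primeFactors := Nat.mem_primeFactors.mpr
          ⟨hp, (hpd.trans hdn).mul_left m, (Nat.mul_pos hm hn).ne'⟩
        refine (pow_dvd_pow _ ?_).trans (hloc p hpmn).dvd
        split_ifs with h
        · rw [← hp.pow_dvd_iff_le_factorization (oInv_ne_zero hm _),
            pow_dvd_oInv_iff hm hu hp (not_mem_nuSet h)]
          exact Nat.ordProj_dvd _ _
        · exact (Nat.factorization_le_iff_dvd hd0 hn.ne').mpr hdn p
      exact_mod_cast this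
    rw [← ZMod.intCast_zmod_eq_zero_iff_dvd]
    push_cast
    rw [orderOf_dvd_iff_pow_eq_one.mp h1, sub_self]
  · have hmod := hef p (hrmn p hp)
    have hpt : (p : ℤ) ^ 1 ∣ t - 1 := by
      simpa using ((mem_primeFactors_rInv_iff hm hu).mp hp).2.2
    rcases hf2 p hp with h | h | ⟨rfl, h1, h2, h3, h4⟩
    · left
      have h' : p ^ m.factorization p ∣ e :=
        ((hmod.of_dvd (pow_dvd_pow _ (by omega))).dvd_iff dvd_rfl).mpr h
      exact (pow_dvd_pow _ (by omega)).trans (pow_add_dvd_pow_sub_one le_rfl hpt h')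
    · exact Or.inr h
    · left
      have h' : 2 ^ (n.factorization 2 - 1) ∣ e :=
        ((hmod.of_dvd (pow_dvd_pow _ (by omega))).dvd_iff dvd_rfl).mpr h4
      obtain ⟨c, hc⟩ := h'
      have hR2 := neg_two_le hm hu h1
      have h5 : ((2 : ℕ) : ℤ) ^ ((rInv (Subgroup.zpowers u)).factorization 2 + 1) ∣
          (t : ℤ) ^ 2 - 1 := by
        rw [show (t : ℤ) ^ 2 - 1 = (t + 1) * (t - 1) by ring, pow_succ]
        exact mul_dvd_mul (by exact_mod_cast neg_dvd hm hu h1) (by simpa using hpt)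
      have h6 := pow_add_dvd_pow_sub_one (by omega) h5 (Dvd.intro c rfl :
        2 ^ (n.factorization 2 - 2) ∣ 2 ^ (n.factorization 2 - 2) * c)
      rw [← pow_mul, ← mul_assoc, ← pow_succ', show n.factorization 2 - 2 + 1 =
        n.factorization 2 - 1 by omega, ← hc] at h6
      exact (pow_dvd_pow _ (by omega)).trans h6

theorem exists_pair_of_isSmall {G : Type*} [Group G] {a b : G} (h : IsPair m n s t a b)
    (hm : 0 < m) (hn : 0 < n) (hs : 0 < s) (hsm : s ∣ m) (ht' : t' = v' + 1)
    (hu : (u : ZMod m) = t) (hu' : (u' : ZMod m) = t')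
    (hT : IsCanonical n s (Subgroup.zpowers u)) (hT' : u' ∈ unitsSub m n s)
    (he : epsInv (Subgroup.zpowers u) = epsInv (Subgroup.zpowers u'))
    (hr : ∀ p ∈ (rInv (Subgroup.zpowers u)).primeFactors,
      (rInv (Subgroup.zpowers u)).factorization p = (rInv (Subgroup.zpowers u')).factorization p)
    (hν : (setPart (nuSet (Subgroup.zpowers u)) m : ℤ) ∣ t - t')
    (hsmall : ∀ p ∈ (rInv (Subgroup.zpowers u)).primeFactors,
      IsSmall (Subgroup.zpowers u) n s p (t - t')) :
    ∃ x y : G, IsPair m n s t' x y := by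
  classical
  obtain ⟨e, hloc, heν, her⟩ := exists_exponent hm hn hs ht' hu hu' hT.le_unitsSub he hr hν hsmall
  have hmn0 : m * n ≠ 0 := (Nat.mul_pos hm hn).ne'
  have hmem : ∀ p : ℕ, p.Prime → p ∣ m → p ∈ (m * n).primeFactors := fun p hp hpm =>
    Nat.mem_primeFactors.mpr ⟨hp, hpm.mul_right n, hmn0⟩
  have hndvd : ∀ {c : ℕ}, (∀ p ∈ (m * n).primeFactors,
      (p : ℤ) ^ n.factorization p ∣ e * c) → n ∣ e * c := fun {c} hc => by
    have : (n : ℤ) ∣ e * c := dvd_of_forall_prime hn.ne' fun p hp hpn =>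
      hc p (Nat.mem_primeFactors.mpr ⟨hp, hpn.mul_left m, hmn0⟩)
    exact_mod_cast this
  obtain ⟨w, hw⟩ := hndvd fun p hp => (hloc p hp).dvd_mul_v
  obtain ⟨w', hw'⟩ := hndvd fun p hp => (hloc p hp).dvd_mul_s
  -- at each prime, either `t ^ e - 1` vanishes or the sum of the geometric sums is divisible by `p`
  have hτ : ∀ p : ℕ, p.Prime → p ∣ m → (p : ℤ) ^ m.factorization p ∣ (t : ℤ) ^ e - 1 ∨
      ((p : ℤ) ∣ t - 1 ∧ (p = 2 → (4 : ℤ) ∣ t - 1) ∧ p ∣ v' ∧ (p = 2 → 4 ∣ v') ∧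
        s.factorization p ≤ n.factorization p) := by
    intro p hp hpm
    by_cases hpr : p ∈ (rInv (Subgroup.zpowers u)).primeFactors
    · refine (her p hpr).imp_right fun ⟨h1, h2⟩ => ?_
      have e1 := pos_dvd hm hu' hp (he ▸ h1)
      rw [← hr p hpr, ht'] at e1
      push_cast at e1
      rw [add_sub_cancel_right] at e1
      have e2 := pos_dvd hm hu hp h1
      have hR1 : 1 ≤ (rInv (Subgroup.zpowers u)).factorization p :=
        hp.factorization_pos_of_dvd (rInv_ne_zero hm _) (Nat.dvd_of_mem_primeFactors hpr)
      have hR2 : p = 2 → 2 ≤ (rInv (Subgroup.zpowers u)).factorization p := by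
        rintro rfl
        exact two_le_rInv_of_pos hm hu (by simpa using h1) (by omega)
      have e3 : p ^ (rInv (Subgroup.zpowers u)).factorization p ∣ v' := by exact_mod_cast e1
      refine ⟨(dvd_pow_self _ (by omega)).trans e2, ?_, (dvd_pow_self _ (by omega)).trans e3, ?_, ?_⟩
      · rintro rfl
        have := (pow_dvd_pow _ (hR2 rfl)).trans e2
        norm_num at this
        exact this
      · rintro rfl
        simpa using (pow_dvd_pow _ (hR2 rfl)).trans e3
      · have := (hT.pos p (mem_union_left _ hpr) h1).1
        exact (hp.pow_dvd_iff_le_factorization hn.ne').mp this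
    · exact Or.inl (pow_dvd_pow_sub_of_mem_nuSet hm heν
        (mem_sdiff.mpr ⟨Nat.mem_primeFactors.mpr ⟨hp, hpm, hm.ne'⟩, hpr⟩))
  have hτ1 : ∀ p : ℕ, p.Prime → p ∣ m → (p : ℤ) ∣ (t : ℤ) ^ e - 1 := fun p hp hpm =>
    (hτ p hp hpm).elim
      (fun h => (dvd_pow_self _ (hp.factorization_pos_of_dvd hm.ne' hpm).ne').trans h)
      fun h => dvd_pow_sub_one h.1 e
  set H : ℕ := ∑ j ∈ range v', ∑ i ∈ range j, (t ^ e) ^ i with hH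
  have hHZ : (H : ℤ) = ∑ j ∈ range v', ∑ i ∈ range j, ((t : ℤ) ^ e) ^ i := by
    rw [hH]
    push_cast
    rfl
  obtain ⟨l, hl⟩ := exists_forall_modEq m.primeFactors
    (fun p hp => Nat.prime_of_mem_primeFactors hp) (fun p => m.factorization p)
    (fun p => if (p : ℤ) ^ m.factorization p ∣ (t : ℤ) ^ e - 1 then 0
      else (p ^ m.factorization p - 1) * H)
  have hl0 : ∀ p : ℕ, p.Prime → p ∣ m → (p : ℤ) ^ m.factorization p ∣ (t : ℤ) ^ e - 1 →
      p ^ m.factorization p ∣ l := fun p hp hpm h1 => by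
    have := hl p (Nat.mem_primeFactors.mpr ⟨hp, hpm, hm.ne'⟩)
    rw [if_pos h1] at this
    exact (Nat.modEq_zero_iff_dvd).mp this
  have hl1 : ∀ p : ℕ, p.Prime → p ∣ m → ¬ (p : ℤ) ^ m.factorization p ∣ (t : ℤ) ^ e - 1 →
      p ^ m.factorization p ∣ l + H := fun p hp hpm h1 => by
    have := hl p (Nat.mem_primeFactors.mpr ⟨hp, hpm, hm.ne'⟩)
    rw [if_neg h1] at this
    refine (Nat.modEq_zero_iff_dvd).mp ((this.add_right H).trans ?_)
    rw [Nat.modEq_zero_iff_dvd]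
    refine ⟨H, ?_⟩
    have : 1 ≤ p ^ m.factorization p := Nat.one_le_pow _ _ hp.pos
    obtain ⟨c, hc⟩ := Nat.exists_eq_add_of_le this
    rw [hc, Nat.add_sub_cancel_left]
    ring
  have hlp : ∀ p : ℕ, p.Prime → p ∣ m → p ∣ l := fun p hp hpm => by
    have hp0 := (hp.factorization_pos_of_dvd hm.ne' hpm).ne'
    by_cases h1 : (p : ℤ) ^ m.factorization p ∣ (t : ℤ) ^ e - 1
    · exact (dvd_pow_self p hp0).trans (hl0 p hp hpm h1)
    · obtain ⟨-, -, h4, h5, -⟩ := (hτ p hp hpm).resolve_left h1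
      have h6 : p ∣ H := by
        have := dvd_sum_geom_sum hp (hτ1 p hp hpm) h4 h5
        rw [← hHZ] at this
        exact_mod_cast this
      exact (Nat.dvd_add_iff_left h6).mpr ((dvd_pow_self p hp0).trans (hl1 p hp hpm h1))
  subst ht'
  refine h.exists_pair hm hn hsm hu' hT' hw.symm hw'.symm ?_ hlp hτ1 ?_ ?_ ?_
  · refine dvd_add ?_ ?_
    · refine dvd_of_forall_prime hm.ne' fun p hp hpm => ?_
      obtain ⟨n', hn', hnp⟩ := exists_eq_pow_mul hn.ne' hp
      refine pow_dvd_of_pow_add_dvd_mul hp hn' hnp ?_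
      refine (hloc p (hmem p hp hpm)).rel.trans (dvd_of_eq ?_)
      have : (e : ℤ) * v' = n * w := by exact_mod_cast hw
      rw [this]
      ring
    · rw [geom_sum_sub_eq, ← hHZ, mul_comm (l : ℤ), ← mul_add]
      refine dvd_of_forall_prime hm.ne' fun p hp hpm => ?_
      by_cases h1 : (p : ℤ) ^ m.factorization p ∣ (t : ℤ) ^ e - 1
      · exact h1.mul_right _
      · refine Dvd.dvd.mul_left ?_ _
        rw [add_comm]
        exact_mod_cast hl1 p hp hpm h1
  · intro p hp hpm hd
    refine (hloc p (hmem p hp hpm)).not_dvd (hp.factorization_pos_of_dvd hm.ne' hpm).ne' ?_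
    have h1 : p ^ n.factorization p * p ∣ n * (1 + w') := mul_dvd_mul (Nat.ordProj_dvd n p) hd
    rw [← pow_succ, mul_add, mul_one, ← hw'] at h1
    exact_mod_cast h1
  · intro p hp hpm
    by_cases h1 : (p : ℤ) ^ m.factorization p ∣ (t : ℤ) ^ e - 1
    · refine ((pow_dvd_pow _ (min_le_right _ _)).trans ?_).mul_right _
      exact_mod_cast hl0 p hp hpm h1
    · obtain ⟨h2, -, -, -, h5⟩ := (hτ p hp hpm).resolve_left h1
      refine (pow_dvd_pow _ (min_le_left _ _)).trans ?_
      rw [pow_succ']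
      refine mul_dvd_mul (by exact_mod_cast hlp p hp hpm) (pow_dvd_geom_sum h2 ?_)
      exact (pow_dvd_pow p h5).trans (Nat.ordProj_dvd n p)
  · intro p hp hpm
    rcases hτ p hp hpm with h1 | ⟨h2, h3, -⟩
    · exact (pow_dvd_pow _ (min_le_right _ _)).trans (dvd_geom_sum_sub h1 s)
    · refine (pow_dvd_pow _ (min_le_left _ _)).trans ?_
      exact pow_succ_dvd_geom_sum_sub hp (dvd_pow_sub_one h2 e)
        (fun h => dvd_pow_sub_one (h3 h) e) (Nat.ordProj_dvd s p)

end Exponent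

end Metacyclic

namespace Metacyclic

open Finset

theorem pow_dvd_pow_sub_pow_of_modEq {p M k k' : ℕ} {x : ℤ} (h : (p : ℤ) ∣ x - 1)
    (hk : k ≡ k' [MOD p ^ M]) : (p : ℤ) ^ M ∣ x ^ k - x ^ k' := by
  wlog hle : k' ≤ k generalizing k k'
  · rw [dvd_sub_comm]
    exact this hk.symm (le_of_not_ge hle)
  obtain ⟨c, rfl⟩ := Nat.exists_eq_add_of_le hle
  have hc : p ^ M ∣ c := (Nat.modEq_iff_dvd' hle).mp hk.symm |>.trans (by simp)
  rw [show x ^ (k' + c) - x ^ k' = x ^ k' * (x ^ c - 1) by ring]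
  refine Dvd.dvd.mul_left ?_ _
  exact (pow_dvd_pow _ (by omega)).trans (pow_add_dvd_pow_sub_one le_rfl (by simpa using h) hc)

theorem zpowers_pow_eq {G : Type*} [Group G] {g : G} {N K : ℕ} (hN : g ^ N = 1)
    (hK : Nat.Coprime K N) : Subgroup.zpowers (g ^ K) = Subgroup.zpowers g := by
  apply le_antisymm
  · exact Subgroup.zpowers_le.mpr (Subgroup.pow_mem _ (Subgroup.mem_zpowers g) K)
  · exact Subgroup.zpowers_le.mpr (mem_of_pow_mem hN hK (Subgroup.mem_zpowers _))

section BracketToPair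

variable {m n s t t' : ℕ} {u u' : (ZMod m)ˣ}

theorem exists_pair_of_bracket_dvd_sub {G : Type*} [Group G] {a b : G} (h : IsPair m n s t a b)
    (hm : 0 < m) (hn : 0 < n) (hs : 0 < s) (hsm : s ∣ m) (ht' : 1 ≤ t')
    (hu : (u : ZMod m) = t) (hu' : (u' : ZMod m) = t')
    (hT : IsCanonical n s (Subgroup.zpowers u)) (hT' : u' ∈ unitsSub m n s)
    (he : epsInv (Subgroup.zpowers u) = epsInv (Subgroup.zpowers u'))
    (hr : ∀ p ∈ (rInv (Subgroup.zpowers u)).primeFactors,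
      (rInv (Subgroup.zpowers u)).factorization p = (rInv (Subgroup.zpowers u')).factorization p)
    (hb : (bracket (Subgroup.zpowers u) n s : ℤ) ∣ t - t') :
    ∃ x y : G, IsPair m n s t' x y := by
  classical
  have hex : ∀ p : ℕ, ∃ k : ℕ, (p.Prime → ¬ p ∣ k) ∧
      (p ∈ (rInv (Subgroup.zpowers u)).primeFactors →
        k ≡ 1 [MOD p ^ (oInv (Subgroup.zpowers u)).factorization p] ∧
        IsSmall (Subgroup.zpowers u) n s p ((t : ℤ) ^ k - t')) ∧
      (p ∉ (rInv (Subgroup.zpowers u)).primeFactors → k = 1) := by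
    intro p
    by_cases hp : p ∈ (rInv (Subgroup.zpowers u)).primeFactors
    · obtain ⟨k, h1, h2, h3⟩ := exists_isSmall_pow hm hu hu' hT he hp (hr p hp)
        (Dvd.dvd.trans (by exact_mod_cast localPart_dvd_bracket hp) hb)
      exact ⟨k, fun _ => h2, fun _ => ⟨h1, h3⟩, fun h => absurd hp h⟩
    · exact ⟨1, fun h => h.one_lt.ne' ∘ Nat.dvd_one.mp, fun h => absurd h hp, fun _ => rfl⟩
  choose f hf1 hf2 hf3 using hex
  obtain ⟨K, hK⟩ := exists_forall_modEq (m * n).primeFactors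
    (fun p hp => Nat.prime_of_mem_primeFactors hp)
    (fun p => n.factorization p + m.factorization p + 1) f
  have hmn0 : m * n ≠ 0 := (Nat.mul_pos hm hn).ne'
  have hco : Nat.Coprime K (m * n) := by
    refine Nat.coprime_of_dvd fun p hp hpK hpmn => hf1 p hp ?_
    have := hK p (Nat.mem_primeFactors.mpr ⟨hp, hpmn, hmn0⟩)
    exact ((this.of_dvd (dvd_pow_self p (Nat.succ_ne_zero _))).dvd_iff dvd_rfl).mp hpK
  have hun : u ^ n = 1 := (hT.le_unitsSub (Subgroup.mem_zpowers u)).2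
  have hz : Subgroup.zpowers (u ^ K) = Subgroup.zpowers u :=
    zpowers_pow_eq hun hco.coprime_mul_left_right
  have huK : ((u ^ K : (ZMod m)ˣ) : ZMod m) = ((t ^ K : ℕ) : ZMod m) := by
    rw [Units.val_pow_eq_pow_val, hu, Nat.cast_pow]
  obtain ⟨v', hv'⟩ := Nat.exists_eq_add_of_le' ht'
  refine exists_pair_of_isSmall (h.pow hm hco) hm hn hs hsm hv' huK hu' ?_ hT' ?_ ?_ ?_ ?_ <;>
    rw [hz]
  · exact hT
  · exact he
  · exact hr
  · have hνb : (setPart (nuSet (Subgroup.zpowers u)) m : ℤ) ∣ t - t' :=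
      Dvd.dvd.trans (by exact_mod_cast dvd_mul_right _ _) hb
    have hdn := orderOf_dvd_n hu hT.le_unitsSub (setPart_dvd (nuSet (Subgroup.zpowers u)) m)
    have hd0 : orderOf (t : ZMod (setPart (nuSet (Subgroup.zpowers u)) m)) ≠ 0 :=
      ne_zero_of_dvd_ne_zero hn.ne' hdn
    have h1 : K ≡ 1 [MOD orderOf (t : ZMod (setPart (nuSet (Subgroup.zpowers u)) m))] := by
      rw [Nat.ModEq.comm, Nat.modEq_iff_dvd]
      refine dvd_of_forall_prime hd0 fun p hp hpd => ?_
      have hpmn : p ∈ (m * n).primeFactors := Nat.mem_primeFactors.mpr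
        ⟨hp, (hpd.trans hdn).mul_left m, hmn0⟩
      have hle := (Nat.factorization_le_iff_dvd hd0 hn.ne').mpr hdn p
      have h2 := (hK p hpmn).of_dvd (pow_dvd_pow p
        (show (orderOf (t : ZMod (setPart (nuSet (Subgroup.zpowers u)) m))).factorization p ≤ _ by
          omega))
      have h3 : K ≡ 1 [MOD p ^ (orderOf
          (t : ZMod (setPart (nuSet (Subgroup.zpowers u)) m))).factorization p] := by
        refine h2.trans ?_
        by_cases hpr : p ∈ (rInv (Subgroup.zpowers u)).primeFactors
        · refine (hf2 p hpr).1.of_dvd (pow_dvd_pow p ?_)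
          rw [← hp.pow_dvd_iff_le_factorization (oInv_ne_zero hm _),
            pow_dvd_oInv_iff hm hu hp (not_mem_nuSet hpr)]
          exact Nat.ordProj_dvd _ _
        · rw [hf3 p hpr]
      exact_mod_cast Nat.modEq_iff_dvd.mp h3.symm
    rw [← ZMod.intCast_zmod_eq_zero_iff_dvd] at hνb ⊢
    push_cast at hνb ⊢
    rw [← hνb, ← pow_mod_orderOf, h1, pow_mod_orderOf, pow_one]
  · intro p hp
    obtain ⟨hpp, hpm, hpt⟩ := (mem_primeFactors_rInv_iff hm hu).mp hp
    refine (hf2 p hp).2.congr ?_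
    have h2 := (hK p (Nat.mem_primeFactors.mpr ⟨hpp, hpm.mul_right n, hmn0⟩)).of_dvd
      (pow_dvd_pow p (show m.factorization p ≤ _ by omega))
    refine (pow_dvd_pow_sub_pow_of_modEq hpt h2).trans (dvd_of_eq ?_)
    push_cast
    ring

theorem exists_dvd_pow_sub_of_res_eq {q : ℕ} (hm : 0 < m) (hq : q ∣ m) (hu : (u : ZMod m) = t)
    (hu' : (u' : ZMod m) = t')
    (h : res hq (Subgroup.zpowers u) = res hq (Subgroup.zpowers u')) {N : ℕ} (hN : N ≠ 0) :
    ∃ K : ℕ, Nat.Coprime K N ∧ (q : ℤ) ∣ (t : ℤ) ^ K - t' := by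
  have : NeZero q := ⟨ne_zero_of_dvd_ne_zero hm.ne' hq⟩
  rw [res_zpowers, res_zpowers] at h
  obtain ⟨K, hK, hK'⟩ := exists_coprime_pow_eq (isOfFinOrder_of_finite _) h hN
  refine ⟨K, hK, ?_⟩
  have h1 := congrArg Units.val hK'
  rw [Units.val_pow_eq_pow_val, unitsMap_coe hu, unitsMap_coe hu'] at h1
  rw [← ZMod.intCast_zmod_eq_zero_iff_dvd]
  push_cast
  rw [h1, sub_self]

theorem exists_pair_of_res_eq {G : Type*} [Group G] {a b : G} (h : IsPair m n s t a b)
    (hm : 0 < m) (hn : 0 < n) (hs : 0 < s) (hsm : s ∣ m) (ht' : 1 ≤ t')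
    (hu : (u : ZMod m) = t) (hu' : (u' : ZMod m) = t')
    (hT : IsCanonical n s (Subgroup.zpowers u)) (hT' : u' ∈ unitsSub m n s)
    (hb : bracket (Subgroup.zpowers u) n s = bracket (Subgroup.zpowers u') n s)
    (hres : res (bracket_dvd (Subgroup.zpowers u) n s) (Subgroup.zpowers u) =
      res (bracket_dvd (Subgroup.zpowers u) n s) (Subgroup.zpowers u')) :
    ∃ x y : G, IsPair m n s t' x y := by
  obtain ⟨K, hK, hKd⟩ := exists_dvd_pow_sub_of_res_eq hm _ hu hu' hres (Nat.mul_pos hm hn).ne'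
  obtain ⟨K', -, hKd'⟩ := exists_dvd_pow_sub_of_res_eq hm _ hu' hu hres.symm one_ne_zero
  obtain ⟨-, -, he, hro⟩ := invariants_eq_of_bracket hm hu hu' hb hKd hKd'
  have hun : u ^ n = 1 := (hT.le_unitsSub (Subgroup.mem_zpowers u)).2
  have hz : Subgroup.zpowers (u ^ K) = Subgroup.zpowers u :=
    zpowers_pow_eq hun hK.coprime_mul_left_right
  have huK : ((u ^ K : (ZMod m)ˣ) : ZMod m) = ((t ^ K : ℕ) : ZMod m) := by
    rw [Units.val_pow_eq_pow_val, hu, Nat.cast_pow]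
  refine exists_pair_of_bracket_dvd_sub (h.pow hm hK) hm hn hs hsm ht' huK hu' ?_ hT' ?_ ?_ ?_ <;>
    rw [hz]
  · exact hT
  · exact he
  · exact fun p hp => (hro p hp).1
  · exact_mod_cast hKd

end BracketToPair

end Metacyclic

namespace Metacyclic

open Finset

section HallParts

variable {m n s t t' : ℕ} {u u' : (ZMod m)ˣ}

theorem res_hallPart_eq (hm : 0 < m) {d q : ℕ} (hdq : d ∣ q) (hqm : q ∣ m) (hdm : d ∣ m)
    {T T' : Subgroup (ZMod m)ˣ} (h : res hqm T = res hqm T') (μ : Set ℕ) :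
    res hdm (hallPart μ T) = res hdm (hallPart μ T') := by
  have : NeZero m := ⟨hm.ne'⟩
  have key : ∀ S : Subgroup (ZMod m)ˣ, res hdm S = res hdq (res hqm S) := fun S => by
    unfold res
    rw [Subgroup.map_map, ZMod.unitsMap_comp]
  have hmap : ∀ S : Subgroup (ZMod m)ˣ, res hdm (hallPart μ S) = hallPart μ (res hdm S) :=
    fun S => map_hallPart _ _ _
  rw [hmap, hmap, key T, key T', h]

theorem map_le_of_prime_pow {G H : Type*} [CommGroup G] [Finite G] [CommGroup H] (f : G →* H)
    {T : Subgroup G} {W : Subgroup H}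
    (h : ∀ p : ℕ, p.Prime → ∀ x ∈ T, (∃ k, orderOf x = p ^ k) → f x ∈ W) : T.map f ≤ W := by
  rintro _ ⟨x, hx, rfl⟩
  rw [← QuotientGroup.eq_one_iff, ← orderOf_eq_one_iff]
  by_contra hne
  obtain ⟨p, hp, hpd⟩ := Nat.exists_prime_and_dvd hne
  have hx0 := (orderOf_pos x).ne'
  have h1 := h p hp (x ^ (orderOf x / p ^ (orderOf x).factorization p)) (T.pow_mem hx _)
    ⟨(orderOf x).factorization p, by
      rw [orderOf_pow_of_dvd (Nat.div_pos (Nat.ordProj_le p hx0) (Nat.ordProj_pos _ p)).ne'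
        (Nat.ordCompl_dvd _ p), Nat.div_div_self (Nat.ordProj_dvd _ p) hx0]⟩
  rw [map_pow, ← QuotientGroup.eq_one_iff, QuotientGroup.mk_pow, ← orderOf_dvd_iff_pow_eq_one] at h1
  exact Nat.not_dvd_ordCompl hp hx0 (hpd.trans h1)

theorem unitsMap_eq_iff {d : ℕ} (hd : d ∣ m) (hu : (u : ZMod m) = t) (hu' : (u' : ZMod m) = t') :
    ZMod.unitsMap hd u = ZMod.unitsMap hd u' ↔ (d : ℤ) ∣ t - t' := by
  rw [Units.ext_iff, unitsMap_coe hu, unitsMap_coe hu', ← ZMod.intCast_zmod_eq_zero_iff_dvd]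
  push_cast
  rw [sub_eq_zero]

theorem pow_dvd_sub_one_of_not_dvd_orderOf (hu : (u : ZMod m) = t) {p : ℕ} (hp : p.Prime)
    (ht : (p : ℤ) ∣ t - 1) (ho : ¬ p ∣ orderOf u) : (p : ℤ) ^ m.factorization p ∣ t - 1 := by
  have h1 : (m : ℤ) ∣ (t : ℤ) ^ orderOf u - 1 := by
    rw [← ZMod.intCast_zmod_eq_zero_iff_dvd]
    push_cast
    rw [← hu, ← Units.val_pow_eq_pow_val, pow_orderOf_eq_one, Units.val_one, sub_self]
  have h2 : (p : ℤ) ^ m.factorization p ∣ (t : ℤ) ^ orderOf u - 1 :=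
    Dvd.dvd.trans (by exact_mod_cast Nat.ordProj_dvd m p) h1
  rw [← mul_geom_sum] at h2
  refine (Nat.prime_iff_prime_int.mp hp).pow_dvd_of_dvd_mul_right _ (fun h3 => ho ?_) h2
  have := dvd_sub h3 (dvd_geom_sum_sub ht (orderOf u))
  rw [sub_sub_cancel] at this
  exact_mod_cast this

theorem primeFactors_rInv_eq_inter (hm : 0 < m) (T : Subgroup (ZMod m)ˣ) (n : ℕ) :
    (rInv T).primeFactors = piSet T n ∩ m.primeFactors := by
  ext p
  have h1 : p ∈ (rInv T).primeFactors → p ∈ m.primeFactors := fun h =>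
    Nat.primeFactors_mono (rInv_dvd T) hm.ne' h
  rw [piSet, mem_inter, mem_union, mem_sdiff]
  tauto

theorem mem_nuSet_of_not_mem_piSet (hm : 0 < m) {T : Subgroup (ZMod m)ˣ} {p : ℕ} (hp : p.Prime)
    (hpm : p ∣ m) (h : p ∉ piSet T n) : p ∈ nuSet T :=
  mem_sdiff.mpr ⟨Nat.mem_primeFactors.mpr ⟨hp, hpm, hm.ne'⟩, fun h' => h (mem_union_left _ h')⟩

theorem setPart_dvd_bracket (hm : 0 < m) (T : Subgroup (ZMod m)ˣ) :
    setPart ((piSet T n : Set ℕ)ᶜ) m ∣ bracket T n s := by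
  have : (setPart ((piSet T n : Set ℕ)ᶜ) m : ℤ) ∣ bracket T n s := by
    refine setPart_dvd_of fun p hp hpm h => ?_
    exact_mod_cast pPart_dvd_bracket hm (mem_nuSet_of_not_mem_piSet hm hp hpm
      (by simpa using h))
  exact_mod_cast this

theorem mixed_dvd_bracket (hm : 0 < m) (T : Subgroup (ZMod m)ˣ) {p : ℕ} (hp : p.Prime)
    (hpπ : p ∈ piSet T n) :
    setPart ((piSet T n : Set ℕ)ᶜ) m * pPart p (bracket T n s) ∣ bracket T n s :=
  Nat.Coprime.mul_dvd_of_dvd_of_dvd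
    (Nat.Coprime.pow_right _ (setPart_coprime m hp fun h => h hpπ))
    (setPart_dvd_bracket hm T) (pPart_dvd _ _)

theorem prime_of_mem_piSet {T : Subgroup (ZMod m)ˣ} {p : ℕ} (hp : p ∈ piSet T n) : p.Prime := by
  rcases mem_union.mp hp with h | h
  · exact Nat.prime_of_mem_primeFactors h
  · exact Nat.prime_of_mem_primeFactors (mem_sdiff.mp h).1

theorem bracket_ne_zero (hm : 0 < m) (T : Subgroup (ZMod m)ˣ) : bracket T n s ≠ 0 :=
  ne_zero_of_dvd_ne_zero hm.ne' (bracket_dvd T n s)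

theorem factorization_bracket_of_mem_nuSet (hm : 0 < m) {T : Subgroup (ZMod m)ˣ} {p : ℕ}
    (hp : p ∈ nuSet T) : (bracket T n s).factorization p = m.factorization p := by
  have hpp := Nat.prime_of_mem_primeFactors (mem_sdiff.mp hp).1
  have h0 := bracket_ne_zero (n := n) (s := s) hm T
  refine le_antisymm ((Nat.factorization_le_iff_dvd h0 hm.ne').mpr (bracket_dvd T n s) p) ?_
  exact (hpp.pow_dvd_iff_le_factorization h0).mp (pPart_dvd_bracket hm hp)

theorem bracket_eq_of_pPart_eq (hm : 0 < m) {T T' : Subgroup (ZMod m)ˣ}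
    (hπ : piSet T n = piSet T' n)
    (h : ∀ p ∈ piSet T n, pPart p (bracket T n s) = pPart p (bracket T' n s)) :
    bracket T n s = bracket T' n s := by
  refine Nat.eq_of_factorization_eq (bracket_ne_zero hm T) (bracket_ne_zero hm T') fun p => ?_
  by_cases hp : p.Prime
  · by_cases hpπ : p ∈ piSet T n
    · exact Nat.pow_right_injective hp.two_le (h p hpπ)
    · by_cases hpm : p ∣ m
      · rw [factorization_bracket_of_mem_nuSet hm (mem_nuSet_of_not_mem_piSet hm hp hpm hpπ),
          factorization_bracket_of_mem_nuSet hm (mem_nuSet_of_not_mem_piSet hm hp hpm (hπ ▸ hpπ))]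
      · rw [Nat.factorization_eq_zero_of_not_dvd fun h => hpm (h.trans (bracket_dvd T n s)),
          Nat.factorization_eq_zero_of_not_dvd fun h => hpm (h.trans (bracket_dvd T' n s))]
  · rw [Nat.factorization_eq_zero_of_not_prime _ hp, Nat.factorization_eq_zero_of_not_prime _ hp]

theorem unitsMap_eq_of_local (hm : 0 < m) {T : Subgroup (ZMod m)ˣ}
    {x y : (ZMod m)ˣ} (hxy : ∀ p ∈ piSet T n, ∀ h : p ∣ m,
      ZMod.unitsMap h x = 1 ∧ ZMod.unitsMap h y = 1)
    {d : ℕ} (hd : d ∣ m) (hsd : setPart ((piSet T n : Set ℕ)ᶜ) m ∣ d)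
    (h : ZMod.unitsMap hd x = ZMod.unitsMap hd y)
    (hpx : ∀ p ∈ piSet T n, p ∣ orderOf x → pPart p (bracket T n s) ∣ d)
    (hpy : ∀ p ∈ piSet T n, p ∣ orderOf y → pPart p (bracket T n s) ∣ d) :
    ZMod.unitsMap (bracket_dvd T n s) x = ZMod.unitsMap (bracket_dvd T n s) y := by
  have : NeZero m := ⟨hm.ne'⟩
  have hx : (x : ZMod m) = ((x : ZMod m).val : ℕ) := (ZMod.natCast_zmod_val _).symm
  have hy : (y : ZMod m) = ((y : ZMod m).val : ℕ) := (ZMod.natCast_zmod_val _).symm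
  rw [unitsMap_eq_iff hd hx hy] at h
  rw [unitsMap_eq_iff _ hx hy]
  refine dvd_of_forall_prime (bracket_ne_zero hm T) fun p hp hpb => ?_
  have hpm := hpb.trans (bracket_dvd T n s)
  by_cases hpπ : p ∈ piSet T n
  · by_cases hdiv : pPart p (bracket T n s) ∣ d
    · refine Dvd.dvd.trans ?_ h
      exact_mod_cast hdiv
    · have hle := (Nat.factorization_le_iff_dvd (bracket_ne_zero hm T) hm.ne').mpr
        (bracket_dvd T n s) p
      obtain ⟨e1, e2⟩ := hxy p hpπ hpm
      rw [Units.ext_iff, unitsMap_coe hx, Units.val_one, natCast_eq_one_iff] at e1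
      rw [Units.ext_iff, unitsMap_coe hy, Units.val_one, natCast_eq_one_iff] at e2
      have h1 := pow_dvd_sub_one_of_not_dvd_orderOf hx hp e1 fun h' => hdiv (hpx p hpπ h')
      have h2 := pow_dvd_sub_one_of_not_dvd_orderOf hy hp e2 fun h' => hdiv (hpy p hpπ h')
      have h3 := dvd_sub h1 h2
      rw [sub_sub_sub_cancel_right] at h3
      exact (pow_dvd_pow _ hle).trans h3
  · rw [factorization_bracket_of_mem_nuSet hm (mem_nuSet_of_not_mem_piSet hm hp hpm hpπ)]
    refine Dvd.dvd.trans ?_ h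
    have := (pPart_dvd_setPart (μ := ((piSet T n : Set ℕ)ᶜ)) hm hp hpm (by simpa using hpπ)).trans
      hsd
    exact_mod_cast this

theorem unitsMap_eq_one_of_mem (hm : 0 < m) (hu : (u : ZMod m) = t) {p : ℕ} (hpm : p ∣ m)
    (hpπ : p ∈ piSet (Subgroup.zpowers u) n) {x : (ZMod m)ˣ} (hx : x ∈ Subgroup.zpowers u) :
    ZMod.unitsMap hpm x = 1 := by
  have hp := prime_of_mem_piSet hpπ
  have hpr : p ∈ (rInv (Subgroup.zpowers u)).primeFactors := by
    rw [primeFactors_rInv_eq_inter hm _ n]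
    exact mem_inter.mpr ⟨hpπ, Nat.mem_primeFactors.mpr ⟨hp, hpm, hm.ne'⟩⟩
  have h1 := (res_eq_bot_iff hu hpm).mpr ((mem_primeFactors_rInv_iff hm hu).mp hpr).2.2
  rw [← Subgroup.mem_bot, ← h1]
  exact Subgroup.mem_map_of_mem _ hx

theorem res_le_of_local (hm : 0 < m) (hu : (u : ZMod m) = t) (hu' : (u' : ZMod m) = t')
    (hπ : piSet (Subgroup.zpowers u) n = piSet (Subgroup.zpowers u') n)
    (h1 : res (setPart_dvd ((piSet (Subgroup.zpowers u) n : Set ℕ)ᶜ) m)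
        (hallPart ((piSet (Subgroup.zpowers u) n : Set ℕ)ᶜ) (Subgroup.zpowers u)) ≤
      res (setPart_dvd ((piSet (Subgroup.zpowers u) n : Set ℕ)ᶜ) m)
        (hallPart ((piSet (Subgroup.zpowers u) n : Set ℕ)ᶜ) (Subgroup.zpowers u')))
    (h2 : ∀ (p : ℕ) (hp : p ∈ piSet (Subgroup.zpowers u) n),
      res (mixed_dvd (Subgroup.zpowers u) n s hp) (hallPart {p} (Subgroup.zpowers u)) ≤
        res (mixed_dvd (Subgroup.zpowers u) n s hp) (hallPart {p} (Subgroup.zpowers u'))) :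
    res (bracket_dvd (Subgroup.zpowers u) n s) (Subgroup.zpowers u) ≤
      res (bracket_dvd (Subgroup.zpowers u) n s) (Subgroup.zpowers u') := by
  have : NeZero m := ⟨hm.ne'⟩
  refine map_le_of_prime_pow _ fun p hp x hx ⟨k, hk⟩ => ?_
  have hxp : ∀ q : ℕ, q.Prime → q ∣ orderOf x → q = p := fun q hq hqx =>
    (Nat.prime_dvd_prime_iff_eq hq hp).mp (hq.dvd_of_dvd_pow (hk ▸ hqx))
  by_cases hpπ : p ∈ piSet (Subgroup.zpowers u) n
  · obtain ⟨y, hy, hyx⟩ := h2 p hpπ (Subgroup.mem_map_of_mem _ (show x ∈ hallPart {p} _ from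
      ⟨hx, hxp⟩))
    refine ⟨y, hy.1, (unitsMap_eq_of_local hm ?_ (mixed_dvd _ n s hpπ) (dvd_mul_right _ _)
      hyx.symm ?_ ?_).symm⟩
    · exact fun q hq h => ⟨unitsMap_eq_one_of_mem hm hu h hq hx,
        unitsMap_eq_one_of_mem hm hu' h (hπ ▸ hq) hy.1⟩
    · intro q hq hqx
      rw [hxp q (prime_of_mem_piSet hq) hqx]
      exact dvd_mul_left _ _
    · intro q hq hqy
      rw [Set.mem_singleton_iff.mp (hy.2 q (prime_of_mem_piSet hq) hqy)]
      exact dvd_mul_left _ _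
  · obtain ⟨y, hy, hyx⟩ := h1 (Subgroup.mem_map_of_mem _ (show x ∈ hallPart _ _ from
      ⟨hx, fun q hq hqx => by rw [hxp q hq hqx]; simpa using hpπ⟩))
    refine ⟨y, hy.1, (unitsMap_eq_of_local hm ?_ (setPart_dvd _ m) dvd_rfl
      hyx.symm ?_ ?_).symm⟩
    · exact fun q hq h => ⟨unitsMap_eq_one_of_mem hm hu h hq hx,
        unitsMap_eq_one_of_mem hm hu' h (hπ ▸ hq) hy.1⟩
    · intro q hq hqx
      rw [hxp q (prime_of_mem_piSet hq) hqx] at hq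
      exact absurd hq hpπ
    · intro q hq hqy
      exact absurd hq (by simpa using hy.2 q (prime_of_mem_piSet hq) hqy)

theorem res_congr {q q' : ℕ} (h : q = q') (hq : q ∣ m) (hq' : q' ∣ m) {T T' : Subgroup (ZMod m)ˣ} :
    ((⟨q, res hq T⟩ : Σ q : ℕ, Subgroup (ZMod q)ˣ) = ⟨q', res hq' T'⟩) ↔
      res hq T = res hq T' := by
  subst h
  simp

end HallParts

end Metacyclic

namespace Metacyclic

section Equivalences

variable {m n s t t' : ℕ} {u u' : (ZMod m)ˣ}

theorem res_le_of_dvd_pow_sub {q K : ℕ} (hq : q ∣ m) (hu : (u : ZMod m) = t)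
    (hu' : (u' : ZMod m) = t') (h : (q : ℤ) ∣ (t : ℤ) ^ K - t') :
    res hq (Subgroup.zpowers u') ≤ res hq (Subgroup.zpowers u) := by
  rw [res_zpowers, res_zpowers, Subgroup.zpowers_le]
  have h1 : ZMod.unitsMap hq u ^ K = ZMod.unitsMap hq u' := by
    rw [Units.ext_iff, Units.val_pow_eq_pow_val, unitsMap_coe hu, unitsMap_coe hu', ← sub_eq_zero]
    rw [← ZMod.intCast_zmod_eq_zero_iff_dvd] at h
    exact_mod_cast h
  rw [← h1]
  exact Subgroup.pow_mem _ (Subgroup.mem_zpowers _) K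

theorem res_eq_of_pairs {G : Type*} [Group G] {a b x y : G}
    (h : IsPair m n s t a b) (h' : IsPair m n s t' x y) (hm : 0 < m)
    (hn : 0 < n) (hs : 0 < s) (hsm : s ∣ m) (ht : 1 ≤ t) (ht' : 1 ≤ t')
    (hu : (u : ZMod m) = t) (hu' : (u' : ZMod m) = t')
    (hT : IsCanonical n s (Subgroup.zpowers u)) (hT' : IsCanonical n s (Subgroup.zpowers u')) :
    bracket (Subgroup.zpowers u) n s = bracket (Subgroup.zpowers u') n s ∧
      res (bracket_dvd (Subgroup.zpowers u) n s) (Subgroup.zpowers u) =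
        res (bracket_dvd (Subgroup.zpowers u) n s) (Subgroup.zpowers u') := by
  obtain ⟨v, hv⟩ := Nat.exists_eq_add_of_le' ht
  obtain ⟨v', hv'⟩ := Nat.exists_eq_add_of_le' ht'
  obtain ⟨hb, ⟨K, hK⟩, K', hK'⟩ := bracket_eq_of_pairs h h' hm hn hs hsm hv hv' hu hu' hT hT'
  exact ⟨hb, le_antisymm (res_le_of_dvd_pow_sub _ hu' hu (hb ▸ hK'))
    (res_le_of_dvd_pow_sub _ hu hu' hK)⟩

theorem local_of_res_eq (hm : 0 < m) (hu : (u : ZMod m) = t) (hu' : (u' : ZMod m) = t')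
    (hb : bracket (Subgroup.zpowers u) n s = bracket (Subgroup.zpowers u') n s)
    (hres : res (bracket_dvd (Subgroup.zpowers u) n s) (Subgroup.zpowers u) =
      res (bracket_dvd (Subgroup.zpowers u) n s) (Subgroup.zpowers u')) :
    piSet (Subgroup.zpowers u) n = piSet (Subgroup.zpowers u') n ∧
      res (setPart_dvd ((piSet (Subgroup.zpowers u) n : Set ℕ)ᶜ) m)
          (hallPart ((piSet (Subgroup.zpowers u) n : Set ℕ)ᶜ) (Subgroup.zpowers u)) =
        res (setPart_dvd ((piSet (Subgroup.zpowers u) n : Set ℕ)ᶜ) m)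
          (hallPart ((piSet (Subgroup.zpowers u) n : Set ℕ)ᶜ) (Subgroup.zpowers u')) ∧
      ∀ (p : ℕ) (hp : p ∈ piSet (Subgroup.zpowers u) n),
        pPart p (bracket (Subgroup.zpowers u) n s) = pPart p (bracket (Subgroup.zpowers u') n s) ∧
          res (mixed_dvd (Subgroup.zpowers u) n s hp) (hallPart {p} (Subgroup.zpowers u)) =
            res (mixed_dvd (Subgroup.zpowers u) n s hp) (hallPart {p} (Subgroup.zpowers u')) := by
  obtain ⟨K, -, hK⟩ := exists_dvd_pow_sub_of_res_eq hm _ hu hu' hres one_ne_zero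
  obtain ⟨K', -, hK'⟩ := exists_dvd_pow_sub_of_res_eq hm _ hu' hu hres.symm one_ne_zero
  obtain ⟨-, hr, -, -⟩ := invariants_eq_of_bracket hm hu hu' hb hK hK'
  refine ⟨by rw [piSet, hr, piSet], res_hallPart_eq hm (setPart_dvd_bracket hm _) _ _ hres _,
    fun p hp => ⟨by rw [hb], ?_⟩⟩
  exact res_hallPart_eq hm (mixed_dvd_bracket hm _ (prime_of_mem_piSet hp) hp) _ _ hres _

theorem res_eq_of_local (hm : 0 < m) (hu : (u : ZMod m) = t) (hu' : (u' : ZMod m) = t')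
    (hπ : piSet (Subgroup.zpowers u) n = piSet (Subgroup.zpowers u') n)
    (h1 : res (setPart_dvd ((piSet (Subgroup.zpowers u) n : Set ℕ)ᶜ) m)
        (hallPart ((piSet (Subgroup.zpowers u) n : Set ℕ)ᶜ) (Subgroup.zpowers u)) =
      res (setPart_dvd ((piSet (Subgroup.zpowers u) n : Set ℕ)ᶜ) m)
        (hallPart ((piSet (Subgroup.zpowers u) n : Set ℕ)ᶜ) (Subgroup.zpowers u')))
    (h2 : ∀ (p : ℕ) (hp : p ∈ piSet (Subgroup.zpowers u) n),
      pPart p (bracket (Subgroup.zpowers u) n s) = pPart p (bracket (Subgroup.zpowers u') n s) ∧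
        res (mixed_dvd (Subgroup.zpowers u) n s hp) (hallPart {p} (Subgroup.zpowers u)) =
          res (mixed_dvd (Subgroup.zpowers u) n s hp) (hallPart {p} (Subgroup.zpowers u'))) :
    bracket (Subgroup.zpowers u) n s = bracket (Subgroup.zpowers u') n s ∧
      res (bracket_dvd (Subgroup.zpowers u) n s) (Subgroup.zpowers u) =
        res (bracket_dvd (Subgroup.zpowers u) n s) (Subgroup.zpowers u') := by
  have hb := bracket_eq_of_pPart_eq hm hπ fun p hp => (h2 p hp).1
  have hcongr : ∀ {q q' : ℕ} (_ : q = q') (hq : q ∣ m) (hq' : q' ∣ m) (A B : Subgroup (ZMod m)ˣ),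
      res hq A ≤ res hq B → res hq' A ≤ res hq' B := by
    intro q q' h
    subst h
    exact fun _ _ _ _ h => h
  refine ⟨hb, le_antisymm (res_le_of_local hm hu hu' hπ h1.le fun p hp => (h2 p hp).2.le) ?_⟩
  refine hcongr hb.symm (bracket_dvd _ n s) _ _ _ (res_le_of_local hm hu' hu hπ.symm ?_ ?_)
  · rw [← hπ]
    exact h1.ge
  · intro p hp
    refine hcongr ?_ _ _ _ _ (h2 p (hπ ▸ hp)).2.ge
    rw [hπ, hb]

end Equivalences

end Metacyclic

theorem mainTheorem4 (m n s : ℕ) (hm : 0 < m) (hn : 0 < n) (hs : 0 < s) (hsm : s ∣ m)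
    (T Tbar : Subgroup (ZMod m)ˣ)
    (hT : Metacyclic.IsCanonical n s T) (hTbar : Metacyclic.IsCanonical n s Tbar)
    (t tbar : ℤ)
    (ht : Metacyclic.IsGeneratedBy T t) (htbar : Metacyclic.IsGeneratedBy Tbar tbar) :
    List.TFAE [
      Nonempty (Metacyclic.MetacyclicGroup m n s t ≃* Metacyclic.MetacyclicGroup m n s tbar),
      (⟨Metacyclic.bracket T n s, Metacyclic.res (Metacyclic.bracket_dvd T n s) T⟩ :
          Σ q : ℕ, Subgroup (ZMod q)ˣ) =
        ⟨Metacyclic.bracket Tbar n s, Metacyclic.res (Metacyclic.bracket_dvd Tbar n s) Tbar⟩,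
      Metacyclic.piSet T n = Metacyclic.piSet Tbar n ∧
        Metacyclic.res (Metacyclic.setPart_dvd ((Metacyclic.piSet T n : Set ℕ)ᶜ) m)
            (Metacyclic.hallPart ((Metacyclic.piSet T n : Set ℕ)ᶜ) T) =
          Metacyclic.res (Metacyclic.setPart_dvd ((Metacyclic.piSet T n : Set ℕ)ᶜ) m)
            (Metacyclic.hallPart ((Metacyclic.piSet T n : Set ℕ)ᶜ) Tbar) ∧
        ∀ (p : ℕ) (hp : p ∈ Metacyclic.piSet T n),
          Metacyclic.pPart p (Metacyclic.bracket T n s) =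
              Metacyclic.pPart p (Metacyclic.bracket Tbar n s) ∧
            Metacyclic.res (Metacyclic.mixed_dvd T n s hp) (Metacyclic.hallPart {p} T) =
              Metacyclic.res (Metacyclic.mixed_dvd T n s hp) (Metacyclic.hallPart {p} Tbar)
    ] := by
  obtain ⟨u, hut, rfl⟩ := ht
  obtain ⟨u', hut', rfl⟩ := htbar
  have : NeZero m := ⟨hm.ne'⟩
  have hrep : ∀ w : (ZMod m)ˣ, ∃ k : ℕ, 1 ≤ k ∧ (w : ZMod m) = k := fun w =>
    ⟨(w : ZMod m).val + m, by omega, by simp⟩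
  obtain ⟨k, hk, hu⟩ := hrep u
  obtain ⟨k', hk', hu'⟩ := hrep u'
  have hmem := hT.le_unitsSub (Subgroup.mem_zpowers u)
  have hmem' := hTbar.le_unitsSub (Subgroup.mem_zpowers u')
  have hP := Metacyclic.presented_isPair hn u' hut' hu' hmem'
  tfae_have 1 → 2 := by
    rw [Metacyclic.nonempty_mulEquiv_iff hm hn u hut hu hmem]
    rintro ⟨x, y, h⟩
    obtain ⟨hb, hres⟩ := Metacyclic.res_eq_of_pairs h hP hm hn hs hsm hk hk' hu hu' hT hTbar
    exact (Metacyclic.res_congr hb _ _).mpr hres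
  tfae_have 2 → 1 := by
    intro h
    have hb := congrArg Sigma.fst h
    have hres := (Metacyclic.res_congr hb _ _).mp h
    have hres' := (Metacyclic.res_congr hb.symm _ _).mp h.symm
    rw [Metacyclic.nonempty_mulEquiv_iff hm hn u hut hu hmem]
    exact Metacyclic.exists_pair_of_res_eq hP hm hn hs hsm hk hu' hu hTbar hmem hb.symm hres'
  tfae_have 2 → 3 := by
    intro h
    have hb := congrArg Sigma.fst h
    exact Metacyclic.local_of_res_eq hm hu hu' hb ((Metacyclic.res_congr hb _ _).mp h)
  tfae_have 3 → 2 := by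
    rintro ⟨hπ, h1, h2⟩
    obtain ⟨hb, hres⟩ := Metacyclic.res_eq_of_local hm hu hu' hπ h1 h2
    exact (Metacyclic.res_congr hb _ _).mpr hres
  tfae_finish
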